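/- Let $n\ge 0$, $a>0$, and let $H:(-2a,2a)\to\mathbb C^{n\times n}$ be an even matrix function ($H(-t)=H(t)$ for almost every $t$) with entries in $L_1(-2a,2a)$. Suppose that for every $\xi\in(0,a]$ the equation $$q(t,\xi)+\int_{-\xi}^{\xi}H(t-s)\,q(s,\xi)\,ds=I,\qquad -\xi\le t\le\xi,$$ has a unique continuous matrix solution $q(\cdot,\xi)$, and that, with $M(\xi)=\int_0^\xi q(s,\xi)\,ds$, one has $\det M'(\xi)\ne0$ for all $\xi\in[0,a]$. Then $M$ is differentiable on $[0,a]$, for every $\xi\in(0,a]$ the transposed equation $$q^*(t,\xi)+\int_{-\xi}^{\xi}q^*(s,\xi)\,H(s-t)\,ds=I,\qquad -\xi\le t\le\xi,$$ also has a unique continuous matrix solution $q^*(\cdot,\xi)$, and for every continuous $f:[-a,a]\to\mathbb C^n$ the equation $$\phi(t)+\int_{-a}^{a}H(t-s)\,\phi(s)\,ds=f(t),\qquad -a\le t\le a,$$ has a unique continuous solution $\phi:[-a,a]\to\mathbb C^n$. It is given, for all $t\in[-a,a]$, by $$\phi(t)=\tfrac12\,q(t,a)\,F(a)-\tfrac12\int_{|t|}^{a}q(t,\xi)\,dF(\xi)-\tfrac12\,\frac{d}{dt}\int_{|t|}^{a}q(t,\xi)\,M'(\xi)^{-1}\Bigl(\int_{-\xi}^{\xi}q^*(s,\xi)\,df(s)\Bigr)d\xi,$$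 $$F(\xi)=M'(\xi)^{-1}\,\frac{d}{d\xi}\int_{-\xi}^{\xi}q^*(s,\xi)\,f(s)\,ds\qquad(0\le\xi\le a),$$ where all derivatives exist (one-sided at end points of the intervals), the integrals $\int q\,dF$ and $\int q^*\,df$ exist as Riemann–Stieltjes integrals, and the integral with respect to $d\xi$ is an ordinary Lebesgue integral. If $F$ is absolutely continuous on $[0,a]$, then $\int_{|t|}^{a}q(t,\xi)\,dF(\xi)=\int_{|t|}^{a}q(t,\xi)\,F'(\xi)\,d\xi$ for all $t\in[-a,a]$, the latter as a Lebesgue integral. -/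

import Mathlib

open Set MeasureTheory

open scoped Matrix

noncomputable section

/-- `Q` is a continuous matrix solution on `[-ξ, ξ]` of
`Q(t) + ∫_{-ξ}^{ξ} H(t - s) Q(s) ds = I`. The integral is taken entrywise. -/
def IsTruncatedSol {n : ℕ} (H : ℝ → Matrix (Fin n) (Fin n) ℂ) (ξ : ℝ)
    (Q : ℝ → Matrix (Fin n) (Fin n) ℂ) : Prop :=
  ContinuousOn Q (Icc (-ξ) ξ) ∧
    ∀ t ∈ Icc (-ξ) ξ, ∀ i j,
      Q t i j + ∫ s in (-ξ)..ξ, (H (t - s) * Q s) i j = (1 : Matrix (Fin n) (Fin n) ℂ) i j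

/-- `Q` is a continuous matrix solution on `[-ξ, ξ]` of the transposed ("starred") equation
`Q(t) + ∫_{-ξ}^{ξ} Q(s) H(s - t) ds = I`. -/
def IsTruncatedSolStar {n : ℕ} (H : ℝ → Matrix (Fin n) (Fin n) ℂ) (ξ : ℝ)
    (Q : ℝ → Matrix (Fin n) (Fin n) ℂ) : Prop :=
  ContinuousOn Q (Icc (-ξ) ξ) ∧
    ∀ t ∈ Icc (-ξ) ξ, ∀ i j,
      Q t i j + ∫ s in (-ξ)..ξ, (Q s * H (s - t)) i j = (1 : Matrix (Fin n) (Fin n) ℂ) i j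

/-- `φ` is a continuous vector solution on `[-a, a]` of
`φ(t) + ∫_{-a}^{a} H(t - s) φ(s) ds = f(t)`. -/
def IsSystemSol {n : ℕ} (H : ℝ → Matrix (Fin n) (Fin n) ℂ) (a : ℝ)
    (f φ : ℝ → Fin n → ℂ) : Prop :=
  ContinuousOn φ (Icc (-a) a) ∧
    ∀ t ∈ Icc (-a) a, φ t + ∫ s in (-a)..a, H (t - s) *ᵥ φ s = f t

/-- The Riemann–Stieltjes integral `∫_c^d g(s) dF(s)` (matrix times vector, `c ≤ d`) exists and
equals `L`: the sums `∑ g(τ_k) (F(x_{k+1}) - F(x_k))` over tagged partitions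
`c = x_0 ≤ τ_0 ≤ x_1 ≤ ⋯ ≤ x_N = d` converge to `L` as the mesh tends to zero. -/
def HasStieltjesIntegral {n : ℕ} (g : ℝ → Matrix (Fin n) (Fin n) ℂ) (F : ℝ → Fin n → ℂ)
    (c d : ℝ) (L : Fin n → ℂ) : Prop :=
  ∀ ε : ℝ, 0 < ε → ∃ δ : ℝ, 0 < δ ∧ ∀ (N : ℕ) (x τ : ℕ → ℝ), x 0 = c → x N = d →
    (∀ k < N, x k ≤ τ k ∧ τ k ≤ x (k + 1) ∧ x (k + 1) - x k < δ) →
      ‖(∑ k ∈ Finset.range N, g (τ k) *ᵥ (F (x (k + 1)) - F (x k))) - L‖ < ε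

/-- `M(ξ) = ∫_0^ξ q(s, ξ) ds`, entrywise. -/
def kreinM {n : ℕ} (q : ℝ → ℝ → Matrix (Fin n) (Fin n) ℂ) (ξ : ℝ) :
    Matrix (Fin n) (Fin n) ℂ :=
  Matrix.of fun i j => ∫ s in (0 : ℝ)..ξ, q s ξ i j

/-- The derivative `M'(ξ)` on `[0, a]` (one-sided at the end points), entrywise. -/
def kreinM' {n : ℕ} (a : ℝ) (q : ℝ → ℝ → Matrix (Fin n) (Fin n) ℂ) (ξ : ℝ) :
    Matrix (Fin n) (Fin n) ℂ :=
  Matrix.of fun i j => derivWithin (fun η => kreinM q η i j) (Icc 0 a) ξ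

/-- `∫_{-ξ}^{ξ} p(s, ξ) f(s) ds`. -/
def truncPairing {n : ℕ} (p : ℝ → ℝ → Matrix (Fin n) (Fin n) ℂ) (f : ℝ → Fin n → ℂ) (ξ : ℝ) :
    Fin n → ℂ :=
  ∫ s in (-ξ)..ξ, p s ξ *ᵥ f s

/-- `F(ξ) = M'(ξ)⁻¹ (d/dξ) ∫_{-ξ}^{ξ} p(s, ξ) f(s) ds` on `[0, a]`. -/
def kreinDensity {n : ℕ} (a : ℝ) (q p : ℝ → ℝ → Matrix (Fin n) (Fin n) ℂ)
    (f : ℝ → Fin n → ℂ) (ξ : ℝ) : Fin n → ℂ :=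
  (kreinM' a q ξ)⁻¹ *ᵥ derivWithin (truncPairing p f) (Icc 0 a) ξ

/-- `∫_{|t|}^{a} q(t, ξ) M'(ξ)⁻¹ S(ξ) dξ`. -/
def kreinPotential {n : ℕ} (a : ℝ) (q : ℝ → ℝ → Matrix (Fin n) (Fin n) ℂ)
    (S : ℝ → Fin n → ℂ) (t : ℝ) : Fin n → ℂ :=
  ∫ ξ in |t|..a, q t ξ *ᵥ ((kreinM' a q ξ)⁻¹ *ᵥ S ξ)

end

/-!
Write `T_ξ` for the convolution operator `u ↦ ∫_{-ξ}^{ξ} H(t - s) u(s) ds` on `C[-a, a]`. Each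
`T_ξ` is compact, so the uniqueness hypothesis makes `1 + T_ξ` invertible, and the inverse `R_ξ` is
norm continuous in `ξ` because `T_ξ` is. Put `ψ_ξ = R_ξ f` and `φ = ψ_a`; since `H` is even, `R_ξ`
commutes with the reflection `t ↦ -t`, and the even and odd parts of `f` can be treated apart.

* Differentiating `∫_{-ξ}^{ξ} q*(s, ξ) f(s) ds` gives `q*(ξ, ξ) (ψ_ξ(ξ) + ψ_ξ(-ξ))`. For `f = 1`
  this is `2 M'(ξ) = 2 q*(ξ, ξ) q(ξ, ξ)`, so `q(ξ, ξ)` is invertible and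
  `F(ξ) = q(ξ, ξ)⁻¹ (ψ_ξ(ξ) + ψ_ξ(-ξ))`.
* For `f` even, `R_ξ' f - R_ξ f = -R_ξ (T_ξ' - T_ξ) R_ξ' f` only involves `ψ_ξ'` on the thin shell
  `ξ < |s| ≤ ξ'`, where it is close to its boundary value `½ q(ξ, ξ) F(ξ)`, and `q(·, ξ)` varies in
  the same way. Summation by parts over a partition of `[|t|, a]` then turns the Stieltjes sums of
  `∫ q dF` into `q(t, a) F(a) - 2 φ(t)` up to a small error.
* For `f` odd, `∫_t^ξ ψ_ξ` solves a truncated equation up to additive constants, and its derivative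
  in `ξ` is `q(t, ξ) q(ξ, ξ)⁻¹ ψ_ξ(ξ)`; integrating in `ξ` gives the last term of the formula.
* `q*(·, ξ)` need not have bounded variation. The Stieltjes sums of `∫ q* df` converge because,
  after summation by parts, they are difference quotients of a convolution paired with the
  continuous function `ψ_ξ`.
-/

noncomputable section

open Filter Topology

theorem tendsto_integral_norm_vadd_sub {X M F : Type*} [TopologicalSpace X] [R1Space X]
    [MeasurableSpace X] [BorelSpace X] [AddMonoid M] [TopologicalSpace M] [MeasurableSpace M]
    [OpensMeasurableSpace M] [AddAction M X] [ContinuousVAdd M X] [NormedAddCommGroup F]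
    {μ : Measure X} [IsLocallyFiniteMeasure μ] [μ.InnerRegularCompactLTTop]
    [VAddInvariantMeasure M X μ] {f : X → F} (hf : Integrable f μ) :
    Tendsto (fun c : M => ∫ x, ‖f (c +ᵥ x) - f x‖ ∂μ) (𝓝 0) (𝓝 0) := by
  have : Fact ((1 : ENNReal) ≠ ⊤) := ⟨ENNReal.one_ne_top⟩
  have hf' : MemLp f 1 μ := memLp_one_iff_integrable.2 hf
  have hc : Continuous fun c : M => dist (DomAddAct.mk c +ᵥ hf'.toLp f) (hf'.toLp f) :=
    ((DomAddAct.continuous_mk.vadd continuous_const).dist continuous_const)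
  convert hc.tendsto 0 using 2 with c
  · rw [DomAddAct.mk_vadd_toLp, dist_eq_norm, ← MemLp.toLp_sub, L1.norm_eq_integral_norm]
    refine integral_congr_ae (EventuallyEq.symm ?_)
    exact (MemLp.coeFn_toLp _).mono fun x hx => congrArg norm hx
  · simp

theorem exists_setIntegral_norm_lt {X F : Type*} [MeasurableSpace X] [NormedAddCommGroup F]
    {μ : Measure X} {f : X → F} (hf : Integrable f μ) {ε : ℝ} (hε : 0 < ε) :
    ∃ δ > 0, ∀ S, μ S < ENNReal.ofReal δ → ∫ x in S, ‖f x‖ ∂μ < ε := by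
  have h := hf.norm.tendsto_setIntegral_nhds_zero (s := id) (tendsto_comap (f := μ) (x := 𝓝 0))
  obtain ⟨δ, hδ, hS⟩ := (ENNReal.nhds_zero_basis.comap μ).eventually_iff.1
    (h.eventually_lt_const hε)
  obtain ⟨r, hr, hrδ⟩ := ENNReal.lt_iff_exists_nnreal_btwn.1 hδ
  exact ⟨r, by simpa using hr, fun S h => hS (h.trans (by simpa using hrδ))⟩

theorem uniformContinuousOn_of_increments {F : Type*} [PseudoMetricSpace F] {f : ℝ → F}
    {s : Set ℝ} (hf : ∀ ε > 0, ∃ δ > 0, ∀ x ∈ s, ∀ y ∈ s, x ≤ y → y - x < δ →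
      dist (f y) (f x) ≤ ε) : UniformContinuousOn f s := by
  refine Metric.uniformContinuousOn_iff_le.2 fun ε hε => ?_
  obtain ⟨δ, hδ, h⟩ := hf ε hε
  refine ⟨δ / 2, half_pos hδ, fun x hx y hy hxy => ?_⟩
  rw [Real.dist_eq, abs_le] at hxy
  rcases le_total x y with hle | hle
  · rw [dist_comm]
    exact h x hx y hy hle (by linarith)
  · exact h y hy x hx hle (by linarith)

theorem hasDerivWithinAt_of_increments {F : Type*} [NormedAddCommGroup F] [NormedSpace ℝ F]
    {f f' : ℝ → F} {s : Set ℝ} (hf' : ContinuousOn f' s)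
    (h : ∀ ε > 0, ∃ δ > 0, ∀ x ∈ s, ∀ y ∈ s, x ≤ y → y - x < δ →
      ‖f y - f x - (y - x) • f' x‖ ≤ ε * (y - x)) {x : ℝ} (hx : x ∈ s) :
    HasDerivWithinAt f (f' x) s x := by
  rw [hasDerivWithinAt_iff_isLittleO, Asymptotics.isLittleO_iff]
  intro ε hε
  obtain ⟨δ, hδ, hf⟩ := h (ε / 2) (half_pos hε)
  obtain ⟨δ', hδ', hclose⟩ := Metric.continuousOn_iff.1 hf' x hx (ε / 2) (half_pos hε)
  filter_upwards [self_mem_nhdsWithin, mem_nhdsWithin_of_mem_nhds (Metric.ball_mem_nhds x hδ),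
    mem_nhdsWithin_of_mem_nhds (Metric.ball_mem_nhds x hδ')] with y hy hyδ hyδ'
  rw [Metric.mem_ball, Real.dist_eq] at hyδ
  rcases le_total x y with hle | hle
  · refine (hf x hx y hy hle ((le_abs_self _).trans_lt hyδ)).trans ?_
    rw [Real.norm_eq_abs, abs_of_nonneg (sub_nonneg.2 hle)]
    nlinarith [sub_nonneg.2 hle]
  · have hyx := hf y hy x hx hle ((le_abs_self _).trans_lt (by rwa [abs_sub_comm]))
    have hslope := (hclose y hy hyδ').le
    rw [dist_eq_norm] at hslope
    have hsplit : f y - f x - (y - x) • f' x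
        = -(f x - f y - (x - y) • f' y) - (x - y) • (f' y - f' x) := by module
    rw [hsplit, Real.norm_eq_abs, abs_of_nonpos (sub_nonpos.2 hle)]
    refine (norm_sub_le _ _).trans ?_
    rw [norm_neg, norm_smul, Real.norm_eq_abs, abs_of_nonneg (sub_nonneg.2 hle)]
    nlinarith [sub_nonneg.2 hle]

theorem exists_norm_sub_diag_le {X F : Type*} [PseudoMetricSpace X] [NormedAddCommGroup F]
    {K : Set X} (hK : IsCompact K) {Φ : X × X × X → F} (hΦ : Continuous Φ) {ε : ℝ} (hε : 0 < ε) :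
    ∃ δ > 0, ∀ r ∈ K, ∀ x ∈ K, ∀ y ∈ K, ∀ z ∈ K, dist x r < δ → dist y r < δ → dist z r < δ →
      ‖Φ (x, y, z) - Φ (r, r, r)‖ ≤ ε := by
  have h := (hK.prod (hK.prod hK)).uniformContinuousOn_of_continuous hΦ.continuousOn
  obtain ⟨δ, hδ, hΦδ⟩ := Metric.uniformContinuousOn_iff.1 h ε hε
  refine ⟨δ, hδ, fun r hr x hx y hy z hz dx dy dz => ?_⟩
  have hdist : dist (x, y, z) (r, r, r) < δ := max_lt dx (max_lt dy dz)
  rw [← dist_eq_norm]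
  exact (hΦδ (x, y, z) ⟨hx, hy, hz⟩ (r, r, r) ⟨hr, hr, hr⟩ hdist).le

/-- `u` is a.e. strongly measurable and everywhere bounded in norm by `C`: the class of functions
on which convolution with an integrable kernel is defined and continuous. -/
structure BddMeas {E : Type*} [NormedAddCommGroup E] (u : ℝ → E) (C : ℝ) : Prop where
  aestronglyMeasurable : AEStronglyMeasurable u
  norm_le : ∀ s, ‖u s‖ ≤ C

namespace BddMeas

variable {E : Type*} [NormedAddCommGroup E] {u v : ℝ → E} {C D : ℝ}

theorem nonneg (hu : BddMeas u C) : 0 ≤ C := (norm_nonneg _).trans (hu.norm_le 0)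

theorem indicator (hu : BddMeas u C) {s : Set ℝ} (hs : MeasurableSet s) :
    BddMeas (s.indicator u) C :=
  ⟨hu.aestronglyMeasurable.indicator hs,
    fun t => (norm_indicator_le_norm_self u t).trans (hu.norm_le t)⟩

theorem add (hu : BddMeas u C) (hv : BddMeas v D) : BddMeas (fun s => u s + v s) (C + D) :=
  ⟨hu.aestronglyMeasurable.add hv.aestronglyMeasurable,
    fun s => norm_add_le_of_le (hu.norm_le s) (hv.norm_le s)⟩

theorem sub (hu : BddMeas u C) (hv : BddMeas v D) : BddMeas (fun s => u s - v s) (C + D) :=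
  ⟨hu.aestronglyMeasurable.sub hv.aestronglyMeasurable,
    fun s => norm_sub_le_of_le (hu.norm_le s) (hv.norm_le s)⟩

theorem mono (hu : BddMeas u C) (h : C ≤ D) : BddMeas u D :=
  ⟨hu.aestronglyMeasurable, fun s => (hu.norm_le s).trans h⟩

theorem integrableOn (hu : BddMeas u C) {s : Set ℝ} (hs : volume s ≠ ⊤) : IntegrableOn u s :=
  Measure.integrableOn_of_bounded hs hu.aestronglyMeasurable (M := C) (ae_of_all _ hu.norm_le)

theorem integrable_indicator (hu : BddMeas u C) {s : Set ℝ} (hm : MeasurableSet s)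
    (hs : volume s ≠ ⊤) : Integrable (s.indicator u) :=
  (integrable_indicator_iff hm).2 (hu.integrableOn hs)

end BddMeas

section Shell

/-- The shell `{ξ < |s| ≤ ξ'}` up to end points. -/
def shell (ξ ξ' : ℝ) : Set ℝ := Ioc (-ξ') ξ' \ Ioc (-ξ) ξ

variable {ξ ξ' : ℝ}

theorem measurableSet_shell (ξ ξ' : ℝ) : MeasurableSet (shell ξ ξ') :=
  measurableSet_Ioc.diff measurableSet_Ioc

theorem volume_shell (h0 : 0 ≤ ξ) (h : ξ ≤ ξ') :
    volume (shell ξ ξ') = ENNReal.ofReal (2 * (ξ' - ξ)) := by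
  rw [shell, measure_sdiff (Ioc_subset_Ioc (by linarith) h) measurableSet_Ioc.nullMeasurableSet
    (by simp), Real.volume_Ioc, Real.volume_Ioc, ← ENNReal.ofReal_sub _ (by linarith)]
  congr 1
  ring

theorem shell_subset (ξ ξ' : ℝ) : shell ξ ξ' ⊆ Ioc (-ξ') ξ' := sdiff_subset

theorem abs_mem_of_mem_shell {s : ℝ} (hs : s ∈ shell ξ ξ') : |s| ∈ Icc ξ ξ' := by
  obtain ⟨⟨hl, hr⟩, hout⟩ := hs
  refine ⟨?_, abs_le.2 ⟨hl.le, hr⟩⟩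
  by_contra! h
  exact hout ⟨(abs_lt.1 h).1, (abs_lt.1 h).2.le⟩

theorem shell_eq_union (h0 : 0 ≤ ξ) : shell ξ ξ' = Ioc (-ξ') (-ξ) ∪ Ioc ξ ξ' := by
  ext s
  simp only [shell, Set.mem_sdiff, mem_union, mem_Ioc]
  grind

variable {F : Type*} [NormedAddCommGroup F] [NormedSpace ℝ F] [CompleteSpace F] {g : ℝ → F}

theorem norm_setIntegral_Ioc_sub_le {c d ε : ℝ} {x : F} (hcd : c ≤ d)
    (hg : IntegrableOn g (Ioc c d)) (h : ∀ s ∈ Icc c d, ‖g s - x‖ ≤ ε) :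
    ‖(∫ s in Ioc c d, g s) - (d - c) • x‖ ≤ ε * (d - c) := by
  have hx : (d - c) • x = ∫ _ in Ioc c d, x := by
    rw [setIntegral_const, Real.volume_real_Ioc_of_le hcd]
  rw [hx, ← integral_sub hg (integrableOn_const (by simp))]
  refine (norm_setIntegral_le_of_norm_le_const (by simp) fun s hs =>
    h s (Ioc_subset_Icc_self hs)).trans_eq ?_
  rw [Real.volume_real_Ioc_of_le hcd]

theorem norm_setIntegral_shell_sub_le {ε : ℝ} {x y : F} (h0 : 0 ≤ ξ) (hle : ξ ≤ ξ')
    (hg : IntegrableOn g (Ioc (-ξ') ξ')) (hx : ∀ s ∈ Icc ξ ξ', ‖g s - x‖ ≤ ε)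
    (hy : ∀ s ∈ Icc ξ ξ', ‖g (-s) - y‖ ≤ ε) :
    ‖(∫ s in shell ξ ξ', g s) - (ξ' - ξ) • (x + y)‖ ≤ 2 * ε * (ξ' - ξ) := by
  have hgl : IntegrableOn g (Ioc (-ξ') (-ξ)) :=
    hg.mono_set (Ioc_subset_Ioc le_rfl (by linarith))
  have hgr : IntegrableOn g (Ioc ξ ξ') := hg.mono_set (Ioc_subset_Ioc (by linarith) le_rfl)
  have hr := norm_setIntegral_Ioc_sub_le hle hgr hx
  have hl := norm_setIntegral_Ioc_sub_le (neg_le_neg hle) hgl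
    (x := y) (ε := ε) fun s hs => by
      simpa using hy (-s) ⟨le_neg.1 hs.2, neg_le.1 hs.1⟩
  have hdisj : Disjoint (Ioc (-ξ') (-ξ)) (Ioc ξ ξ') :=
    Set.disjoint_left.2 fun s hs hs' => by linarith [hs.2, hs'.1]
  rw [neg_sub_neg] at hl
  rw [shell_eq_union h0, setIntegral_union hdisj measurableSet_Ioc hgl hgr, smul_add,
    add_comm (_ • x), add_sub_add_comm]
  exact (norm_add_le_of_le hl hr).trans_eq (by ring)

end Shell

section RiemannStieltjes

/-- `c = x 0 ≤ τ 0 ≤ x 1 ≤ ⋯ ≤ x N = d` is a tagged partition with `N` steps, all shorter than `δ`.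
The values of `x` beyond `N` and of `τ` beyond `N - 1` play no role. -/
structure IsTaggedPartition (c d δ : ℝ) (N : ℕ) (x τ : ℕ → ℝ) : Prop where
  first : x 0 = c
  last : x N = d
  le_tag : ∀ k < N, x k ≤ τ k
  tag_le : ∀ k < N, τ k ≤ x (k + 1)
  step_lt : ∀ k < N, x (k + 1) - x k < δ

theorem le_of_forall_le_succ {α : Type*} [Preorder α] {N : ℕ} {y : ℕ → α}
    (hy : ∀ k < N, y k ≤ y (k + 1)) {i j : ℕ} (hij : i ≤ j) (hj : j ≤ N) : y i ≤ y j := by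
  induction j, hij using Nat.le_induction with
  | base => exact le_rfl
  | succ m _ ih => exact (ih (by omega)).trans (hy m (by omega))

/-- The points `x 0, τ 0, …, τ (N - 1), x N` of a tagged partition. -/
def tagPoints (N : ℕ) (x τ : ℕ → ℝ) : ℕ → ℝ
  | 0 => x 0
  | k + 1 => if k < N then τ k else x N

theorem tagPoints_succ {N : ℕ} {x τ : ℕ → ℝ} {k : ℕ} (hk : k < N) :
    tagPoints N x τ (k + 1) = τ k := if_pos hk

theorem tagPoints_last {N : ℕ} {x τ : ℕ → ℝ} : tagPoints N x τ (N + 1) = x N :=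
  if_neg (lt_irrefl N)

namespace IsTaggedPartition

variable {c d δ : ℝ} {N : ℕ} {x τ : ℕ → ℝ} {k : ℕ}

theorem mesh_mono (h : IsTaggedPartition c d δ N x τ) {δ' : ℝ} (hδ : δ ≤ δ') :
    IsTaggedPartition c d δ' N x τ :=
  { h with step_lt := fun k hk => (h.step_lt k hk).trans_le hδ }

theorem le_succ (h : IsTaggedPartition c d δ N x τ) : ∀ k < N, x k ≤ x (k + 1) :=
  fun k hk => (h.le_tag k hk).trans (h.tag_le k hk)

theorem mem_Icc (h : IsTaggedPartition c d δ N x τ) (hk : k ≤ N) : x k ∈ Icc c d :=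
  ⟨h.first ▸ le_of_forall_le_succ h.le_succ k.zero_le hk,
    h.last ▸ le_of_forall_le_succ h.le_succ hk le_rfl⟩

theorem tag_mem_Icc (h : IsTaggedPartition c d δ N x τ) (hk : k < N) : τ k ∈ Icc c d :=
  ⟨(h.mem_Icc hk.le).1.trans (h.le_tag k hk), (h.tag_le k hk).trans (h.mem_Icc hk).2⟩

theorem tagPoints_le (h : IsTaggedPartition c d δ N x τ) (hk : k < N + 1) :
    tagPoints N x τ k ≤ x k := by
  cases k with
  | zero => exact le_rfl
  | succ j => rw [tagPoints_succ (by omega)]; exact h.tag_le j (by omega)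

theorem le_tagPoints (h : IsTaggedPartition c d δ N x τ) (hk : k < N + 1) :
    x k ≤ tagPoints N x τ (k + 1) := by
  rcases Nat.lt_succ_iff_lt_or_eq.1 hk with hk | rfl
  · rw [tagPoints_succ hk]
    exact h.le_tag k hk
  · rw [tagPoints_last]

theorem sub_tagPoints_lt (h : IsTaggedPartition c d δ N x τ) (hδ : 0 < δ) (hk : k < N + 1) :
    x k - tagPoints N x τ k < δ := by
  cases k with
  | zero => simpa [tagPoints] using hδ
  | succ j =>
    rw [tagPoints_succ (by omega)]
    linarith [h.le_tag j (by omega), h.step_lt j (by omega)]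

theorem tagPoints_sub_lt (h : IsTaggedPartition c d δ N x τ) (hδ : 0 < δ) (hk : k < N + 1) :
    tagPoints N x τ (k + 1) - x k < δ := by
  rcases Nat.lt_succ_iff_lt_or_eq.1 hk with hk | rfl
  · rw [tagPoints_succ hk]
    linarith [h.tag_le k hk, h.step_lt k hk]
  · rwa [tagPoints_last, sub_self]

theorem abs_sub_lt_of_mem_Ioc_tagPoints (h : IsTaggedPartition c d δ N x τ) (hδ : 0 < δ)
    (hk : k < N + 1) {s : ℝ} (hs : s ∈ Ioc (tagPoints N x τ k) (tagPoints N x τ (k + 1))) :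
    |x k - s| < δ :=
  abs_lt.2 ⟨by linarith [hs.2, h.tagPoints_sub_lt hδ hk],
    by linarith [hs.1, h.sub_tagPoints_lt hδ hk]⟩

theorem tagPoints_le_succ (h : IsTaggedPartition c d δ N x τ) :
    ∀ k < N + 1, tagPoints N x τ k ≤ tagPoints N x τ (k + 1) := fun _ hk =>
  (h.tagPoints_le hk).trans (h.le_tagPoints hk)

end IsTaggedPartition

theorem exists_isTaggedPartition {c d δ : ℝ} (hcd : c ≤ d) (hδ : 0 < δ) :
    ∃ N x τ, IsTaggedPartition c d δ N x τ := by
  obtain ⟨N, hN⟩ := exists_nat_gt ((d - c) / δ)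
  have hN0 : (0 : ℝ) < N := (div_nonneg (sub_nonneg.2 hcd) hδ.le).trans_lt hN
  have hstep : 0 ≤ (d - c) / N := div_nonneg (sub_nonneg.2 hcd) hN0.le
  refine ⟨N, fun i => c + i * ((d - c) / N), fun i => c + i * ((d - c) / N), by simp,
    by field_simp; ring, fun _ _ => le_rfl, fun k _ => ?_, fun k _ => ?_⟩
  · push_cast
    linarith
  · rw [div_lt_comm₀ hδ hN0] at hN
    push_cast
    linarith

variable {𝕜 E F : Type*} [NontriviallyNormedField 𝕜] [NormedAddCommGroup E] [NormedSpace 𝕜 E]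
  [NormedAddCommGroup F] [NormedSpace 𝕜 F] {g g' : ℝ → E →L[𝕜] F} {f f' : ℝ → E} {c d : ℝ}
  {L L' : F}

/-- The Riemann–Stieltjes sum of `∫ g df` belonging to a tagged partition. -/
def rsSum (g : ℝ → E →L[𝕜] F) (f : ℝ → E) (N : ℕ) (x τ : ℕ → ℝ) : F :=
  ∑ k ∈ Finset.range N, g (τ k) (f (x (k + 1)) - f (x k))

/-- The Riemann–Stieltjes integral `∫_c^d g df` of an operator-valued function against a
vector-valued one exists, as a limit along the mesh of tagged partitions, and equals `L`. -/
def HasRSIntegral (g : ℝ → E →L[𝕜] F) (f : ℝ → E) (c d : ℝ) (L : F) : Prop :=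
  ∀ ε > 0, ∃ δ > 0, ∀ N x τ, IsTaggedPartition c d δ N x τ → ‖rsSum g f N x τ - L‖ < ε

theorem rsSum_eq_sub_sum_tagPoints (g : ℝ → E →L[𝕜] F) (f : ℝ → E) (N : ℕ) (x τ : ℕ → ℝ) :
    rsSum g f N x τ = g (x N) (f (x N)) - g (x 0) (f (x 0)) - ∑ k ∈ Finset.range (N + 1),
      (g (tagPoints N x τ (k + 1)) - g (tagPoints N x τ k)) (f (x k)) := by
  have abel_summation (Q : ℕ → E →L[𝕜] F) (v : ℕ → E) (n : ℕ) :
      ∑ k ∈ Finset.range n, Q (k + 1) (v (k + 1) - v k) = Q (n + 1) (v n) - Q 0 (v 0) -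
        ∑ k ∈ Finset.range (n + 1), (Q (k + 1) - Q k) (v k) := by
    induction n with
    | zero => simp
    | succ n ih =>
      rw [Finset.sum_range_succ, ih, Finset.sum_range_succ _ (n + 1)]
      simp only [map_sub, _root_.sub_apply]
      abel
  have h := abel_summation (fun k => g (tagPoints N x τ k)) (fun k => f (x k)) N
  simp only [tagPoints_last] at h
  refine (Finset.sum_congr rfl fun k hk => ?_).trans h
  rw [tagPoints_succ (Finset.mem_range.1 hk)]

namespace HasRSIntegral

theorem unique (hcd : c ≤ d) (h : HasRSIntegral g f c d L) (h' : HasRSIntegral g f c d L') :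
    L = L' := by
  refine sub_eq_zero.1 (norm_le_zero_iff.1 (le_of_forall_pos_le_add fun ε hε => ?_))
  obtain ⟨δ, hδ, hL⟩ := h (ε / 2) (half_pos hε)
  obtain ⟨δ', hδ', hL'⟩ := h' (ε / 2) (half_pos hε)
  obtain ⟨N, x, τ, hp⟩ := exists_isTaggedPartition hcd (lt_min hδ hδ')
  have hclose := hL N x τ (hp.mesh_mono (min_le_left _ _))
  have hclose' := hL' N x τ (hp.mesh_mono (min_le_right _ _))
  rw [norm_sub_rev] at hclose
  linarith [norm_sub_le_norm_sub_add_norm_sub L (rsSum g f N x τ) L']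

theorem refl (g : ℝ → E →L[𝕜] F) (f : ℝ → E) (c : ℝ) : HasRSIntegral g f c c 0 :=
  fun ε hε => ⟨1, one_pos, fun N x τ hp => by
    have hx : ∀ k ≤ N, x k = c := fun k hk => by simpa using hp.mem_Icc hk
    have hsum : rsSum g f N x τ = 0 := Finset.sum_eq_zero fun k hk => by
      rw [Finset.mem_range] at hk
      rw [hx k hk.le, hx (k + 1) hk, sub_self, map_zero]
    rwa [hsum, sub_zero, norm_zero]⟩

theorem add_left (h : HasRSIntegral g f c d L) (h' : HasRSIntegral g' f c d L') :
    HasRSIntegral (g + g') f c d (L + L') := fun ε hε => by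
  obtain ⟨δ, hδ, hL⟩ := h (ε / 2) (half_pos hε)
  obtain ⟨δ', hδ', hL'⟩ := h' (ε / 2) (half_pos hε)
  refine ⟨min δ δ', lt_min hδ hδ', fun N x τ hp => ?_⟩
  have hsum : rsSum (g + g') f N x τ = rsSum g f N x τ + rsSum g' f N x τ :=
    Finset.sum_add_distrib
  rw [hsum, add_sub_add_comm]
  refine (norm_add_le _ _).trans_lt ?_
  linarith [hL N x τ (hp.mesh_mono (min_le_left _ _)), hL' N x τ (hp.mesh_mono (min_le_right _ _))]

theorem congr (h : HasRSIntegral g f c d L) (hg : EqOn g' g (Icc c d))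
    (hf : EqOn f' f (Icc c d)) : HasRSIntegral g' f' c d L := fun ε hε => by
  obtain ⟨δ, hδ, hL⟩ := h ε hε
  refine ⟨δ, hδ, fun N x τ hp => ?_⟩
  have hsum : rsSum g' f' N x τ = rsSum g f N x τ := Finset.sum_congr rfl fun k hk => by
    rw [Finset.mem_range] at hk
    rw [hg (hp.tag_mem_Icc hk), hf (hp.mem_Icc hk), hf (hp.mem_Icc hk.le)]
  rw [hsum]
  exact hL N x τ hp

end HasRSIntegral

open Classical in
/- Only the leading steps can have the tag `c`, so their contributions telescope. -/
theorem IsTaggedPartition.exists_rsSum_single_eq {δ : ℝ} (hδ : 0 < δ) {N : ℕ} {x τ : ℕ → ℝ}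
    (hp : IsTaggedPartition c d δ N x τ) (f : ℝ → E) (B : E →L[𝕜] F) {M : ℕ} (hM : M ≤ N) :
    ∃ y ∈ Icc c d, dist y c < δ ∧ rsSum (Pi.single c B) f M x τ = B (f y) - B (f c) := by
  induction M with
  | zero => exact ⟨c, hp.first ▸ hp.mem_Icc N.zero_le, by simpa using hδ, by simp [rsSum]⟩
  | succ M ih =>
    by_cases hτ : τ M = c
    · have hx : ∀ i ≤ M, x i = c := fun i hi => le_antisymm
        ((le_of_forall_le_succ hp.le_succ hi (by omega)).trans ((hp.le_tag M hM).trans_eq hτ))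
        (hp.mem_Icc (by omega)).1
      refine ⟨x (M + 1), hp.mem_Icc hM, ?_, ?_⟩
      · rw [Real.dist_eq, abs_of_nonneg (sub_nonneg.2 (hp.mem_Icc hM).1), ← hx M le_rfl]
        exact hp.step_lt M hM
      · rw [rsSum, Finset.sum_range_succ, hτ, hx M le_rfl, Pi.single_eq_same, map_sub,
          Finset.sum_eq_zero, zero_add]
        intro i hi
        rw [Finset.mem_range] at hi
        rw [hx i hi.le, hx (i + 1) hi, sub_self, map_zero]
    · obtain ⟨y, hy, hyc, hsum⟩ := ih (by omega)
      refine ⟨y, hy, hyc, ?_⟩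
      rw [← hsum, rsSum, Finset.sum_range_succ, Pi.single_eq_of_ne hτ, zero_apply, add_zero, rsSum]

theorem HasRSIntegral.congr_Ioc (h : HasRSIntegral g f c d L)
    (hf : ContinuousWithinAt f (Icc c d) c) (hg : EqOn g' g (Ioc c d)) (hff : EqOn f' f (Icc c d)) :
    HasRSIntegral g' f' c d L := by
  classical
  set B := g' c - g c
  have hsingle : HasRSIntegral (Pi.single c B) f c d 0 := fun ε hε => by
    obtain ⟨δ, hδ, hclose⟩ := Metric.continuousWithinAt_iff.1
      (B.continuous.continuousAt.comp_continuousWithinAt hf) ε hε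
    refine ⟨δ, hδ, fun N x τ hp => ?_⟩
    obtain ⟨y, hy, hyc, hsum⟩ := hp.exists_rsSum_single_eq hδ f B le_rfl
    rw [hsum, sub_zero, ← dist_eq_norm]
    exact hclose hy hyc
  rw [← add_zero L]
  refine (h.add_left hsingle).congr (fun s hs => ?_) hff
  rcases hs.1.eq_or_lt with rfl | hs'
  · simp [B]
  · simp [hg ⟨hs', hs.2⟩, hs'.ne']

end RiemannStieltjes

section AbsoluteContinuity

variable {𝕜 E F : Type*} [RCLike 𝕜] [NormedAddCommGroup E] [NormedSpace 𝕜 E]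
  [NormedAddCommGroup F] [NormedSpace 𝕜 F] {g : ℝ → E →L[𝕜] F} {f h : ℝ → E} {c d : ℝ}

theorem intervalIntegrable_clm_apply (hg : Continuous g) (hh : IntervalIntegrable h volume c d) :
    IntervalIntegrable (fun s => g s (h s)) volume c d := by
  rw [intervalIntegrable_iff] at hh ⊢
  obtain ⟨K, hK⟩ := (isCompact_uIcc (a := c) (b := d)).exists_bound_of_continuousOn hg.continuousOn
  refine (ContinuousLinearMap.id 𝕜 (E →L[𝕜] F)).integrable_of_bilin_of_bdd_left K
    hg.aestronglyMeasurable ?_ hh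
  exact ae_restrict_of_forall_mem measurableSet_uIoc fun s hs => hK s (uIoc_subset_uIcc hs)

variable [NormedSpace ℝ E] [NormedSpace ℝ F] [CompleteSpace E] [CompleteSpace F]

theorem norm_apply_integral_sub_integral_le (hg : Continuous g) {x y τ η : ℝ} (hxy : x ≤ y)
    (hh : IntervalIntegrable h volume x y) (hη : ∀ s ∈ Icc x y, ‖g τ - g s‖ ≤ η) :
    ‖g τ (∫ s in x..y, h s) - ∫ s in x..y, g s (h s)‖ ≤ η * ∫ s in x..y, ‖h s‖ := by
  rw [← (g τ).intervalIntegral_comp_comm hh, ← intervalIntegral.integral_sub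
    (intervalIntegrable_clm_apply continuous_const hh) (intervalIntegrable_clm_apply hg hh),
    ← intervalIntegral.integral_const_mul]
  refine intervalIntegral.norm_integral_le_of_norm_le hxy (ae_of_all _ fun s hs => ?_)
    (hh.norm.const_mul _)
  rw [← _root_.sub_apply]
  exact ContinuousLinearMap.le_of_opNorm_le _ (hη s (Ioc_subset_Icc_self hs)) _

theorem hasRSIntegral_of_primitive (hcd : c ≤ d) (hg : Continuous g)
    (hh : IntervalIntegrable h volume c d)
    (hf : ∀ x ∈ Icc c d, ∀ y ∈ Icc c d, f y - f x = ∫ s in x..y, h s) :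
    HasRSIntegral g f c d (∫ s in c..d, g s (h s)) := fun ε hε => by
  set m := ∫ s in c..d, ‖h s‖
  have hm : 0 ≤ m := intervalIntegral.integral_nonneg hcd fun _ _ => norm_nonneg _
  have hη : ε / (m + 1) * m < ε := by
    rw [div_mul_eq_mul_div, div_lt_iff₀ (by positivity)]
    linarith
  obtain ⟨δ, hδ, hgδ⟩ := Metric.uniformContinuousOn_iff.1
    ((isCompact_Icc (a := c) (b := d)).uniformContinuousOn_of_continuous hg.continuousOn)
    (ε / (m + 1)) (by positivity)
  refine ⟨δ, hδ, fun N x τ hp => lt_of_le_of_lt ?_ hη⟩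
  have hsub : ∀ i < N, uIcc (x i) (x (i + 1)) ⊆ uIcc c d := fun i hi => by
    rw [uIcc_of_le (hp.le_succ i hi), uIcc_of_le hcd]
    exact Icc_subset_Icc (hp.mem_Icc hi.le).1 (hp.mem_Icc hi).2
  have hsplit := intervalIntegral.sum_integral_adjacent_intervals (a := x) (n := N)
    fun i hi => (intervalIntegrable_clm_apply hg hh).mono_set (hsub i hi)
  have hsplit_norm := intervalIntegral.sum_integral_adjacent_intervals (a := x) (n := N)
    fun i hi => hh.norm.mono_set (hsub i hi)
  rw [hp.first, hp.last] at hsplit hsplit_norm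
  rw [← hsplit, rsSum, ← Finset.sum_sub_distrib]
  refine (norm_sum_le_of_le _ fun i hi => ?_).trans_eq
    (by rw [← Finset.mul_sum, hsplit_norm])
  rw [Finset.mem_range] at hi
  rw [hf _ (hp.mem_Icc hi.le) _ (hp.mem_Icc hi)]
  refine norm_apply_integral_sub_integral_le hg (hp.le_succ i hi) (hh.mono_set (hsub i hi))
    fun s hs => ?_
  rw [← dist_eq_norm]
  refine (hgδ _ (hp.tag_mem_Icc hi) s
    ⟨(hp.mem_Icc hi.le).1.trans hs.1, hs.2.trans (hp.mem_Icc hi).2⟩ ?_).le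
  rw [Real.dist_eq, abs_lt]
  constructor <;> linarith [hs.1, hs.2, hp.le_tag i hi, hp.tag_le i hi, hp.step_lt i hi]

end AbsoluteContinuity

section AbsoluteContinuityVector

variable {E F : Type*} [NormedAddCommGroup E] [NormedSpace ℝ E] [NormedAddCommGroup F]
  [NormedSpace ℝ F] {f : ℝ → E} {c d : ℝ}

theorem absolutelyContinuousOnInterval_clm_comp (hf : AbsolutelyContinuousOnInterval f c d)
    (L : E →L[ℝ] F) : AbsolutelyContinuousOnInterval (fun x => L (f x)) c d := by
  refine squeeze_zero (fun t => Finset.sum_nonneg fun i _ => dist_nonneg) (fun t => ?_)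
    (by simpa using! Tendsto.const_mul ‖L‖ hf)
  rw [Finset.mul_sum]
  exact Finset.sum_le_sum fun i _ => L.lipschitz.dist_le_mul _ _

variable [FiniteDimensional ℝ E]

theorem ae_deriv_clm_comp_eq (hf : AbsolutelyContinuousOnInterval f c d) :
    ∀ᵐ x, x ∈ uIoc c d → ∀ L : E →L[ℝ] ℝ, deriv (fun y => L (f y)) x = L (deriv f x) := by
  filter_upwards [hf.boundedVariationOn.ae_differentiableAt_of_mem_uIcc] with x hx hxm L
  exact (L.hasFDerivAt.comp_hasDerivAt x (hx (uIoc_subset_uIcc hxm)).hasDerivAt).deriv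

theorem intervalIntegrable_deriv_of_absolutelyContinuous
    (hf : AbsolutelyContinuousOnInterval f c d) : IntervalIntegrable (deriv f) volume c d := by
  let Φ : E ≃L[ℝ] (Fin (Module.finrank ℝ E) → ℝ) := ContinuousLinearEquiv.ofFinrankEq (by simp)
  rw [intervalIntegrable_iff, IntegrableOn, ← Φ.integrable_comp_iff]
  refine Integrable.of_eval fun i => ?_
  let L : E →L[ℝ] ℝ := ContinuousLinearMap.proj i ∘L Φ.toContinuousLinearMap
  have hint := (absolutelyContinuousOnInterval_clm_comp hf L).intervalIntegrable_deriv
  rw [intervalIntegrable_iff] at hint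
  refine hint.congr ((ae_restrict_iff' measurableSet_uIoc).2 ?_)
  filter_upwards [ae_deriv_clm_comp_eq hf] with x hx hxm using hx hxm L

theorem integral_deriv_of_absolutelyContinuous (hf : AbsolutelyContinuousOnInterval f c d) :
    ∫ x in c..d, deriv f x = f d - f c := by
  have : CompleteSpace E := FiniteDimensional.complete ℝ E
  refine (SeparatingDual.eq_iff_forall_dual_eq (R := ℝ)).2 fun L => ?_
  rw [map_sub, ← (absolutelyContinuousOnInterval_clm_comp hf L).integral_deriv_eq_sub,
    ← L.intervalIntegral_comp_comm (intervalIntegrable_deriv_of_absolutelyContinuous hf)]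
  refine intervalIntegral.integral_congr_ae ?_
  filter_upwards [ae_deriv_clm_comp_eq hf] with x hx hxm using (hx hxm L).symm

end AbsoluteContinuityVector

theorem HasRSIntegral.eq_integral_deriv {E F : Type*} [NormedAddCommGroup E] [NormedSpace ℂ E]
    [FiniteDimensional ℂ E] [NormedAddCommGroup F] [NormedSpace ℂ F] [CompleteSpace F]
    {g : ℝ → E →L[ℂ] F} {f : ℝ → E} {c d : ℝ} {L : F}
    (h : HasRSIntegral g f c d L) (hcd : c ≤ d) (hg : Continuous g)
    (hf : AbsolutelyContinuousOnInterval f c d) :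
    IntervalIntegrable (fun ξ => g ξ (deriv f ξ)) volume c d ∧
      L = ∫ ξ in c..d, g ξ (deriv f ξ) := by
  have : CompleteSpace E := FiniteDimensional.complete ℂ E
  have hf' := intervalIntegrable_deriv_of_absolutelyContinuous hf
  refine ⟨intervalIntegrable_clm_apply hg hf', h.unique hcd
    (hasRSIntegral_of_primitive hcd hg hf' fun x hx y hy => ?_)⟩
  rw [← uIcc_of_le hcd] at hx hy
  exact (integral_deriv_of_absolutelyContinuous (hf.mono (uIcc_subset_uIcc hx hy))).symm

/-- An integrable operator-valued function on the line, the kernel of a convolution operator. -/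
structure IntegrableKernel (E : Type*) [NormedAddCommGroup E] [NormedSpace ℂ E] where
  toFun : ℝ → E →L[ℂ] E
  integrable : Integrable toFun

namespace IntegrableKernel

variable {E : Type*} [NormedAddCommGroup E] [NormedSpace ℂ E]

instance : CoeFun (IntegrableKernel E) fun _ => ℝ → E →L[ℂ] E := ⟨toFun⟩

variable (k : IntegrableKernel E)

/-- The `L¹` norm of a kernel. -/
def mass : ℝ := ∫ t, ‖k t‖

/-- The convolution `∫ k(t - s) u(s) ds`. -/
def conv (u : ℝ → E) (t : ℝ) : E := ∫ s, k (t - s) (u s)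

theorem mass_nonneg : 0 ≤ k.mass := integral_nonneg fun _ => norm_nonneg _

theorem integrable_sub (t : ℝ) : Integrable fun s => k (t - s) :=
  k.integrable.comp_sub_left t

theorem integral_norm_sub (t : ℝ) : ∫ s, ‖k (t - s)‖ = k.mass :=
  integral_sub_left_eq_self (fun s => ‖k s‖) volume t

variable {k} {u v : ℝ → E} {C D : ℝ}

theorem integrable_apply (hu : BddMeas u C) (t : ℝ) : Integrable fun s => k (t - s) (u s) :=
  (ContinuousLinearMap.id ℂ (E →L[ℂ] E)).integrable_of_bilin_of_bdd_right C (k.integrable_sub t)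
    hu.aestronglyMeasurable (ae_of_all _ hu.norm_le)

theorem norm_conv_le (hu : BddMeas u C) (t : ℝ) : ‖k.conv u t‖ ≤ k.mass * C := by
  refine (norm_integral_le_of_norm_le ((k.integrable_sub t).norm.mul_const C)
    (ae_of_all _ fun s => ContinuousLinearMap.le_opNorm_of_le _ (hu.norm_le s))).trans_eq ?_
  rw [integral_mul_const, k.integral_norm_sub]

theorem conv_add (hu : BddMeas u C) (hv : BddMeas v D) (t : ℝ) :
    k.conv (fun s => u s + v s) t = k.conv u t + k.conv v t := by
  simp only [conv, map_add]
  exact integral_add (integrable_apply hu t) (integrable_apply hv t)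

theorem conv_sub (hu : BddMeas u C) (hv : BddMeas v D) (t : ℝ) :
    k.conv (fun s => u s - v s) t = k.conv u t - k.conv v t := by
  simp only [conv, map_sub]
  exact integral_sub (integrable_apply hu t) (integrable_apply hv t)

theorem conv_smul (c : ℂ) (u : ℝ → E) (t : ℝ) :
    k.conv (fun s => c • u s) t = c • k.conv u t := by
  simp only [conv, map_smul]
  exact integral_smul c _

theorem conv_congr (h : u =ᵐ[volume] v) (t : ℝ) : k.conv u t = k.conv v t :=
  integral_congr_ae (h.mono fun s hs => by simp only [hs])

variable (k) in
theorem exists_integral_norm_sub_lt {ε : ℝ} (hε : 0 < ε) :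
    ∃ δ > 0, ∀ t t', |t - t'| < δ → ∫ s, ‖k (t - s) - k (t' - s)‖ < ε := by
  obtain ⟨δ, hδ, h⟩ := Metric.eventually_nhds_iff.1
    ((tendsto_integral_norm_vadd_sub (M := ℝ) k.integrable).eventually_lt_const hε)
  refine ⟨δ, hδ, fun t t' htt => ?_⟩
  refine Eq.trans_lt ?_ (h (y := t - t') (by rwa [dist_zero_right]))
  simp only [vadd_eq_add]
  rw [← integral_sub_left_eq_self (fun x => ‖k (t - t' + x) - k x‖) volume t']
  simp only [sub_add_sub_cancel]

variable (k) in
theorem exists_norm_conv_sub_le {ε : ℝ} (hε : 0 < ε) :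
    ∃ δ > 0, ∀ t t', |t - t'| < δ → ∀ (u : ℝ → E) (C : ℝ), BddMeas u C →
      ‖k.conv u t - k.conv u t'‖ ≤ ε * C := by
  obtain ⟨δ, hδ, h⟩ := k.exists_integral_norm_sub_lt hε
  refine ⟨δ, hδ, fun t t' htt u C hu => ?_⟩
  rw [conv, conv, ← integral_sub (integrable_apply hu t) (integrable_apply hu t')]
  have hint : Integrable fun s => ‖k (t - s) - k (t' - s)‖ :=
    ((k.integrable_sub t).sub (k.integrable_sub t')).norm
  refine (norm_integral_le_of_norm_le (hint.mul_const C) (ae_of_all _ fun s => ?_)).trans ?_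
  · rw [← _root_.sub_apply]
    exact ContinuousLinearMap.le_opNorm_of_le _ (hu.norm_le s)
  · rw [integral_mul_const]
    exact mul_le_mul_of_nonneg_right (h t t' htt).le hu.nonneg

theorem continuous_conv (hu : BddMeas u C) : Continuous (k.conv u) := by
  refine Metric.continuous_iff.2 fun t ε hε => ?_
  have hC : 0 < C + 1 := by linarith [hu.nonneg]
  obtain ⟨δ, hδ, h⟩ := k.exists_norm_conv_sub_le (div_pos hε hC)
  refine ⟨δ, hδ, fun t' ht => ?_⟩
  rw [dist_eq_norm]
  refine (h t' t (by rwa [Real.dist_eq] at ht) u C hu).trans_lt ?_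
  rw [div_mul_eq_mul_div, div_lt_iff₀ hC]
  nlinarith [hu.nonneg]

variable (k) in
theorem exists_setIntegral_norm_sub_lt {ε : ℝ} (hε : 0 < ε) :
    ∃ δ > 0, ∀ S, volume S < ENNReal.ofReal δ → ∀ t, ∫ s in S, ‖k (t - s)‖ < ε := by
  obtain ⟨δ, hδ, h⟩ := exists_setIntegral_norm_lt k.integrable hε
  refine ⟨δ, hδ, fun S hS t => ?_⟩
  have hsub := Measure.measurePreserving_sub_left volume t
  have hemb := (MeasurableEquiv.subLeft t).measurableEmbedding
  have hinv : (t - ·) ⁻¹' ((t - ·) ⁻¹' S) = S := by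
    ext s
    simp only [mem_preimage, sub_sub_cancel]
  rw [← hinv, hsub.setIntegral_preimage_emb hemb fun s => ‖k s‖]
  exact h _ (by rwa [hsub.measure_preimage_emb hemb])

theorem norm_conv_indicator_le {S : Set ℝ} (hS : MeasurableSet S) (hu : ∀ s ∈ S, ‖u s‖ ≤ C)
    (t : ℝ) : ‖k.conv (S.indicator u) t‖ ≤ (∫ s in S, ‖k (t - s)‖) * C := by
  rw [← integral_mul_const, ← integral_indicator hS]
  refine norm_integral_le_of_norm_le
    (((k.integrable_sub t).norm.mul_const C).indicator hS) (ae_of_all _ fun s => ?_)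
  by_cases h : s ∈ S
  · rw [indicator_of_mem h, indicator_of_mem h]
    exact ContinuousLinearMap.le_opNorm_of_le _ (hu s h)
  · rw [indicator_of_notMem h, indicator_of_notMem h, map_zero, norm_zero]

variable (k) in
/-- The truncated convolution `∫_{-ξ}^{ξ} k(t - s) u(s) ds`. -/
def truncConv (ξ : ℝ) (u : ℝ → E) : ℝ → E := k.conv ((Ioc (-ξ) ξ).indicator u)

theorem continuous_truncConv (hu : BddMeas u C) (ξ : ℝ) : Continuous (k.truncConv ξ u) :=
  continuous_conv (hu.indicator measurableSet_Ioc)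

theorem norm_truncConv_le (hu : BddMeas u C) (ξ t : ℝ) : ‖k.truncConv ξ u t‖ ≤ k.mass * C :=
  norm_conv_le (hu.indicator measurableSet_Ioc) t

theorem truncConv_add (hu : BddMeas u C) (hv : BddMeas v D) (ξ t : ℝ) :
    k.truncConv ξ (fun s => u s + v s) t = k.truncConv ξ u t + k.truncConv ξ v t := by
  rw [truncConv, truncConv, truncConv, ← conv_add (hu.indicator measurableSet_Ioc)
    (hv.indicator measurableSet_Ioc)]
  congr 1
  exact indicator_add _ u v

theorem truncConv_sub (hu : BddMeas u C) (hv : BddMeas v D) (ξ t : ℝ) :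
    k.truncConv ξ (fun s => u s - v s) t = k.truncConv ξ u t - k.truncConv ξ v t := by
  rw [truncConv, truncConv, truncConv, ← conv_sub (hu.indicator measurableSet_Ioc)
    (hv.indicator measurableSet_Ioc)]
  congr 1
  exact indicator_sub _ u v

theorem truncConv_smul (c : ℂ) (u : ℝ → E) (ξ t : ℝ) :
    k.truncConv ξ (fun s => c • u s) t = c • k.truncConv ξ u t := by
  rw [truncConv, truncConv, ← conv_smul]
  congr 1
  exact indicator_const_smul _ c u

theorem truncConv_congr {ξ : ℝ} (h : ∀ s ∈ Ioc (-ξ) ξ, u s = v s) :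
    k.truncConv ξ u = k.truncConv ξ v := by
  rw [truncConv, truncConv, indicator_congr h]

theorem truncConv_sub_truncConv (hu : BddMeas u C) {ξ ξ' : ℝ} (h : ξ ≤ ξ') (t : ℝ) :
    k.truncConv ξ' u t - k.truncConv ξ u t = k.conv ((shell ξ ξ').indicator u) t := by
  rw [truncConv, truncConv, ← conv_sub (hu.indicator measurableSet_Ioc)
    (hu.indicator measurableSet_Ioc)]
  congr 1
  rw [shell, indicator_sdiff (Ioc_subset_Ioc (by linarith) h)]
  rfl

theorem truncConv_zero (u : ℝ → E) (t : ℝ) : k.truncConv 0 u t = 0 := by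
  simp [truncConv, conv]

end IntegrableKernel

/-- Continuous functions on `[-a, a]`. -/
abbrev SymmC (a : ℝ) (E : Type*) [TopologicalSpace E] : Type _ := C(Icc (-a) a, E)

namespace SymmC

variable {a : ℝ} {E : Type*}

/-- The restriction to `[-a, a]` of a continuous function on the line. -/
def restrict (a : ℝ) [TopologicalSpace E] (f : ℝ → E) (hf : Continuous f) : SymmC a E :=
  ⟨fun t => f t, hf.comp continuous_subtype_val⟩

variable [ha : Fact (0 < a)]

theorem neg_le_self (a : ℝ) [ha : Fact (0 < a)] : -a ≤ a := by linarith [ha.out]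

/-- The extension of a function on `[-a, a]` to the line by its end values. -/
def extend [TopologicalSpace E] (u : SymmC a E) : ℝ → E := IccExtend (neg_le_self a) u

theorem continuous_extend [TopologicalSpace E] (u : SymmC a E) : Continuous u.extend :=
  u.continuous.Icc_extend'

theorem extend_apply [TopologicalSpace E] (u : SymmC a E) {t : ℝ} (ht : t ∈ Icc (-a) a) :
    u.extend t = u ⟨t, ht⟩ := IccExtend_of_mem _ _ ht

theorem extend_coe [TopologicalSpace E] (u : SymmC a E) (t : Icc (-a) a) :
    u.extend t = u t := IccExtend_val _ _ t

theorem extend_restrict [TopologicalSpace E] {f : ℝ → E} (hf : Continuous f) {t : ℝ}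
    (ht : t ∈ Icc (-a) a) : (restrict a f hf).extend t = f t :=
  extend_apply _ ht

variable [NormedAddCommGroup E]

theorem bddMeas_extend (u : SymmC a E) : BddMeas u.extend ‖u‖ :=
  ⟨u.continuous_extend.aestronglyMeasurable, fun _ => u.norm_coe_le_norm _⟩

theorem norm_extend_le (u : SymmC a E) (t : ℝ) : ‖u.extend t‖ ≤ ‖u‖ := u.bddMeas_extend.norm_le t

theorem extend_add (u v : SymmC a E) : (u + v).extend = fun s => u.extend s + v.extend s := rfl

theorem extend_sub (u v : SymmC a E) : (u - v).extend = fun s => u.extend s - v.extend s := rfl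

theorem extend_neg (u : SymmC a E) : (-u).extend = fun s => -u.extend s := rfl

theorem extend_const (x : E) (t : ℝ) :
    SymmC.extend (ContinuousMap.const (Icc (-a) a) x) t = x := rfl

theorem continuous_extend_uncurry {X : Type*} [TopologicalSpace X] {f : X → SymmC a E}
    {g : X → ℝ} (hf : Continuous f) (hg : Continuous g) :
    Continuous fun x => (f x).extend (g x) := by
  have : Continuous fun x => projIcc (-a) a (neg_le_self a) (g x) := continuous_projIcc.comp hg
  change Continuous fun x => (f x) (projIcc (-a) a (neg_le_self a) (g x))
  fun_prop

end SymmC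

namespace IntegrableKernel

variable {E : Type*} [NormedAddCommGroup E] [NormedSpace ℂ E] {k : IntegrableKernel E} {C : ℝ}
  {a : ℝ} [ha : Fact (0 < a)]

variable (k a) in
/-- The operator `u ↦ ∫_{-ξ}^{ξ} k(t - s) u(s) ds` on `C[-a, a]`. -/
def op (ξ : ℝ) : SymmC a E →L[ℂ] SymmC a E :=
  LinearMap.mkContinuous
    { toFun := fun u =>
        SymmC.restrict a (k.truncConv ξ u.extend) (continuous_truncConv u.bddMeas_extend ξ)
      map_add' := fun u v =>
        ContinuousMap.ext fun t => truncConv_add u.bddMeas_extend v.bddMeas_extend ξ t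
      map_smul' := fun c u => ContinuousMap.ext fun t => truncConv_smul c u.extend ξ t }
    k.mass fun u => (ContinuousMap.norm_le _ (mul_nonneg k.mass_nonneg (norm_nonneg _))).2
      fun t => norm_truncConv_le u.bddMeas_extend ξ t

theorem op_apply (ξ : ℝ) (u : SymmC a E) (t : Icc (-a) a) :
    k.op a ξ u t = k.truncConv ξ u.extend t := rfl

theorem extend_op (ξ : ℝ) (u : SymmC a E) {t : ℝ} (ht : t ∈ Icc (-a) a) :
    (k.op a ξ u).extend t = k.truncConv ξ u.extend t :=
  SymmC.extend_apply _ ht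

theorem op_sub_op_apply {ξ ξ' : ℝ} (h : ξ ≤ ξ') (u : SymmC a E) (t : Icc (-a) a) :
    (k.op a ξ' - k.op a ξ) u t = k.conv ((shell ξ ξ').indicator u.extend) t :=
  truncConv_sub_truncConv u.bddMeas_extend h t

theorem norm_op_sub_apply_le {ξ ξ' : ℝ} (h : ξ ≤ ξ') (u : SymmC a E)
    (hu : ∀ s ∈ shell ξ ξ', ‖u.extend s‖ ≤ C) (t : Icc (-a) a) :
    ‖(k.op a ξ' - k.op a ξ) u t‖ ≤ (∫ s in shell ξ ξ', ‖k (t - s)‖) * C := by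
  rw [op_sub_op_apply h]
  exact norm_conv_indicator_le (measurableSet_shell _ _) hu t

variable (k a) in
theorem exists_norm_op_sub_le {ε : ℝ} (hε : 0 < ε) :
    ∃ δ > 0, ∀ ξ ξ', 0 ≤ ξ → ξ ≤ ξ' → ξ' - ξ < δ → ‖k.op a ξ' - k.op a ξ‖ ≤ ε := by
  obtain ⟨δ, hδ, h⟩ := k.exists_setIntegral_norm_sub_lt hε
  refine ⟨δ / 2, by positivity, fun ξ ξ' h0 hle hlt =>
    ContinuousLinearMap.opNorm_le_bound _ hε.le fun u =>
      (ContinuousMap.norm_le _ (by positivity)).2 fun t =>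
        (norm_op_sub_apply_le hle u (fun s _ => u.norm_extend_le s) t).trans ?_⟩
  refine mul_le_mul_of_nonneg_right (h _ ?_ t).le (norm_nonneg _)
  rw [volume_shell h0 hle]
  exact (ENNReal.ofReal_lt_ofReal_iff hδ).2 (by linarith)

variable (k a) in
theorem continuousOn_op : ContinuousOn (fun ξ : ℝ => k.op a ξ) (Ici 0) := by
  refine (uniformContinuousOn_of_increments (F := SymmC a E →L[ℂ] SymmC a E)
    fun ε hε => ?_).continuousOn
  obtain ⟨δ, hδ, h⟩ := k.exists_norm_op_sub_le a hε
  refine ⟨δ, hδ, fun ξ h0 ξ' _ hle hlt => ?_⟩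
  exact (dist_eq_norm (E := SymmC a E →L[ℂ] SymmC a E) _ _).trans_le (h ξ ξ' h0 hle hlt)

theorem op_zero : k.op a 0 = 0 := by
  ext u t
  exact truncConv_zero _ _

variable (k a) in
theorem isCompactOperator_op [ProperSpace E] (ξ : ℝ) : IsCompactOperator (k.op a ξ) := by
  refine (isCompactOperator_iff_image_closedBall_subset_compact
    (k.op a ξ : SymmC a E →ₗ[ℂ] SymmC a E) one_pos).2 ?_
  set S : Set (SymmC a E) := k.op a ξ '' Metric.closedBall 0 1
  have bounded : ∀ f t, f ∈ BoundedContinuousFunction.mkOfCompact '' S →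
      f t ∈ Metric.closedBall (0 : E) k.mass := by
    rintro _ t ⟨_, ⟨u, hu, rfl⟩, rfl⟩
    rw [mem_closedBall_zero_iff] at hu ⊢
    exact (norm_truncConv_le u.bddMeas_extend ξ t).trans (mul_le_of_le_one_right k.mass_nonneg hu)
  have equicontinuous : Equicontinuous
      ((↑) : BoundedContinuousFunction.mkOfCompact '' S → Icc (-a) a → E) := by
    refine fun t => Metric.equicontinuousAt_iff.2 fun ε hε => ?_
    obtain ⟨δ, hδ, h⟩ := k.exists_norm_conv_sub_le (half_pos hε)
    refine ⟨δ, hδ, ?_⟩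
    rintro t' ht ⟨_, _, ⟨u, hu, rfl⟩, rfl⟩
    rw [mem_closedBall_zero_iff] at hu
    change dist (k.truncConv ξ u.extend t) (k.truncConv ξ u.extend t') < ε
    rw [dist_eq_norm]
    refine (h t t' ?_ _ _ (u.bddMeas_extend.indicator measurableSet_Ioc)).trans_lt ?_
    · rw [abs_sub_comm]
      exact ht
    · nlinarith
  have hcpt := BoundedContinuousFunction.arzela_ascoli _ (isCompact_closedBall (0 : E) k.mass) _
    bounded equicontinuous
  exact ⟨(ContinuousMap.linearIsometryBoundedOfCompact (Icc (-a) a) E ℂ).symm '' closure _,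
    hcpt.image (LinearIsometryEquiv.continuous _),
    fun w hw => ⟨_, subset_closure ⟨w, hw, rfl⟩, rfl⟩⟩

theorem isUnit_one_add_op [ProperSpace E] {ξ : ℝ} (h : ∀ u, u + k.op a ξ u = 0 → u = 0) :
    IsUnit (1 + k.op a ξ) := by
  have : CompleteSpace E := inferInstance
  rcases (k.isCompactOperator_op a ξ).hasEigenvalue_or_mem_resolventSet
    (μ := -1) (by simp) with heig | hres
  · obtain ⟨u, hu⟩ := heig.exists_hasEigenvector
    have hfix : k.op a ξ u = (-1 : ℂ) • u := hu.apply_eq_smul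
    exact absurd (h u (by rw [hfix, neg_one_smul, add_neg_cancel])) hu.2
  · rw [spectrum.mem_resolventSet_iff] at hres
    convert hres.neg using 1
    rw [map_neg, map_one]
    abel

end IntegrableKernel

/-- The kernel is an even function. -/
class IntegrableKernel.IsEven {E : Type*} [NormedAddCommGroup E] [NormedSpace ℂ E]
    (k : IntegrableKernel E) : Prop where
  even : ∀ t, k (-t) = k t

theorem eq_zero_of_forall_integral_apply_eq_zero {E F : Type*} [NormedAddCommGroup E]
    [NormedSpace ℂ E] [NormedAddCommGroup F] [NormedSpace ℂ F] [CompleteSpace F]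
    {g : ℝ → E →L[ℂ] F} (hg : Continuous g) {c d : ℝ}
    (h : ∀ f : ℝ → E, Continuous f → ∫ t in Ioc c d, g t (f t) = 0) :
    ∀ t ∈ Ioo c d, g t = 0 := by
  intro t ht
  ext x
  have hgx : Continuous fun t => g t x := hg.clm_apply continuous_const
  have hae : ∀ᵐ t : ℝ, t ∈ Ioo c d → g t x = 0 := by
    refine isOpen_Ioo.ae_eq_zero_of_integral_contDiff_smul_eq_zero
      (hgx.locallyIntegrable.locallyIntegrableOn _) fun φ hφ _ hsupp => ?_
    have hφx : Continuous fun t => (φ t : ℂ) • x := by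
      have := hφ.continuous
      fun_prop
    rw [← h _ hφx]
    simp only [map_smul]
    refine (setIntegral_eq_integral_of_forall_compl_eq_zero fun t ht => ?_).symm
    rw [image_eq_zero_of_notMem_tsupport fun htφ => ht (Ioo_subset_Ioc_self (hsupp htφ)),
      zero_smul]
  exact Measure.eqOn_open_of_ae_eq ((ae_restrict_iff' measurableSet_Ioo).2 hae) isOpen_Ioo
    hgx.continuousOn continuousOn_const ht

namespace SymmC

variable {a : ℝ} {E : Type*}

/-- The reflection `u(-t)`. -/
def reflect [TopologicalSpace E] (u : SymmC a E) : SymmC a E :=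
  ⟨fun t => u ⟨-t, ⟨neg_le_neg t.2.2, neg_le.1 t.2.1⟩⟩, by fun_prop⟩

theorem extend_reflect [ha : Fact (0 < a)] [TopologicalSpace E] (u : SymmC a E) (t : ℝ) :
    u.reflect.extend t = u.extend (-t) := by
  change u _ = u _
  congr 1
  ext
  simp only [coe_projIcc]
  have := ha.out
  grind

end SymmC

namespace IntegrableKernel

variable {E : Type*} [NormedAddCommGroup E] [NormedSpace ℂ E] {k : IntegrableKernel E}
  {u v : ℝ → E} {C D : ℝ} {a : ℝ} [ha : Fact (0 < a)]

variable (k a) in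
/-- All truncated equations on `[-ξ, ξ]`, `0 ≤ ξ ≤ a`, are uniquely solvable. -/
def Regular : Prop := ∀ ξ ∈ Icc 0 a, IsUnit (1 + k.op a ξ)

variable (k a) in
/-- The inverse of `1 + k.op a ξ` for `0 ≤ ξ ≤ a`, extended to all `ξ` by its end values. -/
def resolvent : ℝ → SymmC a E →L[ℂ] SymmC a E :=
  IccExtend ha.out.le fun ξ : Icc 0 a => Ring.inverse (1 + k.op a ξ)

theorem resolvent_of_mem {ξ : ℝ} (hξ : ξ ∈ Icc 0 a) :
    k.resolvent a ξ = Ring.inverse (1 + k.op a ξ) := IccExtend_of_mem _ _ hξ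

namespace Regular

theorem continuous_inverse [CompleteSpace E] (hk : k.Regular a) :
    Continuous fun ξ : Icc 0 a => Ring.inverse (1 + k.op a ξ) := by
  refine continuous_iff_continuousAt.2 fun ξ => ?_
  obtain ⟨U, hU⟩ := hk ξ ξ.2
  have hinv := NormedRing.inverse_continuousAt (R := SymmC a E →L[ℂ] SymmC a E) U
  rw [hU] at hinv
  have hop : Continuous fun ξ : Icc 0 a => k.op a ξ :=
    (k.continuousOn_op a).comp_continuous continuous_subtype_val fun ξ => ξ.2.1
  exact ContinuousAt.comp (f := fun ξ : Icc 0 a => 1 + k.op a ξ) hinv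
    (continuous_const.add hop).continuousAt

theorem continuous_resolvent [CompleteSpace E] (hk : k.Regular a) :
    Continuous (k.resolvent a) := hk.continuous_inverse.Icc_extend'

theorem exists_norm_resolvent_le [CompleteSpace E] (hk : k.Regular a) :
    ∃ C > 0, ∀ ξ, ‖k.resolvent a ξ‖ ≤ C := by
  obtain ⟨C, hC⟩ := isCompact_univ.exists_bound_of_continuousOn
    (E := SymmC a E →L[ℂ] SymmC a E) hk.continuous_inverse.continuousOn
  exact ⟨max C 1, by positivity, fun ξ => (hC _ (mem_univ _)).trans (le_max_left _ _)⟩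

theorem resolvent_add_op (hk : k.Regular a) {ξ : ℝ} (hξ : ξ ∈ Icc 0 a) (f : SymmC a E) :
    k.resolvent a ξ f + k.op a ξ (k.resolvent a ξ f) = f := by
  rw [resolvent_of_mem hξ]
  exact congrArg (fun L => L f) (Ring.mul_inverse_cancel _ (hk ξ hξ))

theorem resolvent_apply_add (hk : k.Regular a) {ξ : ℝ} (hξ : ξ ∈ Icc 0 a)
    (f : SymmC a E) : k.resolvent a ξ (f + k.op a ξ f) = f := by
  rw [resolvent_of_mem hξ]
  exact congrArg (fun L => L f) (Ring.inverse_mul_cancel _ (hk ξ hξ))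

theorem eq_resolvent (hk : k.Regular a) {ξ : ℝ} (hξ : ξ ∈ Icc 0 a) {f g : SymmC a E}
    (h : f + k.op a ξ f = g) : f = k.resolvent a ξ g := by
  rw [← h, hk.resolvent_apply_add hξ]

theorem op_resolvent (hk : k.Regular a) {ξ : ℝ} (hξ : ξ ∈ Icc 0 a) (f : SymmC a E) :
    k.op a ξ (k.resolvent a ξ f) = k.resolvent a ξ (k.op a ξ f) := by
  refine hk.eq_resolvent hξ ?_
  rw [← map_add, hk.resolvent_add_op hξ]

theorem extend_resolvent_add (hk : k.Regular a) {ξ : ℝ} (hξ : ξ ∈ Icc 0 a)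
    (f : SymmC a E) {t : ℝ} (ht : t ∈ Icc (-a) a) :
    (k.resolvent a ξ f).extend t + k.truncConv ξ (k.resolvent a ξ f).extend t = f.extend t := by
  rw [← extend_op ξ _ ht]
  exact congrArg (fun w : SymmC a E => w.extend t) (hk.resolvent_add_op hξ f)

theorem eq_extend_resolvent (hk : k.Regular a) {ξ : ℝ} (hξ : ξ ∈ Icc 0 a)
    (hv : BddMeas v C) {g : SymmC a E}
    (h : ∀ t ∈ Icc (-ξ) ξ, v t + k.truncConv ξ v t = g.extend t) :
    ∀ t ∈ Icc (-ξ) ξ, v t = (k.resolvent a ξ g).extend t := by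
  have hsub : Icc (-ξ) ξ ⊆ Icc (-a) a := Icc_subset_Icc (neg_le_neg hξ.2) hξ.2
  set w : SymmC a E := SymmC.restrict a (k.truncConv ξ v) (continuous_truncConv hv ξ)
  have hgw : ∀ t ∈ Icc (-ξ) ξ, (g - w).extend t = v t := fun t ht => by
    simp only [SymmC.extend_sub]
    rw [SymmC.extend_restrict _ (hsub ht), ← h t ht, add_sub_cancel_right]
  have hop : k.op a ξ (g - w) = w := by
    ext t
    rw [op_apply, truncConv_congr fun s hs => hgw s (Ioc_subset_Icc_self hs)]
    rfl
  have hres : g - w = k.resolvent a ξ g := hk.eq_resolvent hξ (by rw [hop, sub_add_cancel])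
  intro t ht
  rw [← hgw t ht, hres]

end Regular

section Reflection

theorem conv_neg_arg [hev : k.IsEven] (u : ℝ → E) (t : ℝ) :
    k.conv u (-t) = k.conv (fun s => u (-s)) t := by
  rw [conv, ← integral_neg_eq_self, conv]
  refine integral_congr_ae (ae_of_all _ fun s => ?_)
  simp only
  rw [← hev.even (t - s), neg_sub, sub_neg_eq_add, neg_add_eq_sub]

theorem truncConv_reflect [k.IsEven] (ξ : ℝ) (u : ℝ → E) (t : ℝ) :
    k.truncConv ξ u (-t) = k.truncConv ξ (fun s => u (-s)) t := by
  rw [truncConv, conv_neg_arg, truncConv]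
  refine conv_congr ?_ t
  filter_upwards [Measure.ae_ne volume (-ξ), Measure.ae_ne volume ξ] with s hs hs'
  simp only [indicator_apply, mem_Ioc]
  grind

theorem op_reflect [k.IsEven] (ξ : ℝ) (f : SymmC a E) :
    k.op a ξ f.reflect = (k.op a ξ f).reflect := by
  ext t
  rw [← SymmC.extend_coe (k.op a ξ f).reflect, SymmC.extend_reflect, op_apply, extend_op ξ f
    ⟨neg_le_neg t.2.2, neg_le.1 t.2.1⟩, truncConv_reflect]
  congr 2
  ext s
  rw [SymmC.extend_reflect]

theorem Regular.resolvent_reflect [k.IsEven] (hk : k.Regular a) {ξ : ℝ} (hξ : ξ ∈ Icc 0 a)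
    (f : SymmC a E) : k.resolvent a ξ f.reflect = (k.resolvent a ξ f).reflect := by
  refine (hk.eq_resolvent hξ ?_).symm
  rw [op_reflect]
  conv_rhs => rw [← hk.resolvent_add_op hξ f]
  rfl

end Reflection

section Duality

/-- The transposed kernel `k(-t)` acting on `E →L[ℂ] E` by composition on the right, so that
`k.dual.conv g` is `∫ g(s) k(s - t) ds`. -/
def dual (k : IntegrableKernel E) : IntegrableKernel (E →L[ℂ] E) where
  toFun t := (ContinuousLinearMap.compL ℂ E E E).flip (k (-t))
  integrable := (ContinuousLinearMap.compL ℂ E E E).flip.integrable_comp k.integrable.comp_neg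

theorem dual_apply (t : ℝ) (g : E →L[ℂ] E) : k.dual t g = g ∘L k (-t) := rfl

instance [hev : k.IsEven] : k.dual.IsEven where
  even t := by simp only [dual, hev.even]

theorem integral_apply_conv [CompleteSpace E] {g : ℝ → E →L[ℂ] E} (hg : BddMeas g D)
    (hu : BddMeas u C) (hui : Integrable u) :
    ∫ t, g t (k.conv u t) = ∫ s, k.dual.conv g s (u s) := by
  have hku : Integrable (fun p : ℝ × ℝ => k (p.1 - p.2) (u p.2)) (volume.prod volume) :=
    Integrable.convolution_integrand (ContinuousLinearMap.id ℂ (E →L[ℂ] E)).flip hui k.integrable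
  have hgku : Integrable (fun p : ℝ × ℝ => g p.1 (k (p.1 - p.2) (u p.2)))
      (volume.prod volume) :=
    (ContinuousLinearMap.id ℂ (E →L[ℂ] E)).integrable_of_bilin_of_bdd_left D
      hg.aestronglyMeasurable.comp_fst (ae_of_all _ fun p => hg.norm_le p.1) hku
  have hleft : ∀ t, g t (k.conv u t) = ∫ s, g t (k (t - s) (u s)) := fun t => by
    rw [conv, ContinuousLinearMap.integral_comp_comm _ (integrable_apply hu t)]
  have hright : ∀ s, k.dual.conv g s (u s) = ∫ t, g t (k (t - s) (u s)) := fun s => by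
    rw [conv, ContinuousLinearMap.integral_apply (integrable_apply hg s)]
    simp only [dual_apply, neg_sub, ContinuousLinearMap.comp_apply]
  simp_rw [hleft, hright]
  exact integral_integral_swap hgku

theorem setIntegral_apply_conv [CompleteSpace E] {g : ℝ → E →L[ℂ] E} (hg : BddMeas g D)
    (hu : BddMeas u C) {S S' : Set ℝ} (hS : MeasurableSet S) (hS' : MeasurableSet S')
    (hfin : volume S' ≠ ⊤) :
    ∫ t in S, g t (k.conv (S'.indicator u) t) = ∫ s in S', k.dual.conv (S.indicator g) s (u s) := by
  rw [← integral_indicator hS, ← integral_indicator hS']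
  have h := integral_apply_conv (k := k) (hg.indicator hS) (hu.indicator hS')
    (hu.integrable_indicator hS' hfin)
  refine Eq.trans (integral_congr_ae (ae_of_all _ fun t => ?_))
    (h.trans (integral_congr_ae (ae_of_all _ fun t => ?_)))
  · by_cases ht : t ∈ S <;> simp [ht]
  · by_cases ht : t ∈ S' <;> simp [ht]

theorem bddMeas_apply {g : ℝ → E →L[ℂ] E} (hg : BddMeas g D) (hu : BddMeas u C) :
    BddMeas (fun s => g s (u s)) (D * C) :=
  ⟨(ContinuousLinearMap.id ℂ (E →L[ℂ] E)).aestronglyMeasurable_comp₂ hg.aestronglyMeasurable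
    hu.aestronglyMeasurable, fun s => ContinuousLinearMap.le_of_opNorm_le_of_le _ (hg.norm_le s)
      (hu.norm_le s)⟩

theorem bddMeas_truncConv (hu : BddMeas u C) (ξ : ℝ) :
    BddMeas (k.truncConv ξ u) (k.mass * C) :=
  ⟨(continuous_truncConv hu ξ).aestronglyMeasurable, norm_truncConv_le hu ξ⟩

theorem setIntegral_apply_add_truncConv [CompleteSpace E] {g : ℝ → E →L[ℂ] E} (hg : BddMeas g D)
    (hu : BddMeas u C) (ξ : ℝ) :
    ∫ t in Ioc (-ξ) ξ, g t (u t + k.truncConv ξ u t) =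
      ∫ t in Ioc (-ξ) ξ, (g t + k.dual.truncConv ξ g t) (u t) := by
  have hfin : volume (Ioc (-ξ) ξ) ≠ ⊤ := by simp
  simp only [map_add, _root_.add_apply]
  rw [integral_add ((bddMeas_apply hg hu).integrableOn hfin)
    ((bddMeas_apply hg (bddMeas_truncConv hu ξ)).integrableOn hfin),
    integral_add ((bddMeas_apply hg hu).integrableOn hfin)
    ((bddMeas_apply (bddMeas_truncConv hg ξ) hu).integrableOn hfin)]
  congr 1
  exact setIntegral_apply_conv hg hu measurableSet_Ioc measurableSet_Ioc hfin

theorem Regular.integral_apply_eq_zero_of_dual [CompleteSpace E] (hk : k.Regular a) {ξ : ℝ}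
    (hξ : ξ ∈ Icc 0 a) {g : SymmC a (E →L[ℂ] E)} (hg : g + k.dual.op a ξ g = 0)
    {f : ℝ → E} (hf : Continuous f) : ∫ t in Ioc (-ξ) ξ, g.extend t (f t) = 0 := by
  have hsub : ∀ t ∈ Ioc (-ξ) ξ, t ∈ Icc (-a) a := fun t ht =>
    ⟨(neg_le_neg hξ.2).trans ht.1.le, ht.2.trans hξ.2⟩
  set v := k.resolvent a ξ (SymmC.restrict a f hf)
  have hgv : ∫ t in Ioc (-ξ) ξ, (g.extend t + k.dual.truncConv ξ g.extend t) (v.extend t) = 0 :=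
    setIntegral_eq_zero_of_forall_eq_zero fun t ht => by
      rw [← extend_op ξ _ (hsub t ht)]
      exact congrArg (fun w : SymmC a (E →L[ℂ] E) => w.extend t (v.extend t)) hg
  rw [← hgv, ← setIntegral_apply_add_truncConv g.bddMeas_extend v.bddMeas_extend]
  refine setIntegral_congr_fun measurableSet_Ioc fun t ht => ?_
  rw [hk.extend_resolvent_add hξ _ (hsub t ht), SymmC.extend_restrict hf (hsub t ht)]

theorem Regular.dual [FiniteDimensional ℂ E] (hk : k.Regular a) : k.dual.Regular a := by
  have : ProperSpace E := FiniteDimensional.proper ℂ E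
  have : ProperSpace (E →L[ℂ] E) := FiniteDimensional.proper ℂ _
  intro ξ hξ
  refine isUnit_one_add_op fun g hg => ?_
  have hg_inner : ∀ t ∈ Ioo (-ξ) ξ, g.extend t = 0 :=
    eq_zero_of_forall_integral_apply_eq_zero g.continuous_extend fun f hf =>
      hk.integral_apply_eq_zero_of_dual hξ hg hf
  have hae : (Ioc (-ξ) ξ).indicator g.extend =ᵐ[volume] fun _ => 0 := by
    filter_upwards [Measure.ae_ne volume ξ] with t hne
    exact indicator_apply_eq_zero.2 fun ht => hg_inner t ⟨ht.1, ht.2.lt_of_ne hne⟩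
  ext1 t
  have hconv : k.dual.op a ξ g t = 0 := by
    rw [op_apply, truncConv, conv_congr hae]
    simp only [conv, map_zero, integral_zero]
  rw [← hg, ContinuousMap.add_apply, hconv, add_zero]

end Duality

variable (k a) in
/-- The solution `q(t, ξ)` of the truncated equation with right-hand side `1`. -/
def unitSol (t ξ : ℝ) : E →L[ℂ] E :=
  ContinuousMap.evalCLM ℂ (projIcc (-a) a (SymmC.neg_le_self a) t) ∘L k.resolvent a ξ ∘L
    ContinuousLinearMap.const ℂ (Icc (-a) a)

variable (k a) in
/-- The solution `q*(t, ξ)` of the transposed truncated equation with right-hand side `1`. -/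
def dualSol (t ξ : ℝ) : E →L[ℂ] E :=
  SymmC.extend (k.dual.resolvent a ξ (ContinuousMap.const _ 1)) t

theorem unitSol_apply (t ξ : ℝ) (x : E) :
    k.unitSol a t ξ x = SymmC.extend (k.resolvent a ξ (ContinuousMap.const _ x)) t := rfl

variable (k a) in
theorem bddMeas_dualSol (ξ : ℝ) : BddMeas (fun s => k.dualSol a s ξ)
    ‖k.dual.resolvent a ξ (ContinuousMap.const _ 1)‖ := SymmC.bddMeas_extend _

namespace Regular

theorem continuous_sol [CompleteSpace E] (hk : k.Regular a) (f : SymmC a E)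
    {X : Type*} [TopologicalSpace X] {s r : X → ℝ} (hs : Continuous s) (hr : Continuous r) :
    Continuous fun x => (k.resolvent a (r x) f).extend (s x) :=
  SymmC.continuous_extend_uncurry
    ((hk.continuous_resolvent.comp hr).clm_apply continuous_const) hs

theorem unitSol_neg [k.IsEven] (hk : k.Regular a) {ξ : ℝ} (hξ : ξ ∈ Icc 0 a) (t : ℝ) :
    k.unitSol a (-t) ξ = k.unitSol a t ξ := by
  ext x
  rw [unitSol_apply, ← SymmC.extend_reflect, ← hk.resolvent_reflect hξ]
  rfl

variable [FiniteDimensional ℂ E]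

theorem continuous_unitSol (hk : k.Regular a)
    {X : Type*} [TopologicalSpace X] {s r : X → ℝ} (hs : Continuous s) (hr : Continuous r) :
    Continuous fun x => k.unitSol a (s x) (r x) := by
  have : CompleteSpace E := FiniteDimensional.complete ℂ E
  exact continuous_clm_apply.2 fun x => hk.continuous_sol _ hs hr

theorem continuous_dualSol (hk : k.Regular a)
    {X : Type*} [TopologicalSpace X] {s r : X → ℝ} (hs : Continuous s) (hr : Continuous r) :
    Continuous fun x => k.dualSol a (s x) (r x) := by
  have : CompleteSpace E := FiniteDimensional.complete ℂ E
  exact hk.dual.continuous_sol _ hs hr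

theorem dualSol_neg [k.IsEven] (hk : k.Regular a) {ξ : ℝ}
    (hξ : ξ ∈ Icc 0 a) (t : ℝ) : k.dualSol a (-t) ξ = k.dualSol a t ξ := by
  rw [dualSol, ← SymmC.extend_reflect, ← hk.dual.resolvent_reflect hξ]
  rfl

theorem dualSol_add (hk : k.Regular a) {ξ : ℝ}
    (hξ : ξ ∈ Icc 0 a) {t : ℝ} (ht : t ∈ Icc (-a) a) :
    k.dualSol a t ξ + k.dual.truncConv ξ (fun s => k.dualSol a s ξ) t = 1 :=
  hk.dual.extend_resolvent_add hξ _ ht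

theorem setIntegral_dualSol_apply (hk : k.Regular a) {ξ : ℝ}
    (hξ : ξ ∈ Icc 0 a) (hu : BddMeas u C) :
    ∫ t in Ioc (-ξ) ξ, k.dualSol a t ξ (u t + k.truncConv ξ u t) = ∫ t in Ioc (-ξ) ξ, u t := by
  have : CompleteSpace E := FiniteDimensional.complete ℂ E
  rw [setIntegral_apply_add_truncConv (k.bddMeas_dualSol a ξ) hu]
  refine setIntegral_congr_fun measurableSet_Ioc fun t ht => ?_
  simp only [hk.dualSol_add hξ
    (⟨(neg_le_neg hξ.2).trans ht.1.le, ht.2.trans hξ.2⟩ : t ∈ Icc (-a) a)]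
  rfl

theorem setIntegral_dualSol_shell (hk : k.Regular a) {ξ ξ' : ℝ}
    (hξ : ξ ∈ Icc 0 a) (hξ' : ξ' ∈ Icc 0 a) (hu : BddMeas u C) :
    ∫ t in Ioc (-ξ) ξ, k.dualSol a t ξ (k.conv ((shell ξ ξ').indicator u) t) =
      ∫ t in shell ξ ξ', (u t - k.dualSol a t ξ (u t)) := by
  have : CompleteSpace E := FiniteDimensional.complete ℂ E
  have hfin : volume (shell ξ ξ') ≠ ⊤ :=
    ((measure_mono (shell_subset _ _)).trans_lt (by simp : volume (Ioc (-ξ') ξ') < ⊤)).ne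
  rw [setIntegral_apply_conv (k.bddMeas_dualSol a ξ) hu measurableSet_Ioc
    (measurableSet_shell _ _) hfin]
  refine setIntegral_congr_fun (measurableSet_shell _ _) fun t ht => ?_
  obtain ⟨hl, hr⟩ := shell_subset _ _ ht
  have hconv : k.dual.conv ((Ioc (-ξ) ξ).indicator fun s => k.dualSol a s ξ) t
      = 1 - k.dualSol a t ξ := eq_sub_of_add_eq'
    (hk.dualSol_add hξ ⟨(neg_le_neg hξ'.2).trans hl.le, hr.trans hξ'.2⟩)
  simp only [hconv]
  rfl

end Regular

end IntegrableKernel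

namespace IntegrableKernel

variable {E : Type*} [NormedAddCommGroup E] [NormedSpace ℂ E] {k : IntegrableKernel E}
  {a : ℝ} [ha : Fact (0 < a)]

variable (k) in
/-- The pairing `∫_{-ξ}^{ξ} q*(s, ξ) f(s) ds`. -/
def pairing (f : SymmC a E) (ξ : ℝ) : E := ∫ t in Ioc (-ξ) ξ, k.dualSol a t ξ (f.extend t)

namespace Regular

theorem resolvent_sub_resolvent (hk : k.Regular a) {ξ ξ' : ℝ} (hξ : ξ ∈ Icc 0 a)
    (hξ' : ξ' ∈ Icc 0 a) (f : SymmC a E) :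
    k.resolvent a ξ' f - k.resolvent a ξ f =
      -k.resolvent a ξ ((k.op a ξ' - k.op a ξ) (k.resolvent a ξ' f)) := by
  rw [← map_neg]
  refine hk.eq_resolvent hξ ?_
  rw [map_sub, _root_.sub_apply, ← sub_eq_zero]
  calc _ = k.resolvent a ξ' f + k.op a ξ' (k.resolvent a ξ' f)
        - (k.resolvent a ξ f + k.op a ξ (k.resolvent a ξ f)) := by abel
    _ = 0 := by rw [hk.resolvent_add_op hξ', hk.resolvent_add_op hξ, sub_self]

theorem extend_resolvent_sub_add_truncConv (hk : k.Regular a) {ξ ξ' : ℝ} (hξ : ξ ∈ Icc 0 a)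
    (hξ' : ξ' ∈ Icc 0 a) (hle : ξ ≤ ξ') (f : SymmC a E) {t : ℝ} (ht : t ∈ Icc (-a) a) :
    (k.resolvent a ξ' f - k.resolvent a ξ f).extend t
        + k.truncConv ξ (k.resolvent a ξ' f - k.resolvent a ξ f).extend t =
      -k.conv ((shell ξ ξ').indicator (k.resolvent a ξ' f).extend) t := by
  have hsub := truncConv_sub (k := k) (k.resolvent a ξ' f).bddMeas_extend
    (k.resolvent a ξ f).bddMeas_extend ξ t
  have hshell := truncConv_sub_truncConv (k := k) (k.resolvent a ξ' f).bddMeas_extend hle t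
  have heq := hk.extend_resolvent_add hξ f ht
  rw [← hk.extend_resolvent_add hξ' f ht] at heq
  rw [← hshell, SymmC.extend_sub, hsub, add_sub_assoc', sub_add_eq_add_sub, sub_sub, heq]
  abel

variable [FiniteDimensional ℂ E]

theorem pairing_eq (hk : k.Regular a) {ξ : ℝ} (hξ : ξ ∈ Icc 0 a) (f : SymmC a E) :
    k.pairing f ξ = ∫ t in Ioc (-ξ) ξ, (k.resolvent a ξ f).extend t := by
  rw [← hk.setIntegral_dualSol_apply hξ (k.resolvent a ξ f).bddMeas_extend, pairing]
  refine setIntegral_congr_fun measurableSet_Ioc fun t ht => ?_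
  rw [hk.extend_resolvent_add hξ f ⟨(neg_le_neg hξ.2).trans ht.1.le, ht.2.trans hξ.2⟩]

theorem pairing_sub_pairing (hk : k.Regular a) {ξ ξ' : ℝ} (hξ : ξ ∈ Icc 0 a)
    (hξ' : ξ' ∈ Icc 0 a) (hle : ξ ≤ ξ') (f : SymmC a E) :
    k.pairing f ξ' - k.pairing f ξ =
      ∫ t in shell ξ ξ', k.dualSol a t ξ ((k.resolvent a ξ' f).extend t) := by
  have : CompleteSpace E := FiniteDimensional.complete ℂ E
  set ψ' := k.resolvent a ξ' f
  set ψ := k.resolvent a ξ f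
  have hψ' : ∀ r, IntegrableOn ψ'.extend (Ioc (-r) r) := fun r =>
    ψ'.bddMeas_extend.integrableOn (by simp)
  have hψ : IntegrableOn ψ.extend (Ioc (-ξ) ξ) := ψ.bddMeas_extend.integrableOn (by simp)
  have hqψ' : IntegrableOn (fun t => k.dualSol a t ξ (ψ'.extend t)) (Ioc (-ξ') ξ') :=
    (bddMeas_apply (k.bddMeas_dualSol a ξ) ψ'.bddMeas_extend).integrableOn (by simp)
  have hdiff : ∫ t in Ioc (-ξ) ξ, (ψ' - ψ).extend t =
      -∫ t in shell ξ ξ', (ψ'.extend t - k.dualSol a t ξ (ψ'.extend t)) := by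
    rw [← hk.setIntegral_dualSol_apply hξ (ψ' - ψ).bddMeas_extend,
      ← hk.setIntegral_dualSol_shell hξ hξ' ψ'.bddMeas_extend, ← integral_neg]
    refine setIntegral_congr_fun measurableSet_Ioc fun t ht => ?_
    simp only [hk.extend_resolvent_sub_add_truncConv hξ hξ' hle f
      (⟨(neg_le_neg hξ.2).trans ht.1.le, ht.2.trans hξ.2⟩ : t ∈ Icc (-a) a), map_neg, ψ', ψ]
  have hsplit : ∫ t in shell ξ ξ', ψ'.extend t =
      (∫ t in Ioc (-ξ') ξ', ψ'.extend t) - ∫ t in Ioc (-ξ) ξ, ψ'.extend t :=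
    setIntegral_sdiff measurableSet_Ioc (hψ' ξ') (Ioc_subset_Ioc (neg_le_neg hle) hle)
  have hsh := shell_subset ξ ξ'
  rw [SymmC.extend_sub, integral_sub (hψ' ξ) hψ,
    integral_sub ((hψ' ξ').mono_set hsh) (hqψ'.mono_set hsh), hsplit] at hdiff
  rw [hk.pairing_eq hξ, hk.pairing_eq hξ', ← sub_eq_zero]
  rw [← sub_eq_zero] at hdiff
  rw [← hdiff]
  abel

theorem hasDerivWithinAt_pairing [k.IsEven] (hk : k.Regular a) (f : SymmC a E) {ξ : ℝ}
    (hξ : ξ ∈ Icc 0 a) :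
    HasDerivWithinAt (k.pairing f) (k.dualSol a ξ ξ ((k.resolvent a ξ f).extend ξ +
      (k.resolvent a ξ f).extend (-ξ))) (Icc 0 a) ξ := by
  have : CompleteSpace E := FiniteDimensional.complete ℂ E
  refine hasDerivWithinAt_of_increments (f' := fun ξ => k.dualSol a ξ ξ
    ((k.resolvent a ξ f).extend ξ + (k.resolvent a ξ f).extend (-ξ)))
    ((hk.continuous_dualSol continuous_id continuous_id).clm_apply
      ((hk.continuous_sol f continuous_id continuous_id).add
        (hk.continuous_sol f continuous_neg continuous_id))).continuousOn (fun ε hε => ?_) hξ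
  have hΦ (σ : ℝ → ℝ) (hσ : Continuous σ) : Continuous fun p : ℝ × ℝ × ℝ =>
      k.dualSol a (σ p.1) p.2.1 ((k.resolvent a p.2.2 f).extend (σ p.1)) :=
    (hk.continuous_dualSol (by fun_prop) (by fun_prop)).clm_apply
      (hk.continuous_sol f (by fun_prop) (by fun_prop))
  obtain ⟨δ₁, hδ₁, hright⟩ := exists_norm_sub_diag_le (isCompact_Icc (a := 0) (b := a))
    (hΦ id continuous_id) (half_pos hε)
  obtain ⟨δ₂, hδ₂, hleft⟩ := exists_norm_sub_diag_le (isCompact_Icc (a := 0) (b := a))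
    (hΦ (fun s => -s) continuous_neg) (half_pos hε)
  refine ⟨min δ₁ δ₂, lt_min hδ₁ hδ₂, fun ξ hξ ξ' hξ' hle hlt => ?_⟩
  have hdist : ∀ s ∈ Icc ξ ξ', dist s ξ < min δ₁ δ₂ := fun s hs => by
    rw [Real.dist_eq, abs_of_nonneg (sub_nonneg.2 hs.1)]
    linarith [hs.2]
  have hdξ := hdist ξ ⟨le_rfl, hle⟩
  have hdξ' := hdist ξ' ⟨hle, le_rfl⟩
  have hmem : ∀ s ∈ Icc ξ ξ', s ∈ Icc 0 a := fun s hs => ⟨hξ.1.trans hs.1, hs.2.trans hξ'.2⟩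
  have hint := bddMeas_apply (k.bddMeas_dualSol a ξ) (k.resolvent a ξ' f).bddMeas_extend
  rw [hk.pairing_sub_pairing hξ hξ' hle, map_add]
  refine (norm_setIntegral_shell_sub_le hξ.1 hle (hint.integrableOn (by simp)) (fun s hs =>
    hright ξ hξ s (hmem s hs) ξ hξ ξ' hξ' ((hdist s hs).trans_le (min_le_left _ _))
      (hdξ.trans_le (min_le_left _ _)) (hdξ'.trans_le (min_le_left _ _)))
    (fun s hs => ?_)).trans_eq (by ring)
  rw [← hk.dualSol_neg hξ ξ]
  exact hleft ξ hξ s (hmem s hs) ξ hξ ξ' hξ' ((hdist s hs).trans_le (min_le_right _ _))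
    (hdξ.trans_le (min_le_right _ _)) (hdξ'.trans_le (min_le_right _ _))

end Regular

end IntegrableKernel

section ShellData

variable {E : Type*} [NormedAddCommGroup E] {a : ℝ} [Fact (0 < a)]

/-- The data `v` of a response sum: nodes `0 ≤ y 0 ≤ ⋯ ≤ y N ≤ a`, and on the `i`-th shell `v i` is
bounded by `ε`. -/
structure ShellData (N : ℕ) (y : ℕ → ℝ) (v : ℕ → SymmC a E) (ε : ℝ) : Prop where
  nonneg_bound : 0 ≤ ε
  nonneg : 0 ≤ y 0
  le : y N ≤ a
  le_succ : ∀ i < N, y i ≤ y (i + 1)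
  norm_le : ∀ i < N, ∀ s ∈ shell (y i) (y (i + 1)), ‖(v i).extend s‖ ≤ ε

namespace ShellData

variable {N M : ℕ} {y : ℕ → ℝ} {v : ℕ → SymmC a E} {ε : ℝ}

theorem mem_Icc (h : ShellData N y v ε) {i : ℕ} (hi : i ≤ N) : y i ∈ Icc 0 a :=
  ⟨h.nonneg.trans (le_of_forall_le_succ h.le_succ i.zero_le hi),
    (le_of_forall_le_succ h.le_succ hi le_rfl).trans h.le⟩

theorem take (h : ShellData N y v ε) (hM : M ≤ N) : ShellData M y v ε :=
  ⟨h.nonneg_bound, h.nonneg, (h.mem_Icc hM).2, fun i hi => h.le_succ i (by omega),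
    fun i hi => h.norm_le i (by omega)⟩

theorem drop (h : ShellData (M + N) y v ε) :
    ShellData N (fun i => y (M + i)) (fun i => v (M + i)) ε :=
  ⟨h.nonneg_bound, (h.mem_Icc (by omega)).1, h.le, fun i hi => h.le_succ (M + i) (by omega),
    fun i hi => h.norm_le (M + i) (by omega)⟩

end ShellData

end ShellData

namespace IntegrableKernel

variable {E : Type*} [NormedAddCommGroup E] [NormedSpace ℂ E] {k : IntegrableKernel E}
  {a : ℝ} [ha : Fact (0 < a)]

theorem setIntegral_shell_add {y₀ y₁ y₂ : ℝ} (h₀ : y₀ ≤ y₁) (h₁ : y₁ ≤ y₂) (t : ℝ) :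
    (∫ s in shell y₀ y₁, ‖k (t - s)‖) + (∫ s in shell y₁ y₂, ‖k (t - s)‖) =
      ∫ s in shell y₀ y₂, ‖k (t - s)‖ := by
  have hint : ∀ S, IntegrableOn (fun s => ‖k (t - s)‖) S := fun S =>
    (k.integrable_sub t).norm.integrableOn
  have hsub : ∀ {r r' : ℝ}, r ≤ r' → Ioc (-r) r ⊆ Ioc (-r') r' := fun h =>
    Ioc_subset_Ioc (neg_le_neg h) h
  rw [shell, shell, shell, setIntegral_sdiff measurableSet_Ioc (hint _) (hsub h₀),
    setIntegral_sdiff measurableSet_Ioc (hint _) (hsub h₁),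
    setIntegral_sdiff measurableSet_Ioc (hint _) (hsub (h₀.trans h₁))]
  ring

theorem setIntegral_norm_sub_le_mass (S : Set ℝ) (t : ℝ) : ∫ s in S, ‖k (t - s)‖ ≤ k.mass :=
  (setIntegral_le_integral (k.integrable_sub t).norm
    (ae_of_all _ fun _ => norm_nonneg _)).trans_eq (k.integral_norm_sub t)

theorem Regular.norm_le_of_norm_add_op_le (hk : k.Regular a) {ξ C D : ℝ} (hξ : ξ ∈ Icc 0 a)
    (hC : ‖k.resolvent a ξ‖ ≤ C) (hD : 0 ≤ D) {w : SymmC a E}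
    (hw : ∀ t, ‖(w + k.op a ξ w) t‖ ≤ D) : ‖w‖ ≤ C * D := by
  rw [hk.eq_resolvent hξ (f := w) rfl]
  exact ContinuousLinearMap.le_of_opNorm_le_of_le _ hC ((ContinuousMap.norm_le _ hD).2 hw)

variable (k) in
/-- The sum of the responses `R(y_i) (T(y_{i+1}) - T(y_i)) v_i`, where `R` is the resolvent and `T`
the truncated operator. -/
def shellSum (N : ℕ) (y : ℕ → ℝ) (v : ℕ → SymmC a E) : SymmC a E :=
  ∑ i ∈ Finset.range N, k.resolvent a (y i) ((k.op a (y (i + 1)) - k.op a (y i)) (v i))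

theorem shellSum_add (N M : ℕ) (y : ℕ → ℝ) (v : ℕ → SymmC a E) :
    k.shellSum (N + M) y v =
      k.shellSum N y v + k.shellSum M (fun i => y (N + i)) (fun i => v (N + i)) :=
  Finset.sum_range_add _ _ _

theorem shellSum_one (y : ℕ → ℝ) (v : ℕ → SymmC a E) :
    k.shellSum 1 y v = k.resolvent a (y 0) ((k.op a (y 1) - k.op a (y 0)) (v 0)) := by
  simp [shellSum]

section ShellSum

variable {N : ℕ} {y : ℕ → ℝ} {v : ℕ → SymmC a E} {ε : ℝ}

theorem norm_shellSum_one_le (h : ShellData 1 y v ε) {C : ℝ} (hC : ‖k.resolvent a (y 0)‖ ≤ C) :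
    ‖k.shellSum 1 y v‖ ≤ C * (k.mass * ε) := by
  rw [shellSum_one]
  have hε := h.nonneg_bound
  have hmass := k.mass_nonneg
  refine ContinuousLinearMap.le_of_opNorm_le_of_le _ hC
    ((ContinuousMap.norm_le _ (by positivity)).2 fun t => ?_)
  exact (norm_op_sub_apply_le (h.le_succ 0 one_pos) _ (h.norm_le 0 one_pos) t).trans
    (mul_le_mul_of_nonneg_right (setIntegral_norm_sub_le_mass _ _) hε)

theorem norm_shellSum_succ_add_op_apply_le (hk : k.Regular a) (h : ShellData (1 + N) y v ε)
    (t : Icc (-a) a) :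
    let w := k.shellSum N (fun i => y (1 + i)) fun i => v (1 + i)
    ‖w‖ ≤ ε → ‖(w + k.op a (y 1) w) t‖ ≤ (∫ s in shell (y 1) (y (1 + N)), ‖k (t - s)‖) * (2 * ε) →
      ‖(k.shellSum (1 + N) y v + k.op a (y 0) (k.shellSum (1 + N) y v)) t‖ ≤
        (∫ s in shell (y 0) (y (1 + N)), ‖k (t - s)‖) * (2 * ε) := by
  intro w hw hwt
  have hsplit : k.shellSum (1 + N) y v + k.op a (y 0) (k.shellSum (1 + N) y v)
      = (k.op a (y 1) - k.op a (y 0)) (v 0 - w) + (w + k.op a (y 1) w) := by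
    rw [shellSum_add, shellSum_one, map_add, add_add_add_comm,
      hk.resolvent_add_op (h.mem_Icc (by omega)), map_sub, _root_.sub_apply _ _ w]
    abel
  rw [hsplit, ContinuousMap.add_apply, ← setIntegral_shell_add (h.le_succ 0 (by omega))
    (le_of_forall_le_succ h.le_succ (by omega) le_rfl), add_mul]
  refine norm_add_le_of_le (norm_op_sub_apply_le (h.le_succ 0 (by omega)) _ (fun s hs => ?_) t) hwt
  rw [SymmC.extend_sub, two_mul]
  exact norm_sub_le_of_le (h.norm_le 0 (by omega) s hs) ((w.norm_extend_le s).trans hw)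

theorem norm_shellSum_le_of_mass_shell_le (hk : k.Regular a) {C : ℝ} (hC : 0 < C)
    (hres : ∀ ξ, ‖k.resolvent a ξ‖ ≤ C) (h : ShellData N y v ε)
    (hmass : ∀ t, ∫ s in shell (y 0) (y N), ‖k (t - s)‖ ≤ 1 / (2 * C)) :
    ‖k.shellSum N y v‖ ≤ ε ∧ ∀ t, ‖(k.shellSum N y v + k.op a (y 0) (k.shellSum N y v)) t‖ ≤
      (∫ s in shell (y 0) (y N), ‖k (t - s)‖) * (2 * ε) := by
  have hε := h.nonneg_bound
  induction N generalizing y v with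
  | zero =>
    refine ⟨by simpa [shellSum] using hε, fun t => ?_⟩
    simp only [shellSum, Finset.range_zero, Finset.sum_empty, map_zero, add_zero,
      ContinuousMap.zero_apply, norm_zero]
    positivity
  | succ N ih =>
    rw [add_comm N 1] at *
    have htail : ∀ t, ∫ s in shell (y 1) (y (1 + N)), ‖k (t - s)‖ ≤ 1 / (2 * C) := fun t => by
      refine le_trans ?_ (hmass t)
      rw [← setIntegral_shell_add (h.le_succ 0 (by omega))
        (le_of_forall_le_succ h.le_succ (by omega) le_rfl)]
      exact le_add_of_nonneg_left (integral_nonneg fun _ => norm_nonneg _)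
    obtain ⟨hw, hwt⟩ := ih h.drop htail
    have hpt := fun t => norm_shellSum_succ_add_op_apply_le hk h t hw (hwt t)
    refine ⟨(hk.norm_le_of_norm_add_op_le (h.mem_Icc (by omega)) (hres _) (by positivity)
      fun t => (hpt t).trans (mul_le_mul_of_nonneg_right (hmass t) (by positivity))).trans_eq ?_,
      hpt⟩
    field_simp

end ShellSum

namespace Regular

theorem exists_norm_shellSum_le_of_sub_lt [CompleteSpace E] (hk : k.Regular a) :
    ∃ δ > 0, ∀ N y (v : ℕ → SymmC a E) ε, ShellData N y v ε → y N - y 0 < δ →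
      ‖k.shellSum N y v‖ ≤ ε := by
  obtain ⟨C, hC, hres⟩ := hk.exists_norm_resolvent_le
  obtain ⟨δ, hδ, hmass⟩ := k.exists_setIntegral_norm_sub_lt (ε := 1 / (2 * C)) (by positivity)
  refine ⟨δ / 2, by positivity, fun N y v ε h hlt =>
    (norm_shellSum_le_of_mass_shell_le hk hC hres h fun t => (hmass _ ?_ t).le).1⟩
  rw [volume_shell h.nonneg (le_of_forall_le_succ h.le_succ N.zero_le le_rfl)]
  exact (ENNReal.ofReal_lt_ofReal_iff hδ).2 (by linarith)

/- The partition is cut at the first node from which less than `(m + 1) * δ` remains; the step that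
ends there may be long, but its response is bounded by the mass of the kernel. -/
theorem norm_shellSum_le_of_sub_lt_mul [CompleteSpace E] {C δ : ℝ} (hC : 0 < C) (hδ : 0 < δ)
    (hres : ∀ ξ, ‖k.resolvent a ξ‖ ≤ C)
    (hshort : ∀ N y (v : ℕ → SymmC a E) ε, ShellData N y v ε → y N - y 0 < δ →
      ‖k.shellSum N y v‖ ≤ ε) (m : ℕ) {N : ℕ} {y : ℕ → ℝ} {v : ℕ → SymmC a E} {ε : ℝ}
    (h : ShellData N y v ε) (hlt : y N - y 0 < (m + 1) * δ) :
    ‖k.shellSum N y v‖ ≤ (m + 1) * (1 + C * k.mass) * ε := by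
  have hmass := k.mass_nonneg
  have hε := h.nonneg_bound
  induction m generalizing N y v with
  | zero =>
    refine (hshort N y v ε h (by simpa using hlt)).trans (le_mul_of_one_le_left hε ?_)
    simpa using mul_nonneg hC.le hmass
  | succ m ih =>
    push_cast at hlt ⊢
    by_cases hshorter : y N - y 0 < (m + 1) * δ
    · refine (ih h hshorter).trans ?_
      gcongr
      linarith
    obtain ⟨i, hi, hsucc⟩ := Nat.exists_not_and_succ_of_not_zero_of_exists
      (p := fun i => i < N → y N - y i < (m + 1) * δ)
      (fun h0 => hshorter (by
        rcases Nat.eq_zero_or_pos N with rfl | hN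
        · rw [sub_self]; positivity
        · exact h0 hN)) ⟨N, fun hN => absurd hN (lt_irrefl N)⟩
    obtain ⟨hiN, hlong⟩ := Classical.not_imp.1 hi
    obtain ⟨r, rfl⟩ := Nat.exists_eq_add_of_lt hiN
    rw [show i + r + 1 = i + 1 + r by ring] at *
    have hhead := hshort i y v ε (h.take (by omega)) (by linarith)
    have hstep := norm_shellSum_one_le (k := k)
      (ShellData.drop (M := i) (h.take (by omega : i + 1 ≤ i + 1 + r))) (hres _)
    have htail := ih h.drop (by
      rcases Nat.eq_zero_or_pos r with rfl | hr
      · simp only [add_zero, sub_self]; positivity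
      · exact hsucc (by omega))
    rw [shellSum_add, shellSum_add]
    refine (norm_add_le_of_le (norm_add_le_of_le hhead hstep) htail).trans_eq ?_
    ring

theorem exists_norm_shellSum_le [CompleteSpace E] (hk : k.Regular a) :
    ∃ K > 0, ∀ N y (v : ℕ → SymmC a E) ε, ShellData N y v ε → ‖k.shellSum N y v‖ ≤ K * ε := by
  obtain ⟨δ, hδ, hshort⟩ := hk.exists_norm_shellSum_le_of_sub_lt
  obtain ⟨C, hC, hres⟩ := hk.exists_norm_resolvent_le
  have hmass := k.mass_nonneg
  obtain ⟨m, hm⟩ := exists_nat_gt (a / δ)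
  rw [div_lt_iff₀ hδ] at hm
  exact ⟨(m + 1) * (1 + C * k.mass), by positivity, fun N y v ε h =>
    norm_shellSum_le_of_sub_lt_mul hC hδ hres hshort m h (by linarith [h.nonneg, h.le])⟩

theorem extend_resolvent_abs [k.IsEven] (hk : k.Regular a) {ξ : ℝ} (hξ : ξ ∈ Icc 0 a)
    {f : SymmC a E} (hf : f.reflect = f) (s : ℝ) :
    (k.resolvent a ξ f).extend |s| = (k.resolvent a ξ f).extend s := by
  rcases abs_choice s with h | h
  · rw [h]
  · rw [h, ← SymmC.extend_reflect, ← hk.resolvent_reflect hξ, hf]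

theorem extend_shellSum_resolvent (hk : k.Regular a) {N : ℕ} {y : ℕ → ℝ}
    (hy : ∀ i ≤ N, y i ∈ Icc 0 a) (f : SymmC a E) (c : ℕ → E) {t : ℝ} (ht : t ∈ Icc (-a) a) :
    (k.shellSum N y fun i =>
        k.resolvent a (y (i + 1)) (f - ContinuousMap.const _ (c i))).extend t =
      (∑ i ∈ Finset.range N, (k.unitSol a t (y (i + 1)) - k.unitSol a t (y i)) (c i)) -
        ((k.resolvent a (y N) f).extend t - (k.resolvent a (y 0) f).extend t) := by
  rw [← Finset.sum_range_sub (fun i => (k.resolvent a (y i) f).extend t),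
    SymmC.extend_apply _ ht, shellSum, ContinuousMap.sum_apply, ← Finset.sum_sub_distrib]
  refine Finset.sum_congr rfl fun i hi => ?_
  rw [Finset.mem_range] at hi
  rw [← neg_neg (k.resolvent a (y i) _), ← hk.resolvent_sub_resolvent (hy i hi.le) (hy (i + 1) hi),
    neg_sub, map_sub, map_sub, ← SymmC.extend_apply _ ht]
  simp only [SymmC.extend_sub, _root_.sub_apply, unitSol_apply]
  abel

section EvenRightHandSide

variable [k.IsEven] {f : SymmC a E} {c : ℝ → E}

theorem unitSol_abs_apply (hk : k.Regular a) (hf : f.reflect = f)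
    (hcf : ∀ ξ ∈ Icc 0 a, (k.resolvent a ξ f).extend ξ = k.unitSol a ξ ξ (c ξ)) {t : ℝ}
    (ht : |t| ∈ Icc 0 a) : k.unitSol a t |t| (c |t|) = (k.resolvent a |t| f).extend t := by
  rw [← hk.extend_resolvent_abs ht hf t, hcf _ ht]
  exact (hk.extend_resolvent_abs ht (f := ContinuousMap.const _ (c |t|)) rfl t).symm

variable [FiniteDimensional ℂ E]

theorem exists_norm_resolvent_sub_const_le (hk : k.Regular a) (hf : f.reflect = f)
    (hc : ContinuousOn c (Icc 0 a))
    (hcf : ∀ ξ ∈ Icc 0 a, (k.resolvent a ξ f).extend ξ = k.unitSol a ξ ξ (c ξ)) {ε : ℝ}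
    (hε : 0 < ε) :
    ∃ δ > 0, ∀ ξ ∈ Icc 0 a, ∀ η ∈ Icc 0 a, |η - ξ| < δ → ∀ s, |s| ∈ Icc 0 a → |(|s| - ξ)| < δ →
      ‖(k.resolvent a ξ (f - ContinuousMap.const _ (c η))).extend s‖ ≤ ε := by
  have : CompleteSpace E := FiniteDimensional.complete ℂ E
  have hc' : Continuous (IccExtend ha.out.le ((Icc 0 a).domRestrict c)) :=
    hc.domRestrict.Icc_extend'
  have hcc : ∀ ξ ∈ Icc 0 a, IccExtend ha.out.le ((Icc 0 a).domRestrict c) ξ = c ξ :=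
    fun ξ hξ => IccExtend_of_mem _ _ hξ
  have hΘ : Continuous fun p : ℝ × ℝ × ℝ => (k.resolvent a p.2.1 f).extend p.1 -
      k.unitSol a p.1 p.2.1 (IccExtend ha.out.le ((Icc 0 a).domRestrict c) p.2.2) :=
    (hk.continuous_sol f (by fun_prop) (by fun_prop)).sub
      ((hk.continuous_unitSol (by fun_prop) (by fun_prop)).clm_apply (by fun_prop))
  obtain ⟨δ, hδ, hclose⟩ := exists_norm_sub_diag_le (isCompact_Icc (a := 0) (b := a)) hΘ hε
  refine ⟨δ, hδ, fun ξ hξ η hη hηξ s hs hsξ => ?_⟩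
  have hnear := hclose ξ hξ |s| hs ξ hξ η hη hsξ (by rwa [dist_self]) hηξ
  have hreflect : (f - ContinuousMap.const _ (c η)).reflect = f - ContinuousMap.const _ (c η) :=
    ContinuousMap.ext fun t => congrArg (fun w : SymmC a E => w t - c η) hf
  rw [hcc ξ hξ, hcc η hη, hcf ξ hξ, sub_self, sub_zero] at hnear
  rw [← hk.extend_resolvent_abs hξ hreflect, map_sub, SymmC.extend_sub]
  exact hnear

/- Summation by parts turns the Riemann–Stieltjes sum into the value of a response sum whose data
vanish on the diagonal, hence are small for fine partitions. -/
theorem hasRSIntegral_unitSol (hk : k.Regular a) (hf : f.reflect = f)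
    (hc : ContinuousOn c (Icc 0 a))
    (hcf : ∀ ξ ∈ Icc 0 a, (k.resolvent a ξ f).extend ξ = k.unitSol a ξ ξ (c ξ)) {t : ℝ}
    (ht : t ∈ Icc (-a) a) :
    HasRSIntegral (fun ξ => k.unitSol a t ξ) c |t| a
      (k.unitSol a t a (c a) - (k.resolvent a a f).extend t) := by
  have : CompleteSpace E := FiniteDimensional.complete ℂ E
  intro ε hε
  obtain ⟨K, hK, hsum⟩ := hk.exists_norm_shellSum_le
  obtain ⟨δ, hδ, hclose⟩ := hk.exists_norm_resolvent_sub_const_le hf hc hcf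
    (ε := ε / (2 * K)) (by positivity)
  refine ⟨δ / 2, by positivity, fun N x τ hp => ?_⟩
  have hp_abs : Icc |t| a ⊆ Icc 0 a := Icc_subset_Icc_left (abs_nonneg t)
  set y := tagPoints N x τ
  have hy0 : y 0 = |t| := hp.first
  have hyN : y (N + 1) = a := tagPoints_last.trans hp.last
  have hyI : ∀ i ≤ N + 1, y i ∈ Icc 0 a := fun i hi => hp_abs
    ⟨hy0 ▸ le_of_forall_le_succ hp.tagPoints_le_succ i.zero_le hi,
      hyN ▸ le_of_forall_le_succ hp.tagPoints_le_succ hi le_rfl⟩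
  have hdata : ShellData (N + 1) y
      (fun i => k.resolvent a (y (i + 1)) (f - ContinuousMap.const _ (c (x i)))) (ε / (2 * K)) := by
    refine ⟨by positivity, (hyI 0 (by omega)).1, hyN.le, hp.tagPoints_le_succ, fun i hi s hs => ?_⟩
    have hs := abs_mem_of_mem_shell hs
    have hyi := hyI (i + 1) hi
    have := hp.sub_tagPoints_lt (half_pos hδ) hi
    have := hp.tagPoints_sub_lt (half_pos hδ) hi
    refine hclose _ hyi _ (hp_abs (hp.mem_Icc (by omega))) (abs_lt.2 ⟨?_, ?_⟩) s
      ⟨abs_nonneg s, hs.2.trans hyi.2⟩ (abs_lt.2 ⟨?_, ?_⟩) <;>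
    linarith [hs.1, hs.2, hp.le_tagPoints hi]
  have hsmall : ‖(k.shellSum (N + 1) y fun i =>
      k.resolvent a (y (i + 1)) (f - ContinuousMap.const _ (c (x i)))).extend t‖ < ε := by
    refine ((SymmC.norm_extend_le _ t).trans (hsum _ _ _ _ hdata)).trans_lt ?_
    rw [mul_div_assoc', mul_comm K, mul_div_mul_right _ _ hK.ne']
    exact half_lt_self hε
  rw [hk.extend_shellSum_resolvent hyI f (fun i => c (x i)) ht, hy0, hyN, norm_sub_rev] at hsmall
  rw [rsSum_eq_sub_sum_tagPoints, hp.first, hp.last,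
    hk.unitSol_abs_apply hf hcf ⟨abs_nonneg t, abs_le.2 ht⟩]
  refine lt_of_eq_of_lt (congrArg norm ?_) hsmall
  rw [sub_sub_eq_add_sub]
  abel

end EvenRightHandSide

end Regular

end IntegrableKernel

theorem tendsto_average {F : Type*} [NormedAddCommGroup F] [NormedSpace ℝ F] [CompleteSpace F]
    {Φ : ℝ → ℝ → F} {c : ℝ → ℝ} {σ : ℝ} {L : F} (hΦ : ∀ r, Continuous (Φ r))
    (hlim : Tendsto (fun p : ℝ × ℝ => Φ p.1 p.2) (𝓝[>] 0 ×ˢ 𝓝 σ) (𝓝 L))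
    (hc : ∀ᶠ r in 𝓝[>] (0 : ℝ), c r ∈ Icc (σ - 2 * r) σ) :
    Tendsto (fun r => (2 * r)⁻¹ • ∫ t in (c r)..(c r + 2 * r), Φ r t) (𝓝[>] 0) (𝓝 L) := by
  refine Metric.tendsto_nhds.2 fun ε hε => ?_
  obtain ⟨small, hsmall, near, hnear, hdist⟩ :=
    eventually_prod_iff.1 (Metric.tendsto_nhds.1 hlim (ε / 2) (half_pos hε))
  obtain ⟨δ, hδ, hball⟩ := Metric.eventually_nhds_iff.1 hnear
  filter_upwards [hsmall, hc, Ioo_mem_nhdsGT (half_pos hδ)] with r hr hcr ⟨hr0, hrδ⟩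
  have hle : c r ≤ c r + 2 * r := by linarith
  have hclose : ∀ t ∈ Icc (c r) (c r + 2 * r), ‖Φ r t - L‖ ≤ ε / 2 := fun t ht => by
    rw [← dist_eq_norm]
    refine (hdist hr (hball ?_)).le
    rw [Real.dist_eq, abs_lt]
    constructor <;> linarith [ht.1, ht.2, hcr.1, hcr.2]
  have hint := norm_setIntegral_Ioc_sub_le hle
    ((hΦ r).integrableOn_Icc.mono_set Ioc_subset_Icc_self) hclose
  rw [add_sub_cancel_left, ← intervalIntegral.integral_of_le hle] at hint
  have hfactor : (2 * r)⁻¹ • (∫ t in (c r)..(c r + 2 * r), Φ r t) - L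
      = (2 * r)⁻¹ • ((∫ t in (c r)..(c r + 2 * r), Φ r t) - (2 * r) • L) := by
    rw [smul_sub, smul_smul, inv_mul_cancel₀ (by positivity), one_smul]
  rw [dist_eq_norm, hfactor, norm_smul, Real.norm_eq_abs, abs_of_pos (by positivity)]
  refine (mul_le_mul_of_nonneg_left hint (by positivity)).trans_lt ?_
  field_simp
  linarith

theorem integral_shift_sub_shift {F : Type*} [NormedAddCommGroup F] [NormedSpace ℝ F]
    {g : ℝ → F} (hg : Continuous g) (b m r : ℝ) :
    ∫ t in b..m, (g (t + r) - g (t - r)) =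
      (∫ t in (m - r)..(m + r), g t) - ∫ t in (b - r)..(b + r), g t := by
  have hi : ∀ c d, IntervalIntegrable g volume c d := hg.intervalIntegrable
  have hadd : Continuous fun t => g (t + r) := by fun_prop
  have hsub : Continuous fun t => g (t - r) := by fun_prop
  rw [intervalIntegral.integral_sub (hadd.intervalIntegrable _ _) (hsub.intervalIntegrable _ _),
    intervalIntegral.integral_comp_add_right, intervalIntegral.integral_comp_sub_right]
  exact intervalIntegral.integral_interval_sub_interval_comm (hi _ _) (hi _ _) (hi _ _)
    |>.trans (by rw [intervalIntegral.integral_symm (m - r), intervalIntegral.integral_symm (b - r)]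
                 abel)

theorem integral_apply_indicator_Iic {E F : Type*} [NormedAddCommGroup E] [NormedSpace ℂ E]
    [NormedAddCommGroup F] [NormedSpace ℂ F] (G : ℝ → E →L[ℂ] F) {b c : ℝ} (h : b ≤ c) (y : ℝ)
    (x : E) : ∫ t in b..c, G t ((Iic y).indicator (fun _ => x) t) =
      ∫ t in b..(max b (min c y)), G t x := by
  have hind : (fun t => G t ((Iic y).indicator (fun _ => x) t))
      = (Iic y).indicator fun t => G t x := by
    ext t
    by_cases ht : t ∈ Iic y <;> simp only [ht, indicator_of_mem, indicator_of_notMem,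
      not_false_eq_true, map_zero]
  have hset : Ioc b (max b (min c y)) = Ioc b (min c y) := by
    ext t
    simp only [mem_Ioc]
    grind
  rw [intervalIntegral.integral_of_le h, intervalIntegral.integral_of_le (le_max_left _ _), hind,
    setIntegral_indicator measurableSet_Iic, Ioc_inter_Iic, hset]

theorem sum_indicator_Ioc {E : Type*} [AddCommMonoid E] {N : ℕ} {y : ℕ → ℝ}
    (hy : ∀ i < N, y i ≤ y (i + 1)) (f : ℝ → E) (s : ℝ) :
    ∑ i ∈ Finset.range N, (Ioc (y i) (y (i + 1))).indicator f s =
      (Ioc (y 0) (y N)).indicator f s := by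
  induction N with
  | zero => simp
  | succ N ih =>
    have h0 : y 0 ≤ y N := le_of_forall_le_succ hy N.zero_le N.le_succ
    have hdisj : Disjoint (Ioc (y 0) (y N)) (Ioc (y N) (y (N + 1))) :=
      Ioc_disjoint_Ioc_of_le le_rfl
    rw [Finset.sum_range_succ, ih fun i hi => hy i (by omega),
      ← Ioc_union_Ioc_eq_Ioc h0 (hy N N.lt_succ_self), indicator_union_of_disjoint hdisj]

theorem norm_sum_indicator_Ioc_sub_le {E : Type*} [NormedAddCommGroup E] {N : ℕ} {y : ℕ → ℝ}
    (hy : ∀ i < N, y i ≤ y (i + 1)) {c : ℕ → E} {f : ℝ → E} {ε : ℝ}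
    (h : ∀ i < N, ∀ s ∈ Ioc (y i) (y (i + 1)), ‖c i - f s‖ ≤ ε) {s : ℝ}
    (hs : s ∈ Ioc (y 0) (y N)) :
    ‖∑ i ∈ Finset.range N, (Ioc (y i) (y (i + 1))).indicator (fun _ => c i) s - f s‖ ≤ ε := by
  have hf := sum_indicator_Ioc hy f s
  have hε := sum_indicator_Ioc hy (fun _ => ε) s
  rw [indicator_of_mem hs] at hf hε
  rw [← hf, ← hε, ← Finset.sum_sub_distrib]
  refine norm_sum_le_of_le _ fun i hi => ?_
  by_cases hsi : s ∈ Ioc (y i) (y (i + 1))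
  · simpa only [indicator_of_mem hsi] using h i (Finset.mem_range.1 hi) s hsi
  · simp only [indicator_of_notMem hsi, sub_zero, norm_zero, le_refl]

namespace BddMeas

variable {E : Type*} [NormedAddCommGroup E]

theorem indicator_const {S : Set ℝ} (hS : MeasurableSet S) (x : E) :
    BddMeas (S.indicator fun _ => x) ‖x‖ :=
  BddMeas.indicator ⟨aestronglyMeasurable_const, fun _ => le_rfl⟩ hS

theorem sum {ι : Type*} {u : ι → ℝ → E} {C : ι → ℝ} (h : ∀ i, BddMeas (u i) (C i))
    (s : Finset ι) : BddMeas (fun t => ∑ i ∈ s, u i t) (∑ i ∈ s, C i) :=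
  ⟨s.aestronglyMeasurable_fun_sum fun i _ => (h i).aestronglyMeasurable,
    fun t => norm_sum_le_of_le s fun i _ => (h i).norm_le t⟩

end BddMeas

namespace IntegrableKernel

variable {E : Type*} [NormedAddCommGroup E] [NormedSpace ℂ E] {k : IntegrableKernel E}
  {u v : ℝ → E} {C D : ℝ} {a : ℝ}

theorem conv_shift (u : ℝ → E) (t r : ℝ) : k.conv u (t - r) = k.conv (fun s => u (s - r)) t := by
  rw [conv, conv, ← integral_sub_right_eq_self (fun s => k (t - r - s) (u s)) r]
  simp only [sub_sub_sub_cancel_right]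

theorem truncConv_shift (η : ℝ) (u : ℝ → E) (t r : ℝ) : k.truncConv η u (t - r) =
    k.conv ((Ioc (-η + r) (η + r)).indicator fun s => u (s - r)) t := by
  rw [truncConv, conv_shift]
  congr 1
  ext s
  simp only [indicator_apply, mem_Ioc, lt_sub_iff_add_lt, sub_le_iff_le_add]

variable (k a) in
/-- The truncated convolution of a bounded measurable function, as an element of `C[-a, a]`. -/
def truncLift (hu : BddMeas u C) (ξ : ℝ) : SymmC a E :=
  SymmC.restrict a (k.truncConv ξ u) (continuous_truncConv hu ξ)

theorem truncLift_sub (hu : BddMeas u C) (hv : BddMeas v D) (ξ : ℝ) :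
    k.truncLift a (hu.sub hv) ξ = k.truncLift a hu ξ - k.truncLift a hv ξ :=
  ContinuousMap.ext fun t => truncConv_sub hu hv ξ t

theorem truncConv_sum {ι : Type*} {u : ι → ℝ → E} {C : ι → ℝ} (h : ∀ i, BddMeas (u i) (C i))
    (s : Finset ι) (ξ t : ℝ) :
    k.truncConv ξ (fun x => ∑ i ∈ s, u i x) t = ∑ i ∈ s, k.truncConv ξ (u i) t := by
  classical
  induction s using Finset.induction_on with
  | empty => simp [truncConv, conv]
  | insert i s hi ih =>
    simp only [Finset.sum_insert hi]
    rw [truncConv_add (h i) (BddMeas.sum h s), ih]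

theorem truncLift_sum {ι : Type*} {u : ι → ℝ → E} {C : ι → ℝ} (h : ∀ i, BddMeas (u i) (C i))
    (s : Finset ι) (ξ : ℝ) :
    k.truncLift a (BddMeas.sum h s) ξ = ∑ i ∈ s, k.truncLift a (h i) ξ := by
  ext t
  rw [ContinuousMap.sum_apply]
  exact truncConv_sum h s ξ t

theorem norm_truncLift_le (hu : BddMeas u C) {ξ D : ℝ} (hD : 0 ≤ D)
    (h : ∀ s ∈ Ioc (-ξ) ξ, ‖u s‖ ≤ D) : ‖k.truncLift a hu ξ‖ ≤ k.mass * D :=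
  (ContinuousMap.norm_le _ (mul_nonneg k.mass_nonneg hD)).2 fun t =>
    (norm_conv_indicator_le measurableSet_Ioc h t).trans
      (mul_le_mul_of_nonneg_right (setIntegral_norm_sub_le_mass _ _) hD)

theorem continuousOn_truncLift (hu : BddMeas u C) : ContinuousOn (k.truncLift a hu) (Ici 0) := by
  refine (uniformContinuousOn_of_increments (F := SymmC a E) fun ε hε => ?_).continuousOn
  have hC : 0 < C + 1 := by linarith [hu.nonneg]
  obtain ⟨δ, hδ, hmass⟩ := k.exists_setIntegral_norm_sub_lt (div_pos hε hC)
  refine ⟨δ / 2, by positivity, fun ξ h0 ξ' _ hle hlt =>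
    (dist_eq_norm (E := SymmC a E) _ _).trans_le ((ContinuousMap.norm_le _ hε.le).2 fun t => ?_)⟩
  refine (congrArg norm (truncConv_sub_truncConv hu hle t)).trans_le
    ((norm_conv_indicator_le (measurableSet_shell _ _) (fun s _ => hu.norm_le s) _).trans ?_)
  have hshell := hmass (shell ξ ξ') (by
    rw [volume_shell h0 hle]
    exact (ENNReal.ofReal_lt_ofReal_iff hδ).2 (by linarith)) t
  refine (mul_le_mul_of_nonneg_right hshell.le hu.nonneg).trans ?_
  rw [div_mul_eq_mul_div, div_le_iff₀ hC]
  nlinarith [hu.nonneg]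

variable [ha : Fact (0 < a)]

theorem extend_truncLift (hu : BddMeas u C) (ξ : ℝ) {t : ℝ} (ht : t ∈ Icc (-a) a) :
    (k.truncLift a hu ξ).extend t = k.truncConv ξ u t :=
  SymmC.extend_restrict (continuous_truncConv hu ξ) ht

variable (k a) in
/-- `response a hu ξ` is the truncated convolution `∫_{-ξ}^{ξ} k(t - s) v(s) ds` of the solution `v`
of the truncated equation with the bounded measurable right-hand side `u`. -/
def response (hu : BddMeas u C) (ξ : ℝ) : SymmC a E := k.resolvent a ξ (k.truncLift a hu ξ)

variable (k a) in
/-- The solution of the truncated equation with the bounded measurable right-hand side `u`. -/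
def bddSol (hu : BddMeas u C) (ξ t : ℝ) : E := u t - (k.response a hu ξ).extend t

theorem bddMeas_bddSol (hu : BddMeas u C) (ξ : ℝ) :
    BddMeas (k.bddSol a hu ξ) (C + ‖k.resolvent a ξ‖ * (k.mass * C)) :=
  (hu.sub (k.response a hu ξ).bddMeas_extend).mono <| by
    gcongr
    exact ContinuousLinearMap.le_of_opNorm_le_of_le _ le_rfl
      (norm_truncLift_le hu hu.nonneg fun s _ => hu.norm_le s)

namespace Regular

theorem truncConv_bddSol (hk : k.Regular a) {ξ : ℝ} (hξ : ξ ∈ Icc 0 a) (hu : BddMeas u C) {t : ℝ}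
    (ht : t ∈ Icc (-a) a) : k.truncConv ξ (k.bddSol a hu ξ) t = (k.response a hu ξ).extend t := by
  have hsplit : k.truncConv ξ (k.bddSol a hu ξ) t
      = k.truncConv ξ u t - k.truncConv ξ (k.response a hu ξ).extend t :=
    truncConv_sub hu (k.response a hu ξ).bddMeas_extend ξ t
  rw [hsplit, ← extend_truncLift (a := a) hu ξ ht, ← hk.extend_resolvent_add hξ _ ht]
  exact add_sub_cancel_right _ _

theorem continuousOn_response [CompleteSpace E] (hk : k.Regular a) (hu : BddMeas u C) :
    ContinuousOn (k.response a hu) (Icc 0 a) :=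
  hk.continuous_resolvent.continuousOn.clm_apply
    ((continuousOn_truncLift hu).mono Icc_subset_Ici_self)

theorem tendsto_truncConv_bddSol [CompleteSpace E] (hk : k.Regular a) (hu : BddMeas u C)
    {ι : Type*} {l : Filter ι} {η x : ι → ℝ} {ξ σ : ℝ} (hξ : ξ ∈ Icc 0 a) (hσ : σ ∈ Icc (-a) a)
    (hη : Tendsto η l (𝓝[Icc 0 a] ξ)) (hx : Tendsto x l (𝓝 σ)) :
    Tendsto (fun i => k.truncConv (η i) (k.bddSol a hu (η i)) (x i)) l
      (𝓝 ((k.response a hu ξ).extend σ)) := by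
  obtain ⟨K, hK, hres⟩ := hk.exists_norm_resolvent_le
  have hm := k.mass_nonneg
  have hC := hu.nonneg
  set B := C + K * (k.mass * C)
  have hB : 0 < B + 1 := by positivity
  have hsol : ∀ i, BddMeas (k.bddSol a hu (η i)) B := fun i =>
    (bddMeas_bddSol hu _).mono (by simp only [B]; gcongr; exact hres _)
  have hresp := (hk.continuousOn_response hu ξ hξ).tendsto.comp hη
  have hrespσ : Tendsto (fun i => (k.response a hu (η i)).extend σ) l
      (𝓝 ((k.response a hu ξ).extend σ)) :=
    ((continuous_eval_const _).tendsto (k.response a hu ξ)).comp hresp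
  refine hrespσ.congr_dist (Metric.tendsto_nhds.2 fun ε hε => ?_)
  obtain ⟨δ, hδ, hconv⟩ := k.exists_norm_conv_sub_le (div_pos hε hB)
  filter_upwards [Metric.tendsto_nhds.1 hx δ hδ, hη.eventually self_mem_nhdsWithin] with i hi hηi
  rw [← hk.truncConv_bddSol hηi hu hσ, dist_zero_right, Real.norm_eq_abs, abs_of_nonneg dist_nonneg,
    dist_comm, dist_eq_norm]
  refine (hconv (x i) σ hi _ _ ((hsol i).indicator measurableSet_Ioc)).trans_lt ?_
  rw [div_mul_eq_mul_div, div_lt_iff₀ hB]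
  nlinarith

variable [FiniteDimensional ℂ E]

theorem integral_dualSol_truncConv_shift (hk : k.Regular a) {ξ η ρ : ℝ} (hξ : ξ ∈ Icc 0 a)
    (hη : 0 ≤ η) (hadd : η + ρ ≤ ξ) (hsub : η - ρ ≤ ξ) (hv : BddMeas v C) :
    ∫ t in (-ξ)..ξ, k.dualSol a t ξ (k.truncConv η v (t - ρ)) =
      ∫ s in (-η)..η, (v s - k.dualSol a (s + ρ) ξ (v s)) := by
  have : CompleteSpace E := FiniteDimensional.complete ℂ E
  have hvshift : BddMeas (fun s => v (s - ρ)) C :=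
    ⟨hv.aestronglyMeasurable.comp_measurePreserving (measurePreserving_sub_right volume ρ),
      fun s => hv.norm_le _⟩
  have hsubst := intervalIntegral.integral_comp_add_right
    (fun s => v (s - ρ) - k.dualSol a s ξ (v (s - ρ))) (a := -η) (b := η) ρ
  simp only [add_sub_cancel_right] at hsubst
  simp_rw [truncConv_shift]
  rw [hsubst, intervalIntegral.integral_of_le (by linarith [hξ.1]),
    setIntegral_apply_conv (k.bddMeas_dualSol a ξ) hvshift measurableSet_Ioc measurableSet_Ioc
      (by simp), intervalIntegral.integral_of_le (by linarith)]
  refine setIntegral_congr_fun measurableSet_Ioc fun s hs => ?_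
  have hdual : k.dual.conv ((Ioc (-ξ) ξ).indicator fun s => k.dualSol a s ξ) s
      = 1 - k.dualSol a s ξ := eq_sub_of_add_eq'
    (hk.dualSol_add hξ ⟨by linarith [hs.1, hξ.2], by linarith [hs.2, hξ.2]⟩)
  simp only [hdual]
  rfl

theorem integral_dualSol_shift_apply_add_truncConv (hk : k.Regular a) {ξ η ρ : ℝ}
    (hξ : ξ ∈ Icc 0 a) (hη : 0 ≤ η) (hadd : η + ρ ≤ ξ) (hsub : η - ρ ≤ ξ) (hv : BddMeas v C) :
    ∫ t in (-η)..η, k.dualSol a (t + ρ) ξ (v t + k.truncConv η v t) =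
      (∫ t in (-η)..η, v t) -
        (∫ t in (-ξ)..(-η + ρ), k.dualSol a t ξ (k.truncConv η v (t - ρ))) -
        ∫ t in (η + ρ)..ξ, k.dualSol a t ξ (k.truncConv η v (t - ρ)) := by
  have : CompleteSpace E := FiniteDimensional.complete ℂ E
  have hshift := hk.integral_dualSol_truncConv_shift hξ hη hadd hsub hv
  have hq : Continuous fun t => k.dualSol a t ξ :=
    hk.continuous_dualSol continuous_id continuous_const
  have hqρ : Continuous fun t => k.dualSol a (t + ρ) ξ := hq.comp (by fun_prop)
  set w := k.truncConv η v
  have hw : Continuous w := continuous_truncConv hv η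
  have hle : -η ≤ η := by linarith
  have hfin : volume (Ioc (-η) η) ≠ ⊤ := by simp
  have hvint : IntervalIntegrable v volume (-η) η :=
    (intervalIntegrable_iff_integrableOn_Ioc_of_le hle).2 (hv.integrableOn hfin)
  have hqv : IntervalIntegrable (fun t => k.dualSol a (t + ρ) ξ (v t)) volume (-η) η :=
    (intervalIntegrable_iff_integrableOn_Ioc_of_le hle).2 <|
      (bddMeas_apply ⟨hqρ.aestronglyMeasurable, fun s => (k.bddMeas_dualSol a ξ).norm_le _⟩
        hv).integrableOn hfin
  have hqw : ∀ c d, IntervalIntegrable (fun t => k.dualSol a t ξ (w (t - ρ))) volume c d :=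
    (hq.clm_apply (hw.comp (by fun_prop))).intervalIntegrable
  have hsubst := intervalIntegral.integral_comp_add_right
    (fun t => k.dualSol a t ξ (w (t - ρ))) (a := -η) (b := η) ρ
  simp only [add_sub_cancel_right] at hsubst
  rw [intervalIntegral.integral_sub hvint hqv,
    ← intervalIntegral.integral_add_adjacent_intervals (hqw (-ξ) (-η + ρ)) (hqw _ ξ),
    ← intervalIntegral.integral_add_adjacent_intervals (hqw (-η + ρ) (η + ρ)) (hqw _ ξ)] at hshift
  simp only [map_add]
  rw [intervalIntegral.integral_add hqv ((hqρ.clm_apply hw).intervalIntegrable _ _), hsubst,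
    sub_eq_iff_eq_add.1 hshift.symm]
  abel

/- Shifting the kernel past `q*` leaves only the boundary layers of width `2 r` at `±ξ`; this is
what makes the symmetric differences of `q*` computable although `q*` need not be differentiable. -/
theorem integral_dualSol_difference (hk : k.Regular a) {ξ r : ℝ} (hξ : ξ ∈ Icc 0 a) (hr : 0 ≤ r)
    (hrξ : r ≤ ξ) (hv : BddMeas v C) :
    ∫ t in (-(ξ - r))..(ξ - r), (k.dualSol a (t + r) ξ - k.dualSol a (t - r) ξ)
        (v t + k.truncConv (ξ - r) v t) =
      (∫ t in (ξ - 2 * r)..(ξ - 2 * r + 2 * r),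
        k.dualSol a t ξ (k.truncConv (ξ - r) v (t + r))) -
      ∫ t in (-ξ)..(-ξ + 2 * r), k.dualSol a t ξ (k.truncConv (ξ - r) v (t - r)) := by
  have hright := hk.integral_dualSol_shift_apply_add_truncConv hξ (η := ξ - r) (ρ := r)
    (by linarith) (by linarith) (by linarith) hv
  have hleft := hk.integral_dualSol_shift_apply_add_truncConv hξ (η := ξ - r) (ρ := -r)
    (by linarith) (by linarith) (by linarith) hv
  have hint : ∀ ρ, IntervalIntegrable
      (fun t => k.dualSol a (t + ρ) ξ (v t + k.truncConv (ξ - r) v t)) volume (-(ξ - r)) (ξ - r) :=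
    fun ρ => (intervalIntegrable_iff_integrableOn_Ioc_of_le (by linarith)).2 <|
      (bddMeas_apply ⟨((hk.continuous_dualSol continuous_id continuous_const).comp
        (continuous_add_const ρ)).aestronglyMeasurable, fun s => (k.bddMeas_dualSol a ξ).norm_le _⟩
        (hv.add (bddMeas_truncConv hv _))).integrableOn (by simp)
  have hneg := hint (-r)
  simp only [← sub_eq_add_neg, sub_neg_eq_add] at hneg hleft
  simp only [_root_.sub_apply]
  rw [intervalIntegral.integral_sub (hint r) hneg]
  rw [show -(ξ - r) - r = -ξ by ring, show ξ - r - r = ξ - 2 * r by ring,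
    intervalIntegral.integral_same, sub_zero] at hleft
  rw [show -(ξ - r) + r = -ξ + 2 * r by ring, sub_add_cancel, intervalIntegral.integral_same,
    sub_zero] at hright
  rw [hright, hleft, sub_add_cancel]
  abel

end Regular

variable (k a) in
/-- The functional of `w` that represents the integral `∫_{-ξ}^{ξ} dq*(s, ξ) u(s)` when `w` is the
truncated convolution of `u`. -/
def boundaryForm (ξ : ℝ) : SymmC a E →L[ℂ] E :=
  k.dualSol a ξ ξ ∘L
      ContinuousMap.evalCLM ℂ (projIcc (-a) a (SymmC.neg_le_self a) ξ) ∘L k.resolvent a ξ -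
    k.dualSol a (-ξ) ξ ∘L
      ContinuousMap.evalCLM ℂ (projIcc (-a) a (SymmC.neg_le_self a) (-ξ)) ∘L k.resolvent a ξ

theorem boundaryForm_apply (ξ : ℝ) (w : SymmC a E) : k.boundaryForm a ξ w =
    k.dualSol a ξ ξ ((k.resolvent a ξ w).extend ξ) -
      k.dualSol a (-ξ) ξ ((k.resolvent a ξ w).extend (-ξ)) := rfl

namespace Regular

variable [FiniteDimensional ℂ E]

theorem tendsto_integral_difference (hk : k.Regular a) {ξ : ℝ} (hξ : ξ ∈ Ioc 0 a)
    (hu : BddMeas u C) :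
    Tendsto (fun r => (2 * r)⁻¹ • ∫ t in (-(ξ - r))..(ξ - r),
      (k.dualSol a (t + r) ξ - k.dualSol a (t - r) ξ) (u t)) (𝓝[>] 0)
      (𝓝 (k.boundaryForm a ξ (k.truncLift a hu ξ))) := by
  have : CompleteSpace E := FiniteDimensional.complete ℂ E
  have hξ' : ξ ∈ Icc 0 a := Ioc_subset_Icc_self hξ
  have hq : Continuous fun t => k.dualSol a t ξ :=
    hk.continuous_dualSol continuous_id continuous_const
  set W : ℝ → ℝ → E := fun r => k.truncConv (ξ - r) (k.bddSol a hu (ξ - r))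
  have hW : ∀ r, Continuous (W r) := fun r => continuous_truncConv (bddMeas_bddSol hu _) _
  have hr : ∀ σ : ℝ, Tendsto (Prod.fst : ℝ × ℝ → ℝ) (𝓝[>] 0 ×ˢ 𝓝 σ) (𝓝 0) := fun σ =>
    tendsto_fst.mono_right nhdsWithin_le_nhds
  have hη : ∀ σ : ℝ, Tendsto (fun p : ℝ × ℝ => ξ - p.1) (𝓝[>] 0 ×ˢ 𝓝 σ) (𝓝[Icc 0 a] ξ) :=
    fun σ => tendsto_nhdsWithin_iff.2 ⟨by simpa using (hr σ).const_sub ξ,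
      (tendsto_fst.eventually (Ioo_mem_nhdsGT hξ.1)).mono fun p hp =>
        ⟨by linarith [hp.2], by linarith [hp.1, hξ.2]⟩⟩
  have hWlim : ∀ σ ∈ Icc (-a) a, ∀ x : ℝ × ℝ → ℝ, Tendsto x (𝓝[>] 0 ×ˢ 𝓝 σ) (𝓝 σ) →
      Tendsto (fun p : ℝ × ℝ => k.dualSol a p.2 ξ (W p.1 (x p))) (𝓝[>] 0 ×ˢ 𝓝 σ)
        (𝓝 (k.dualSol a σ ξ ((k.response a hu ξ).extend σ))) := fun σ hσ x hx =>
    (isBoundedBilinearMap_apply.continuous.tendsto (_, _)).comp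
      (((hq.tendsto σ).comp tendsto_snd).prodMk_nhds
        (hk.tendsto_truncConv_bddSol hu hξ' hσ (hη σ) hx))
  have hright := tendsto_average (Φ := fun r t => k.dualSol a t ξ (W r (t + r)))
    (c := fun r => ξ - 2 * r) (fun r => hq.clm_apply ((hW r).comp (by fun_prop)))
    (hWlim ξ ⟨by linarith [hξ.1, hξ.2], hξ.2⟩ (fun p => p.2 + p.1)
      (by simpa using tendsto_snd.add (hr ξ)))
    (eventually_mem_nhdsWithin.mono fun r hr => ⟨le_rfl, by linarith [mem_Ioi.1 hr]⟩)
  have hleft := tendsto_average (Φ := fun r t => k.dualSol a t ξ (W r (t - r)))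
    (c := fun _ => -ξ) (fun r => hq.clm_apply ((hW r).comp (by fun_prop)))
    (hWlim (-ξ) ⟨by linarith [hξ.2], by linarith [hξ.1, hξ.2]⟩ (fun p => p.2 - p.1)
      (by simpa using tendsto_snd.sub (hr (-ξ))))
    (eventually_mem_nhdsWithin.mono fun r hr => ⟨by linarith [mem_Ioi.1 hr], le_rfl⟩)
  refine (hright.sub hleft).congr' ?_
  filter_upwards [Ioo_mem_nhdsGT hξ.1] with r hr
  rw [← smul_sub, ← hk.integral_dualSol_difference hξ' hr.1.le hr.2.le
    (bddMeas_bddSol hu (ξ - r))]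
  congr 1
  refine intervalIntegral.integral_congr fun t ht => ?_
  rw [uIcc_of_le (by linarith [hr.2])] at ht
  have hta : t ∈ Icc (-a) a :=
    ⟨by linarith [ht.1, hr.1, hξ.2], by linarith [ht.2, hr.1, hξ.2]⟩
  have hη : ξ - r ∈ Icc 0 a := ⟨by linarith [hr.2], by linarith [hr.1, hξ.2]⟩
  simp only [hk.truncConv_bddSol hη hu hta, bddSol, sub_add_cancel]

theorem boundaryForm_indicator_Iic (hk : k.Regular a) {ξ : ℝ} (hξ : ξ ∈ Ioc 0 a) {y : ℝ}
    (hy : y ∈ Icc (-ξ) ξ) (x : E) :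
    k.boundaryForm a ξ (k.truncLift a (BddMeas.indicator_const (measurableSet_Iic (a := y)) x) ξ) =
      (k.dualSol a y ξ - k.dualSol a (-ξ) ξ) x := by
  have : CompleteSpace E := FiniteDimensional.complete ℂ E
  have hqx : Continuous fun t => k.dualSol a t ξ x :=
    (hk.continuous_dualSol continuous_id continuous_const).clm_apply continuous_const
  have hlim : ∀ σ, Tendsto (fun p : ℝ × ℝ => k.dualSol a p.2 ξ x) (𝓝[>] 0 ×ˢ 𝓝 σ)
      (𝓝 (k.dualSol a σ ξ x)) := fun σ => (hqx.tendsto σ).comp tendsto_snd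
  have hev : ∀ᶠ r in 𝓝[>] (0 : ℝ), r ∈ Ioo 0 ξ := Ioo_mem_nhdsGT hξ.1
  set m : ℝ → ℝ := fun r => max (-(ξ - r)) (min (ξ - r) y) with hm
  have hright := tendsto_average (c := fun r => m r - r) (fun _ => hqx) (hlim y)
    (hev.mono fun r hr => by
      simp only [hm, mem_Icc, mem_Ioo] at hy hr ⊢
      grind)
  have hleft := tendsto_average (c := fun _ => -ξ) (fun _ => hqx) (hlim (-ξ))
    (hev.mono fun r hr => ⟨by linarith [hr.1], le_rfl⟩)
  refine tendsto_nhds_unique (hk.tendsto_integral_difference hξ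
    (BddMeas.indicator_const (measurableSet_Iic (a := y)) x))
    ((hright.sub hleft).congr' (hev.mono fun r hr => ?_))
  have hcut := integral_apply_indicator_Iic
    (fun t => k.dualSol a (t + r) ξ - k.dualSol a (t - r) ξ) (b := -(ξ - r)) (c := ξ - r)
    (by linarith [hr.2]) y x
  simp only [hcut, ← smul_sub]
  simp only [_root_.sub_apply]
  rw [integral_shift_sub_shift hqx, show m r - r + 2 * r = m r + r by ring,
    show -(ξ - r) - r = -ξ by ring, show -(ξ - r) + r = -ξ + 2 * r by ring]

theorem boundaryForm_indicator_Ioc (hk : k.Regular a) {ξ : ℝ} (hξ : ξ ∈ Ioc 0 a) {y y' : ℝ}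
    (hy : y ∈ Icc (-ξ) ξ) (hy' : y' ∈ Icc (-ξ) ξ) (hle : y ≤ y') (x : E) :
    k.boundaryForm a ξ (k.truncLift a
        (BddMeas.indicator_const (measurableSet_Ioc (a := y) (b := y')) x) ξ) =
      (k.dualSol a y' ξ - k.dualSol a y ξ) x := by
  have hdiff : (Ioc y y').indicator (fun _ => x)
      = fun s => (Iic y').indicator (fun _ => x) s - (Iic y).indicator (fun _ => x) s := by
    rw [← Iic_sdiff_Iic, indicator_sdiff (Iic_subset_Iic.2 hle)]
    rfl
  have hlift : k.truncLift a (BddMeas.indicator_const (measurableSet_Ioc (a := y) (b := y')) x) ξ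
      = k.truncLift a (BddMeas.indicator_const (measurableSet_Iic (a := y')) x) ξ -
        k.truncLift a (BddMeas.indicator_const (measurableSet_Iic (a := y)) x) ξ := by
    rw [← truncLift_sub]
    simp only [truncLift, hdiff]
  rw [hlift, map_sub, hk.boundaryForm_indicator_Iic hξ hy', hk.boundaryForm_indicator_Iic hξ hy]
  simp only [_root_.sub_apply]
  abel

theorem boundaryForm_sum_indicator_Ioc (hk : k.Regular a) {ξ : ℝ} (hξ : ξ ∈ Ioc 0 a) {N : ℕ}
    {y : ℕ → ℝ} (hy : ∀ i ≤ N, y i ∈ Icc (-ξ) ξ) (hmono : ∀ i < N, y i ≤ y (i + 1))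
    (x : ℕ → E) :
    k.boundaryForm a ξ (k.truncLift a (BddMeas.sum (fun i =>
        BddMeas.indicator_const (measurableSet_Ioc (a := y i) (b := y (i + 1))) (x i))
          (Finset.range N)) ξ) =
      ∑ i ∈ Finset.range N, (k.dualSol a (y (i + 1)) ξ - k.dualSol a (y i) ξ) (x i) := by
  rw [truncLift_sum fun i => BddMeas.indicator_const measurableSet_Ioc (x i), map_sum]
  refine Finset.sum_congr rfl fun i hi => ?_
  have hi := Finset.mem_range.1 hi
  exact hk.boundaryForm_indicator_Ioc hξ (hy i hi.le) (hy (i + 1) hi) (hmono i hi) _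

theorem boundaryForm_truncLift_extend (hk : k.Regular a) [k.IsEven] {ξ : ℝ} (hξ : ξ ∈ Icc 0 a)
    (f : SymmC a E) : k.boundaryForm a ξ (k.truncLift a f.bddMeas_extend ξ) =
      (k.dualSol a ξ ξ (f.extend ξ) - k.dualSol a (-ξ) ξ (f.extend (-ξ))) -
        k.dualSol a ξ ξ ((k.resolvent a ξ f).extend ξ - (k.resolvent a ξ f).extend (-ξ)) := by
  have hres : k.resolvent a ξ (k.truncLift a f.bddMeas_extend ξ) = f - k.resolvent a ξ f :=
    (hk.op_resolvent hξ f).symm.trans (eq_sub_of_add_eq' (hk.resolvent_add_op hξ f))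
  rw [boundaryForm_apply, hres, hk.dualSol_neg hξ ξ]
  simp only [SymmC.extend_sub, map_sub]
  abel

theorem hasRSIntegral_dualSol (hk : k.Regular a) [k.IsEven] {ξ : ℝ} (hξ : ξ ∈ Ioc 0 a)
    (f : SymmC a E) :
    HasRSIntegral (fun s => k.dualSol a s ξ) f.extend (-ξ) ξ
      (k.dualSol a ξ ξ ((k.resolvent a ξ f).extend ξ - (k.resolvent a ξ f).extend (-ξ))) := by
  intro ε hε
  set K := ‖k.boundaryForm a ξ‖ * k.mass
  have hK : 0 < K + 1 := by have := k.mass_nonneg; positivity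
  obtain ⟨δ, hδ, huc⟩ := Metric.uniformContinuousOn_iff.1
    ((isCompact_Icc (a := -ξ) (b := ξ)).uniformContinuousOn_of_continuous
      f.continuous_extend.continuousOn) _ (div_pos hε hK)
  refine ⟨δ, hδ, fun N x τ hp => ?_⟩
  set y := tagPoints N x τ
  have hy0 : y 0 = -ξ := hp.first
  have hyN : y (N + 1) = ξ := (tagPoints_last ..).trans hp.last
  have hmono : ∀ i < N + 1, y i ≤ y (i + 1) := hp.tagPoints_le_succ
  have hy : ∀ i ≤ N + 1, y i ∈ Icc (-ξ) ξ := fun i hi =>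
    ⟨hy0 ▸ le_of_forall_le_succ hmono i.zero_le hi, hyN ▸ le_of_forall_le_succ hmono hi le_rfl⟩
  have hind := fun i => BddMeas.indicator_const (measurableSet_Ioc (a := y i) (b := y (i + 1)))
    (f.extend (x i))
  set step := BddMeas.sum hind (Finset.range (N + 1))
  have hclose : ∀ i < N + 1, ∀ s ∈ Ioc (y i) (y (i + 1)),
      ‖f.extend (x i) - f.extend s‖ ≤ ε / (K + 1) := fun i hi s hs => by
    rw [← dist_eq_norm]
    refine (huc _ (hp.mem_Icc (by omega)) s ⟨(hy i hi.le).1.trans hs.1.le,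
      hs.2.trans (hy (i + 1) hi).2⟩ ?_).le
    exact hp.abs_sub_lt_of_mem_Ioc_tagPoints hδ hi hs
  have hbound : ‖k.truncLift a step ξ - k.truncLift a f.bddMeas_extend ξ‖
      ≤ k.mass * (ε / (K + 1)) := by
    rw [← truncLift_sub]
    refine norm_truncLift_le _ (by positivity) fun s hs => ?_
    exact norm_sum_indicator_Ioc_sub_le hmono hclose (by rwa [hy0, hyN])
  have hdiff := ContinuousLinearMap.le_of_opNorm_le_of_le (k.boundaryForm a ξ) le_rfl hbound
  rw [map_sub, hk.boundaryForm_sum_indicator_Ioc hξ hy hmono,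
    hk.boundaryForm_truncLift_extend (Ioc_subset_Icc_self hξ)] at hdiff
  rw [rsSum_eq_sub_sum_tagPoints, hp.first, hp.last, norm_sub_rev]
  have hsmall : ‖k.boundaryForm a ξ‖ * (k.mass * (ε / (K + 1))) < ε := by
    rw [← mul_assoc, mul_div_assoc', div_lt_iff₀ hK]
    linarith
  refine lt_of_eq_of_lt (congrArg norm ?_) (hdiff.trans_lt hsmall)
  abel

end Regular

end IntegrableKernel

namespace SymmC

variable {a : ℝ} [ha : Fact (0 < a)] {E : Type*} [NormedAddCommGroup E]

theorem extend_neg_of_reflect {f : SymmC a E} (hf : f.reflect = -f) (t : ℝ) :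
    f.extend (-t) = -f.extend t := by
  rw [← extend_reflect, hf, extend_neg]

theorem integral_extend_of_reflect [NormedSpace ℝ E] {f : SymmC a E} (hf : f.reflect = -f)
    (r : ℝ) : ∫ s in (-r)..r, f.extend s = 0 := by
  have h := intervalIntegral.integral_comp_neg (a := -r) (b := r) f.extend
  simp only [extend_neg_of_reflect hf, neg_neg, intervalIntegral.integral_neg] at h
  have := IsAddTorsionFree.of_isTorsionFree ℝ E
  exact self_eq_neg.1 h.symm

theorem integral_extend_abs [NormedSpace ℝ E] {f : SymmC a E} (hf : f.reflect = -f)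
    (t b : ℝ) : ∫ s in |t|..b, f.extend s = ∫ s in t..b, f.extend s := by
  have hi : ∀ c d, IntervalIntegrable f.extend volume c d := f.continuous_extend.intervalIntegrable
  rcases abs_choice t with h | h
  · rw [h]
  · have hodd := integral_extend_of_reflect hf (-t)
    rw [neg_neg] at hodd
    rw [h, ← intervalIntegral.integral_add_adjacent_intervals (hi t (-t)) (hi _ b), hodd, zero_add]

theorem integrable_indicator_extend (g : SymmC a E) (ξ : ℝ) :
    Integrable ((Ioc (-ξ) ξ).indicator g.extend) :=
  g.bddMeas_extend.integrable_indicator measurableSet_Ioc (by simp)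

end SymmC

theorem bddMeas_primitive {E : Type*} [NormedAddCommGroup E] [NormedSpace ℝ E] {u : ℝ → E}
    (hu : Integrable u) (b : ℝ) : BddMeas (fun s => ∫ r in s..b, u r) (∫ r, ‖u r‖) := by
  refine ⟨?_, fun s => ?_⟩
  · have h := intervalIntegral.continuous_primitive
      (fun _ _ => hu.intervalIntegrable : ∀ c d, IntervalIntegrable u volume c d) b
    refine (h.neg.congr fun s => ?_).aestronglyMeasurable
    exact (intervalIntegral.integral_symm b s).symm
  · exact (intervalIntegral.norm_integral_le_integral_norm_uIoc (f := u)).trans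
      (setIntegral_le_integral hu.norm (ae_of_all _ fun _ => norm_nonneg _))

namespace IntegrableKernel

variable {E : Type*} [NormedAddCommGroup E] [NormedSpace ℂ E] {k : IntegrableKernel E}

theorem conv_eq_integral_apply_sub (u : ℝ → E) (t : ℝ) :
    k.conv u t = ∫ x, k x (u (t - x)) := by
  rw [conv, ← integral_sub_left_eq_self (fun x => k x (u (t - x))) volume t]
  simp only [sub_sub_cancel]

theorem setIntegral_conv {u : ℝ → E} (hu : Integrable u) (S : Set ℝ) :
    ∫ r in S, k.conv u r = ∫ x, ∫ r in S, k x (u (r - x)) := by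
  have hprod : Integrable (fun p : ℝ × ℝ => k p.2 (u (p.1 - p.2)))
      ((volume.restrict S).prod volume) := by
    have h := (Integrable.convolution_integrand (ContinuousLinearMap.id ℂ (E →L[ℂ] E))
      k.integrable hu).integrableOn (s := S ×ˢ univ)
    rwa [IntegrableOn, ← Measure.prod_restrict, Measure.restrict_univ] at h
  rw [← integral_integral_swap hprod]
  exact integral_congr_ae (ae_of_all _ fun r => conv_eq_integral_apply_sub u r)

theorem conv_primitive_sub [CompleteSpace E] {u : ℝ → E} (hu : Integrable u) (b : ℝ) {c t : ℝ}
    (hct : c ≤ t) :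
    k.conv (fun s => ∫ r in s..b, u r) t - k.conv (fun s => ∫ r in s..b, u r) c =
      -∫ r in Ioc c t, k.conv u r := by
  have hui : ∀ c d, IntervalIntegrable u volume c d := fun _ _ => hu.intervalIntegrable
  have hint : ∀ r, Integrable fun x => k x (∫ s in (r - x)..b, u s) := fun r => by
    simpa only [sub_sub_cancel] using
      (integrable_apply (k := k) (bddMeas_primitive hu b) r).comp_sub_left r
  rw [setIntegral_conv hu, conv_eq_integral_apply_sub, conv_eq_integral_apply_sub,
    ← integral_sub (hint t) (hint c), ← integral_neg]
  refine integral_congr_ae (ae_of_all _ fun x => ?_)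
  have hshift : IntegrableOn (fun r => u (r - x)) (Ioc c t) := (hu.comp_sub_right x).integrableOn
  simp only
  rw [ContinuousLinearMap.integral_comp_comm _ hshift, ← map_sub, ← map_neg,
    ← intervalIntegral.integral_of_le hct, intervalIntegral.integral_comp_sub_right,
    ← intervalIntegral.integral_add_adjacent_intervals (hui (c - x) (t - x)) (hui (t - x) b)]
  congr 1
  abel

variable {a : ℝ} [ha : Fact (0 < a)]

variable (k a) in
/-- The primitive `∫_t^ξ ψ_ξ` on `[-ξ, ξ]` of the solution `ψ_ξ` of the truncated equation, extended
to the line by cutting `ψ_ξ` off outside `[-ξ, ξ]`. -/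
def solPrimitive (f : SymmC a E) (ξ t : ℝ) : E :=
  ∫ s in t..a, (Ioc (-ξ) ξ).indicator (k.resolvent a ξ f).extend s

variable (k) in
theorem bddMeas_solPrimitive (f : SymmC a E) (ξ : ℝ) : BddMeas (k.solPrimitive a f ξ)
    (∫ r, ‖(Ioc (-ξ) ξ).indicator (k.resolvent a ξ f).extend r‖) :=
  bddMeas_primitive (SymmC.integrable_indicator_extend _ _) a

theorem solPrimitive_of_le (f : SymmC a E) {ξ t : ℝ} (hξ : ξ ≤ a) (h : ξ ≤ t) :
    k.solPrimitive a f ξ t = 0 :=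
  intervalIntegral.integral_zero_ae (ae_of_all _ fun _ hs =>
    indicator_of_notMem (fun hsξ => ((le_min h hξ).trans_lt hs.1).not_ge hsξ.2) _)

theorem solPrimitive_eq (f : SymmC a E) {ξ t : ℝ} (hξ : ξ ≤ a) (ht : t ∈ Icc (-ξ) ξ) :
    k.solPrimitive a f ξ t = ∫ s in t..ξ, (k.resolvent a ξ f).extend s := by
  have hi := SymmC.integrable_indicator_extend (k.resolvent a ξ f) ξ
  have hright := solPrimitive_of_le (k := k) f hξ le_rfl
  rw [solPrimitive] at hright ⊢
  rw [← intervalIntegral.integral_add_adjacent_intervals (b := ξ) hi.intervalIntegrable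
    hi.intervalIntegrable, hright, add_zero, intervalIntegral.integral_of_le ht.2,
    intervalIntegral.integral_of_le ht.2]
  exact setIntegral_congr_fun measurableSet_Ioc fun s hs =>
    indicator_of_mem (show s ∈ Ioc (-ξ) ξ from ⟨ht.1.trans_lt hs.1, hs.2⟩) _

variable (k a) in
/-- The inverse of `q(ξ, ξ)`. -/
def diagInv (ξ : ℝ) : E →L[ℂ] E := Ring.inverse (k.unitSol a ξ ξ)

theorem unitSol_diagInv {ξ : ℝ} (hu : IsUnit (k.unitSol a ξ ξ)) (x : E) :
    k.unitSol a ξ ξ (k.diagInv a ξ x) = x :=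
  congrArg (fun L : E →L[ℂ] E => L x) (Ring.mul_inverse_cancel _ hu)

theorem diagInv_unitSol {ξ : ℝ} (hu : IsUnit (k.unitSol a ξ ξ)) (x : E) :
    k.diagInv a ξ (k.unitSol a ξ ξ x) = x :=
  congrArg (fun L : E →L[ℂ] E => L x) (Ring.inverse_mul_cancel _ hu)

variable (k a) in
/-- The convolution over `shell ξ ξ'` of the primitive of the solution at `ξ'`. It is the error made
when the convolution of that primitive is truncated to `[-ξ, ξ]`. -/
def shellConv (f : SymmC a E) (ξ ξ' : ℝ) : SymmC a E :=
  SymmC.restrict a (k.conv ((shell ξ ξ').indicator (k.solPrimitive a f ξ')))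
    (continuous_conv ((k.bddMeas_solPrimitive f ξ').indicator (measurableSet_shell _ _)))

namespace Regular

variable {f : SymmC a E} {ξ ξ' : ℝ}

section Odd

variable [k.IsEven]

theorem resolvent_odd (hk : k.Regular a) (hξ : ξ ∈ Icc 0 a) (hf : f.reflect = -f) :
    (k.resolvent a ξ f).reflect = -k.resolvent a ξ f := by
  rw [← hk.resolvent_reflect hξ, hf, map_neg]

theorem solPrimitive_of_le_neg (hk : k.Regular a) (hξ : ξ ∈ Icc 0 a)
    (hf : f.reflect = -f) {t : ℝ} (ht : t ≤ -ξ) : k.solPrimitive a f ξ t = 0 := by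
  have hi := SymmC.integrable_indicator_extend (k.resolvent a ξ f) ξ
  have hleft := solPrimitive_eq (k := k) f hξ.2 (t := -ξ) ⟨le_rfl, by linarith [hξ.1]⟩
  rw [SymmC.integral_extend_of_reflect (hk.resolvent_odd hξ hf), solPrimitive] at hleft
  rw [solPrimitive, ← intervalIntegral.integral_add_adjacent_intervals (b := -ξ)
    hi.intervalIntegrable hi.intervalIntegrable, hleft, add_zero]
  refine intervalIntegral.integral_zero_ae (ae_of_all _ fun s hs => indicator_of_notMem ?_ _)
  rw [uIoc_of_le ht] at hs
  exact fun hsξ => hsξ.1.not_ge hs.2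

theorem solPrimitive_abs_self (hk : k.Regular a) (hf : f.reflect = -f) {t : ℝ}
    (ht : |t| ≤ a) : k.solPrimitive a f |t| t = 0 := by
  rcases le_total 0 t with h | h
  · exact solPrimitive_of_le f ht (abs_of_nonneg h).le
  · exact hk.solPrimitive_of_le_neg ⟨abs_nonneg t, ht⟩ hf (by rw [abs_of_nonpos h, neg_neg])

theorem truncConv_solPrimitive (hk : k.Regular a) (hξ : ξ ∈ Icc 0 a)
    (hf : f.reflect = -f) :
    k.truncConv ξ (k.solPrimitive a f ξ) = k.conv (k.solPrimitive a f ξ) := by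
  rw [truncConv]
  congr 1
  refine indicator_eq_self.2 fun t ht => ?_
  by_contra hn
  rw [mem_Ioc, not_and_or, not_lt, not_le] at hn
  rcases hn with h | h
  · exact ht (hk.solPrimitive_of_le_neg hξ hf h)
  · exact ht (solPrimitive_of_le f hξ.2 h.le)

theorem norm_solPrimitive_le (hk : k.Regular a) (hξ : ξ ∈ Icc 0 a)
    (hf : f.reflect = -f) {h s : ℝ} (hs : ξ - h ≤ |s|) (hsξ : |s| ≤ ξ) :
    ‖k.solPrimitive a f ξ s‖ ≤ ‖k.resolvent a ξ f‖ * h := by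
  rw [solPrimitive_eq f hξ.2 (abs_le.1 hsξ),
    ← SymmC.integral_extend_abs (hk.resolvent_odd hξ hf)]
  refine (intervalIntegral.norm_integral_le_of_norm_le_const fun r _ =>
    SymmC.norm_extend_le _ r).trans (mul_le_mul_of_nonneg_left ?_ (norm_nonneg _))
  rw [abs_of_nonneg (sub_nonneg.2 hsξ)]
  linarith

variable [CompleteSpace E]

/- Integrating the truncated equation: the primitive solves an equation whose right-hand side is
known up to an additive constant. -/
theorem exists_solPrimitive_add_conv (hk : k.Regular a) (hξ : ξ ∈ Icc 0 a)
    (hf : f.reflect = -f) : ∃ x : E, ∀ t ∈ Icc (-ξ) ξ,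
      k.solPrimitive a f ξ t + k.conv (k.solPrimitive a f ξ) t = x - ∫ s in 0..t, f.extend s := by
  refine ⟨k.conv (k.solPrimitive a f ξ) (-ξ) - ∫ s in (-ξ)..0, f.extend s, fun t ht => ?_⟩
  set ψ := k.resolvent a ξ f with hψ
  have hψi : ∀ c d, IntervalIntegrable ψ.extend volume c d := ψ.continuous_extend.intervalIntegrable
  have hfi : ∀ c d, IntervalIntegrable f.extend volume c d := f.continuous_extend.intervalIntegrable
  have hconv : k.conv (k.solPrimitive a f ξ) t - k.conv (k.solPrimitive a f ξ) (-ξ) =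
      -∫ r in Ioc (-ξ) t, k.conv ((Ioc (-ξ) ξ).indicator ψ.extend) r :=
    conv_primitive_sub (ψ.integrable_indicator_extend ξ) a ht.1
  have hequation : ∫ r in Ioc (-ξ) t, k.conv ((Ioc (-ξ) ξ).indicator ψ.extend) r
      = (∫ r in (-ξ)..t, f.extend r) - ∫ r in (-ξ)..t, ψ.extend r := by
    rw [← intervalIntegral.integral_sub (hfi _ _) (hψi _ _), intervalIntegral.integral_of_le ht.1]
    refine setIntegral_congr_fun measurableSet_Ioc fun r hr => eq_sub_of_add_eq' ?_
    exact hk.extend_resolvent_add hξ f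
      ⟨by linarith [hr.1, hξ.2], by linarith [hr.2, ht.2, hξ.2]⟩
  have hodd := SymmC.integral_extend_of_reflect (hk.resolvent_odd hξ hf) ξ
  rw [← hψ, ← intervalIntegral.integral_add_adjacent_intervals (hψi (-ξ) t) (hψi t ξ),
    hψ, ← solPrimitive_eq f hξ.2 ht] at hodd
  rw [eq_add_of_sub_eq hconv, hequation, eq_neg_of_add_eq_zero_right hodd,
    ← intervalIntegral.integral_add_adjacent_intervals (hfi (-ξ) 0) (hfi 0 t)]
  abel

theorem exists_solPrimitive_sub (hk : k.Regular a) (hξ : ξ ∈ Icc 0 a)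
    (hξ' : ξ' ∈ Icc 0 a) (hle : ξ ≤ ξ') (hf : f.reflect = -f) :
    ∃ x : E, ∀ t ∈ Icc (-ξ) ξ, k.solPrimitive a f ξ' t - k.solPrimitive a f ξ t =
      k.unitSol a t ξ x - (k.resolvent a ξ (k.shellConv a f ξ ξ')).extend t := by
  obtain ⟨x, hx⟩ := hk.exists_solPrimitive_add_conv hξ hf
  obtain ⟨x', hx'⟩ := hk.exists_solPrimitive_add_conv hξ' hf
  refine ⟨x' - x, fun t ht => ?_⟩
  have hb := k.bddMeas_solPrimitive f ξ
  have hb' := k.bddMeas_solPrimitive f ξ'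
  refine (hk.eq_extend_resolvent hξ (hb'.sub hb)
    (g := ContinuousMap.const _ (x' - x) - k.shellConv a f ξ ξ') (fun s hs => ?_) t ht).trans ?_
  · have hs' : s ∈ Icc (-ξ') ξ' := ⟨by linarith [hs.1], by linarith [hs.2]⟩
    have hsa : s ∈ Icc (-a) a := ⟨by linarith [hs.1, hξ.2], by linarith [hs.2, hξ.2]⟩
    have hshell : (k.shellConv a f ξ ξ').extend s =
        k.truncConv ξ' (k.solPrimitive a f ξ') s - k.truncConv ξ (k.solPrimitive a f ξ') s :=
      (SymmC.extend_restrict _ hsa).trans (truncConv_sub_truncConv hb' hle s).symm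
    simp only [truncConv_sub hb' hb, hk.truncConv_solPrimitive hξ hf, SymmC.extend_sub,
      SymmC.extend_const, hshell, hk.truncConv_solPrimitive hξ' hf, eq_sub_of_add_eq' (hx s hs),
      eq_sub_of_add_eq' (hx' s hs')]
    abel
  · rw [map_sub, SymmC.extend_sub]
    rfl

/- The constant in `exists_solPrimitive_sub` is read off at `t = ξ`, where the primitive at `ξ`
vanishes. -/
theorem solPrimitive_sub (hk : k.Regular a) (hξ : ξ ∈ Icc 0 a) (hξ' : ξ' ∈ Icc 0 a)
    (hle : ξ ≤ ξ') (hf : f.reflect = -f) (hu : IsUnit (k.unitSol a ξ ξ)) {t : ℝ}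
    (ht : t ∈ Icc (-ξ) ξ) :
    k.solPrimitive a f ξ' t - k.solPrimitive a f ξ t =
      k.unitSol a t ξ (k.diagInv a ξ (k.solPrimitive a f ξ' ξ +
        (k.resolvent a ξ (k.shellConv a f ξ ξ')).extend ξ)) -
      (k.resolvent a ξ (k.shellConv a f ξ ξ')).extend t := by
  obtain ⟨x, hx⟩ := hk.exists_solPrimitive_sub hξ hξ' hle hf
  have hdiag := hx ξ ⟨by linarith [hξ.1], le_rfl⟩
  rw [solPrimitive_of_le f hξ.2 le_rfl, sub_zero] at hdiag
  rw [hx t ht, hdiag, sub_add_cancel, diagInv_unitSol hu]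

theorem exists_norm_resolvent_shellConv_le (hk : k.Regular a) (hf : f.reflect = -f) {ε : ℝ}
    (hε : 0 < ε) : ∃ δ > 0, ∀ ξ ∈ Icc 0 a, ∀ ξ' ∈ Icc 0 a, ξ ≤ ξ' → ξ' - ξ < δ →
      ‖k.resolvent a ξ (k.shellConv a f ξ ξ')‖ ≤ ε * (ξ' - ξ) := by
  obtain ⟨K, hK, hres⟩ := hk.exists_norm_resolvent_le
  set M := K * (K * ‖f‖) with hM
  have hM0 : 0 < M + 1 := by positivity
  obtain ⟨δ, hδ, hmass⟩ := k.exists_setIntegral_norm_sub_lt (div_pos hε hM0)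
  refine ⟨δ / 2, by positivity, fun ξ hξ ξ' hξ' hle hlt => ?_⟩
  have hh : 0 ≤ ξ' - ξ := sub_nonneg.2 hle
  have hprim : ∀ r ∈ shell ξ ξ', ‖k.solPrimitive a f ξ' r‖ ≤ K * ‖f‖ * (ξ' - ξ) := fun r hr => by
    have hr := abs_mem_of_mem_shell hr
    refine (hk.norm_solPrimitive_le hξ' hf (h := ξ' - ξ) (by linarith [hr.1]) hr.2).trans ?_
    exact mul_le_mul_of_nonneg_right ((k.resolvent a ξ').le_of_opNorm_le (hres _) _) hh
  have hshell : ‖k.shellConv a f ξ ξ'‖ ≤ ε / (M + 1) * (K * ‖f‖ * (ξ' - ξ)) := by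
    refine (ContinuousMap.norm_le _ (by positivity)).2 fun s => ?_
    refine (norm_conv_indicator_le (measurableSet_shell _ _) hprim _).trans
      (mul_le_mul_of_nonneg_right (hmass _ ?_ _).le (by positivity))
    rw [volume_shell hξ.1 hle]
    exact (ENNReal.ofReal_lt_ofReal_iff hδ).2 (by linarith)
  refine (ContinuousLinearMap.le_of_opNorm_le_of_le _ (hres ξ) hshell).trans ?_
  calc K * (ε / (M + 1) * (K * ‖f‖ * (ξ' - ξ))) = ε * (ξ' - ξ) * (M / (M + 1)) := by
        rw [hM]; ring
    _ ≤ ε * (ξ' - ξ) := mul_le_of_le_one_right (by positivity) (by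
        rw [div_le_one hM0]; linarith)

end Odd

theorem exists_norm_solPrimitive_sub_smul_le [CompleteSpace E] (hk : k.Regular a)
    (f : SymmC a E) {ε : ℝ} (hε : 0 < ε) :
    ∃ δ > 0, ∀ ξ ∈ Icc 0 a, ∀ ξ' ∈ Icc 0 a, ξ ≤ ξ' → ξ' - ξ < δ →
      ‖k.solPrimitive a f ξ' ξ - (ξ' - ξ) • (k.resolvent a ξ f).extend ξ‖ ≤ ε * (ξ' - ξ) := by
  have hΦ : Continuous fun p : ℝ × ℝ × ℝ => (k.resolvent a p.2.2 f).extend p.1 :=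
    hk.continuous_sol f (by fun_prop) (by fun_prop)
  obtain ⟨δ, hδ, hclose⟩ := exists_norm_sub_diag_le (isCompact_Icc (a := 0) (b := a)) hΦ hε
  refine ⟨δ, hδ, fun ξ hξ ξ' hξ' hle hlt => ?_⟩
  have hdist : ∀ s ∈ Icc ξ ξ', dist s ξ < δ := fun s hs => by
    rw [Real.dist_eq, abs_of_nonneg (sub_nonneg.2 hs.1)]
    linarith [hs.2]
  rw [solPrimitive_eq f hξ'.2 ⟨by linarith [hξ.1, hξ'.1], hle⟩,
    intervalIntegral.integral_of_le hle]
  exact norm_setIntegral_Ioc_sub_le hle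
    ((k.resolvent a ξ' f).bddMeas_extend.integrableOn (by simp)) fun s hs =>
      hclose ξ hξ s ⟨hξ.1.trans hs.1, hs.2.trans hξ'.2⟩ ξ hξ ξ' hξ' (hdist s hs)
        (hdist ξ ⟨le_rfl, hle⟩) (hdist ξ' ⟨hle, le_rfl⟩)

variable [FiniteDimensional ℂ E]

theorem continuousOn_diagInv (hk : k.Regular a)
    (hu : ∀ ξ ∈ Icc 0 a, IsUnit (k.unitSol a ξ ξ)) : ContinuousOn (k.diagInv a) (Icc 0 a) := by
  have : CompleteSpace E := FiniteDimensional.complete ℂ E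
  intro ξ hξ
  obtain ⟨U, hU⟩ := hu ξ hξ
  have hinv := NormedRing.inverse_continuousAt (R := E →L[ℂ] E) U
  rw [hU] at hinv
  exact (ContinuousAt.comp (f := fun ξ => k.unitSol a ξ ξ) hinv
    (hk.continuous_unitSol continuous_id continuous_id).continuousAt).continuousWithinAt

theorem continuousOn_unitSol_comp_diagInv (hk : k.Regular a)
    (hu : ∀ ξ ∈ Icc 0 a, IsUnit (k.unitSol a ξ ξ)) (t : ℝ) :
    ContinuousOn (fun ξ => k.unitSol a t ξ ∘L k.diagInv a ξ) (Icc 0 a) :=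
  (hk.continuous_unitSol continuous_const continuous_id).continuousOn.clm_comp
    (hk.continuousOn_diagInv hu)

theorem continuousOn_unitSol_diagInv (hk : k.Regular a)
    (hu : ∀ ξ ∈ Icc 0 a, IsUnit (k.unitSol a ξ ξ)) (f : SymmC a E) (t : ℝ) :
    ContinuousOn (fun ξ => k.unitSol a t ξ (k.diagInv a ξ ((k.resolvent a ξ f).extend ξ)))
      (Icc 0 a) :=
  have : CompleteSpace E := FiniteDimensional.complete ℂ E
  (hk.continuousOn_unitSol_comp_diagInv hu t).clm_apply
    (hk.continuous_sol f continuous_id continuous_id).continuousOn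

variable [k.IsEven]

theorem hasDerivWithinAt_solPrimitive (hk : k.Regular a)
    (hu : ∀ ξ ∈ Icc 0 a, IsUnit (k.unitSol a ξ ξ)) (hf : f.reflect = -f) {t : ℝ}
    (hξ : ξ ∈ Icc |t| a) :
    HasDerivWithinAt (fun ξ => k.solPrimitive a f ξ t)
      (k.unitSol a t ξ (k.diagInv a ξ ((k.resolvent a ξ f).extend ξ))) (Icc |t| a) ξ := by
  have : CompleteSpace E := FiniteDimensional.complete ℂ E
  have hsub : Icc |t| a ⊆ Icc 0 a := Icc_subset_Icc_left (abs_nonneg t)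
  refine hasDerivWithinAt_of_increments (f' := fun ξ =>
    k.unitSol a t ξ (k.diagInv a ξ ((k.resolvent a ξ f).extend ξ)))
    ((hk.continuousOn_unitSol_diagInv hu f t).mono hsub) (fun ε hε => ?_) hξ
  obtain ⟨B, hB⟩ := (isCompact_Icc (a := 0) (b := a)).exists_bound_of_continuousOn
    (E := E →L[ℂ] E) (hk.continuousOn_unitSol_comp_diagInv hu t)
  have hB0 : 0 ≤ B := (norm_nonneg _).trans (hB 0 ⟨le_rfl, ha.out.le⟩)
  set ρ := ε / (2 * B + 1)
  have hρ : 0 < ρ := by positivity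
  obtain ⟨δ₁, hδ₁, hshell⟩ := hk.exists_norm_resolvent_shellConv_le hf hρ
  obtain ⟨δ₂, hδ₂, hdiag⟩ := hk.exists_norm_solPrimitive_sub_smul_le f hρ
  refine ⟨min δ₁ δ₂, lt_min hδ₁ hδ₂, fun ξ hξ ξ' hξ' hle hlt => ?_⟩
  have hR := hshell ξ (hsub hξ) ξ' (hsub hξ') hle (hlt.trans_le (min_le_left _ _))
  have hψ := hdiag ξ (hsub hξ) ξ' (hsub hξ') hle (hlt.trans_le (min_le_right _ _))
  set R := k.resolvent a ξ (k.shellConv a f ξ ξ')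
  set z := k.solPrimitive a f ξ' ξ - (ξ' - ξ) • (k.resolvent a ξ f).extend ξ + R.extend ξ with hz
  have hincr : k.solPrimitive a f ξ' t - k.solPrimitive a f ξ t - (ξ' - ξ) •
      k.unitSol a t ξ (k.diagInv a ξ ((k.resolvent a ξ f).extend ξ)) =
        (k.unitSol a t ξ ∘L k.diagInv a ξ) z - R.extend t := by
    rw [hk.solPrimitive_sub (hsub hξ) (hsub hξ') hle hf (hu ξ (hsub hξ)) (abs_le.1 hξ.1), hz,
      ContinuousLinearMap.comp_apply]
    simp only [map_add, map_sub, ContinuousLinearMap.map_smul_of_tower]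
    abel
  have hzρ : ‖z‖ ≤ 2 * ρ * (ξ' - ξ) :=
    (norm_add_le_of_le hψ ((SymmC.norm_extend_le _ _).trans hR)).trans_eq (by ring)
  rw [hincr]
  calc _ ≤ B * (2 * ρ * (ξ' - ξ)) + ρ * (ξ' - ξ) :=
        norm_sub_le_of_le (ContinuousLinearMap.le_of_opNorm_le_of_le _ (hB ξ (hsub hξ)) hzρ)
          ((SymmC.norm_extend_le _ _).trans hR)
    _ = ε * (ξ' - ξ) := by simp only [ρ]; field_simp

theorem integral_unitSol_diagInv (hk : k.Regular a)
    (hu : ∀ ξ ∈ Icc 0 a, IsUnit (k.unitSol a ξ ξ)) (hf : f.reflect = -f) {t : ℝ}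
    (ht : t ∈ Icc (-a) a) :
    ∫ ξ in |t|..a, k.unitSol a t ξ (k.diagInv a ξ ((k.resolvent a ξ f).extend ξ)) =
      ∫ s in t..a, (k.resolvent a a f).extend s := by
  have hta : |t| ≤ a := abs_le.2 ht
  have hd := fun ξ hξ => hk.hasDerivWithinAt_solPrimitive (t := t) (ξ := ξ) hu hf hξ
  rw [intervalIntegral.integral_eq_sub_of_hasDerivAt_of_le hta
    (fun ξ hξ => (hd ξ hξ).continuousWithinAt)
    (fun ξ hξ => (hd ξ (Ioo_subset_Icc_self hξ)).hasDerivAt (Icc_mem_nhds hξ.1 hξ.2))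
    (((hk.continuousOn_unitSol_diagInv hu f t).mono
      (Icc_subset_Icc_left (abs_nonneg t))).intervalIntegrable_of_Icc hta),
    solPrimitive_eq f le_rfl ht, hk.solPrimitive_abs_self hf hta, sub_zero]

end Regular

end IntegrableKernel

theorem Icc_neg_subset {a ξ : ℝ} (hξ : ξ ≤ a) : Icc (-ξ) ξ ⊆ Icc (-a) a :=
  Icc_subset_Icc (neg_le_neg hξ) hξ

theorem exists_bddMeas_indicator_Icc {E : Type*} [NormedAddCommGroup E] {u : ℝ → E} {c d : ℝ}
    (hu : ContinuousOn u (Icc c d)) : ∃ C, BddMeas ((Icc c d).indicator u) C := by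
  obtain ⟨C, hC⟩ := isCompact_Icc.exists_bound_of_continuousOn hu
  refine ⟨max C 0, (aestronglyMeasurable_indicator_iff measurableSet_Icc).2
    (hu.aestronglyMeasurable measurableSet_Icc), fun s => ?_⟩
  by_cases hs : s ∈ Icc c d
  · rw [indicator_of_mem hs]
    exact (hC s hs).trans (le_max_left _ _)
  · rw [indicator_of_notMem hs, norm_zero]
    exact le_max_right _ _

/-- The element of `C([-a, a])` defined by a function on the line that is continuous there. -/
def SymmC.ofContinuousOn {a : ℝ} {E : Type*} [TopologicalSpace E] {f : ℝ → E}
    (hf : ContinuousOn f (Icc (-a) a)) : SymmC a E :=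
  ⟨(Icc (-a) a).domRestrict f, hf.domRestrict⟩

theorem SymmC.extend_ofContinuousOn {a : ℝ} [Fact (0 < a)] {E : Type*} [TopologicalSpace E]
    {f : ℝ → E} (hf : ContinuousOn f (Icc (-a) a)) {t : ℝ} (ht : t ∈ Icc (-a) a) :
    (SymmC.ofContinuousOn hf).extend t = f t := SymmC.extend_apply _ ht

namespace IntegrableKernel

section Decomposition

variable {E : Type*} [NormedAddCommGroup E] [NormedSpace ℂ E] {k : IntegrableKernel E} {a : ℝ}
  [ha : Fact (0 < a)] {t ξ : ℝ}

theorem Regular.eqOn_extend_resolvent (hk : k.Regular a) (hξ : ξ ∈ Icc 0 a) {v : ℝ → E}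
    (hv : ContinuousOn v (Icc (-ξ) ξ)) {g : SymmC a E}
    (h : ∀ t ∈ Icc (-ξ) ξ, v t + k.truncConv ξ v t = g.extend t) :
    EqOn v (k.resolvent a ξ g).extend (Icc (-ξ) ξ) := by
  obtain ⟨C, hC⟩ := exists_bddMeas_indicator_Icc hv
  intro t ht
  rw [← indicator_of_mem ht v]
  refine hk.eq_extend_resolvent hξ hC (fun t ht => ?_) t ht
  rw [indicator_of_mem ht, ← h t ht,
    truncConv_congr fun s hs => indicator_of_mem (Ioc_subset_Icc_self hs) v]

theorem Regular.resolvent_add_reflect [k.IsEven] (hk : k.Regular a) (hξ : ξ ∈ Icc 0 a)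
    (f : SymmC a E) (t : ℝ) : (k.resolvent a ξ (f + f.reflect)).extend t =
      (k.resolvent a ξ f).extend t + (k.resolvent a ξ f).extend (-t) := by
  simp only [map_add, hk.resolvent_reflect hξ, SymmC.extend_add, SymmC.extend_reflect]

theorem Regular.resolvent_sub_reflect [k.IsEven] (hk : k.Regular a) (hξ : ξ ∈ Icc 0 a)
    (f : SymmC a E) (t : ℝ) : (k.resolvent a ξ (f - f.reflect)).extend t =
      (k.resolvent a ξ f).extend t - (k.resolvent a ξ f).extend (-t) := by
  simp only [map_sub, hk.resolvent_reflect hξ, SymmC.extend_sub, SymmC.extend_reflect]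

variable (k a) in
/-- The density `F(ξ) = q(ξ, ξ)⁻¹ (ψ(ξ) + ψ(-ξ))`, where `ψ` solves the truncated equation on
`[-ξ, ξ]` with right-hand side `f`. -/
def density (f : SymmC a E) (ξ : ℝ) : E :=
  k.diagInv a ξ ((k.resolvent a ξ f).extend ξ + (k.resolvent a ξ f).extend (-ξ))

variable (k a) in
/-- The value `q*(ξ, ξ) (ψ(ξ) - ψ(-ξ))` of `∫_{-ξ}^{ξ} q*(s, ξ) df(s)`, where `ψ` solves the
truncated equation on `[-ξ, ξ]` with right-hand side `f`. -/
def stieltjesPairing (f : SymmC a E) (ξ : ℝ) : E :=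
  k.dualSol a ξ ξ ((k.resolvent a ξ f).extend ξ - (k.resolvent a ξ f).extend (-ξ))

variable (k a) in
/-- The value `q(t, a) F(a) - (φ(t) + φ(-t))` of `∫_{|t|}^{a} q(t, ξ) dF(ξ)`, where `φ` solves the
equation on `[-a, a]` with right-hand side `f` and `F` is the density. -/
def densityIntegral (f : SymmC a E) (t : ℝ) : E :=
  k.unitSol a t a (k.density a f a) -
    ((k.resolvent a a f).extend t + (k.resolvent a a f).extend (-t))

variable [FiniteDimensional ℂ E]

theorem Regular.continuousOn_density (hk : k.Regular a)
    (hu : ∀ ξ ∈ Icc 0 a, IsUnit (k.unitSol a ξ ξ)) (f : SymmC a E) :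
    ContinuousOn (k.density a f) (Icc 0 a) :=
  have : CompleteSpace E := FiniteDimensional.complete ℂ E
  (hk.continuousOn_diagInv hu).clm_apply ((hk.continuous_sol f continuous_id continuous_id).add
    (hk.continuous_sol f continuous_neg continuous_id)).continuousOn

variable [k.IsEven]

theorem Regular.hasRSIntegral_density (hk : k.Regular a)
    (hu : ∀ ξ ∈ Icc 0 a, IsUnit (k.unitSol a ξ ξ)) (f : SymmC a E) (ht : t ∈ Icc (-a) a) :
    HasRSIntegral (fun ξ => k.unitSol a t ξ) (k.density a f) |t| a (k.densityIntegral a f t) := by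
  have hreflect : (f + f.reflect).reflect = f + f.reflect := by
    ext s
    change f _ + f _ = f _ + f _
    rw [add_comm]
    simp only [neg_neg]
  have h := hk.hasRSIntegral_unitSol hreflect (hk.continuousOn_density hu f) (fun ξ hξ => by
    rw [density, unitSol_diagInv (hu ξ hξ), hk.resolvent_add_reflect hξ]) ht
  rwa [hk.resolvent_add_reflect ⟨ha.out.le, le_rfl⟩] at h

theorem Regular.integral_unitSol_diagInv_sub (hk : k.Regular a)
    (hu : ∀ ξ ∈ Icc 0 a, IsUnit (k.unitSol a ξ ξ)) (f : SymmC a E) (ht : t ∈ Icc (-a) a) :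
    ∫ ξ in |t|..a, k.unitSol a t ξ (k.diagInv a ξ
      ((k.resolvent a ξ f).extend ξ - (k.resolvent a ξ f).extend (-ξ))) =
      ∫ s in t..a, ((k.resolvent a a f).extend s - (k.resolvent a a f).extend (-s)) := by
  have hreflect : (f - f.reflect).reflect = -(f - f.reflect) := by
    ext s
    change f _ - f _ = -(f _ - f _)
    simp only [neg_sub, neg_neg]
  have h := hk.integral_unitSol_diagInv hu hreflect ht
  simp only [hk.resolvent_sub_reflect (⟨ha.out.le, le_rfl⟩ : a ∈ Icc 0 a)] at h
  rw [← h]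
  refine intervalIntegral.integral_congr fun ξ hξ => ?_
  rw [uIcc_of_le (abs_le.2 ht)] at hξ
  simp only [hk.resolvent_sub_reflect (⟨(abs_nonneg t).trans hξ.1, hξ.2⟩ : ξ ∈ Icc 0 a)]

end Decomposition

end IntegrableKernel

/-- Square matrices as continuous operators. -/
def matCLM (n : ℕ) : Matrix (Fin n) (Fin n) ℂ ≃ₐ[ℂ] ((Fin n → ℂ) →L[ℂ] (Fin n → ℂ)) :=
  Matrix.toLinAlgEquiv'.trans (Module.End.toContinuousLinearMap (𝕜 := ℂ) (Fin n → ℂ))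

section MatrixOperators

variable {n : ℕ}

theorem matCLM_apply (A : Matrix (Fin n) (Fin n) ℂ) (x : Fin n → ℂ) : matCLM n A x = A *ᵥ x := rfl

theorem matCLM_symm_apply (L : (Fin n → ℂ) →L[ℂ] (Fin n → ℂ)) (i j : Fin n) :
    (matCLM n).symm L i j = L (Pi.single j 1) i := LinearMap.toMatrixAlgEquiv'_apply _ i j

theorem matCLM_symm_mulVec (L : (Fin n → ℂ) →L[ℂ] (Fin n → ℂ)) (x : Fin n → ℂ) :
    (matCLM n).symm L *ᵥ x = L x := by
  rw [← matCLM_apply, AlgEquiv.apply_symm_apply]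

/-- The `(i, j)` entry of an operator on `ℂⁿ`. -/
def entryCLM (i j : Fin n) : ((Fin n → ℂ) →L[ℂ] (Fin n → ℂ)) →L[ℂ] ℂ :=
  ContinuousLinearMap.proj i ∘L ContinuousLinearMap.apply ℂ (Fin n → ℂ) (Pi.single j 1)

theorem entryCLM_apply (i j : Fin n) (L : (Fin n → ℂ) →L[ℂ] (Fin n → ℂ)) :
    entryCLM i j L = (matCLM n).symm L i j := (matCLM_symm_apply L i j).symm

theorem entryCLM_matCLM (i j : Fin n) (A : Matrix (Fin n) (Fin n) ℂ) :
    entryCLM i j (matCLM n A) = A i j := by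
  rw [entryCLM_apply, AlgEquiv.symm_apply_apply]

theorem continuous_matCLM : Continuous (matCLM n) :=
  LinearMap.continuous_of_finiteDimensional (matCLM n).toLinearMap

theorem continuous_matCLM_symm : Continuous (matCLM n).symm :=
  continuous_matrix fun i j => (entryCLM i j).continuous.congr fun L => entryCLM_apply i j L

theorem integrable_matCLM {A : ℝ → Matrix (Fin n) (Fin n) ℂ}
    (hA : ∀ i j, Integrable fun t => A t i j) : Integrable fun t => matCLM n (A t) := by
  let L : (Fin n → Fin n → ℂ) →ₗ[ℂ] ((Fin n → ℂ) →L[ℂ] (Fin n → ℂ)) :=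
    (matCLM n).toLinearMap ∘ₗ (Matrix.ofLinearEquiv ℂ).toLinearMap
  exact (LinearMap.toContinuousLinearMap L).integrable_comp
    (Integrable.of_eval fun i => Integrable.of_eval fun j => hA i j)

theorem continuousOn_col {Q : ℝ → Matrix (Fin n) (Fin n) ℂ} {S : Set ℝ} (hQ : ContinuousOn Q S)
    (j : Fin n) : ContinuousOn (fun s => (Q s).col j) S :=
  continuousOn_pi.2 fun i => (continuous_id.matrix_elem i j).comp_continuousOn hQ

theorem HasRSIntegral.hasStieltjesIntegral {G : ℝ → Matrix (Fin n) (Fin n) ℂ}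
    {f : ℝ → Fin n → ℂ} {c d : ℝ} {L : Fin n → ℂ}
    (h : HasRSIntegral (fun s => matCLM n (G s)) f c d L) : HasStieltjesIntegral G f c d L :=
  fun ε hε => by
    obtain ⟨δ, hδ, hL⟩ := h ε hε
    exact ⟨δ, hδ, fun N x τ hc hd hp => hL N x τ ⟨hc, hd, fun k hk => (hp k hk).1,
      fun k hk => (hp k hk).2.1, fun k hk => (hp k hk).2.2⟩⟩

/-- The even part of a matrix function on `(-2a, 2a)`, extended by zero. -/
def evenPart (a : ℝ) (H : ℝ → Matrix (Fin n) (Fin n) ℂ) (t : ℝ) : Matrix (Fin n) (Fin n) ℂ :=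
  Matrix.of fun i j => (1 / 2 : ℂ) * ((Ioo (-2 * a) (2 * a)).indicator (fun t => H t i j) t +
    (Ioo (-2 * a) (2 * a)).indicator (fun t => H t i j) (-t))

variable {a : ℝ} {H : ℝ → Matrix (Fin n) (Fin n) ℂ}

/-- The kernel defined by an integrable matrix function on `(-2a, 2a)`. Passing to the even part
makes a function that is only almost everywhere even into an even one. -/
def symmKernel (H : ℝ → Matrix (Fin n) (Fin n) ℂ)
    (hH : ∀ i j, IntegrableOn (fun t => H t i j) (Ioo (-2 * a) (2 * a)) volume) :
    IntegrableKernel (Fin n → ℂ) where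
  toFun t := matCLM n (evenPart a H t)
  integrable := integrable_matCLM fun i j => by
    have h := (integrable_indicator_iff measurableSet_Ioo).2 (hH i j)
    exact (h.add h.comp_neg).const_mul _

instance (hH : ∀ i j, IntegrableOn (fun t => H t i j) (Ioo (-2 * a) (2 * a)) volume) :
    (symmKernel H hH).IsEven where
  even t := by simp only [symmKernel, evenPart, neg_neg, add_comm]

/-- The kernel `k` agrees almost everywhere with the matrix function `H` on `(-2a, 2a)`, where the
convolution equations on `[-a, a]` see it. -/
def IntegrableKernel.Represents (k : IntegrableKernel (Fin n → ℂ)) (a : ℝ)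
    (H : ℝ → Matrix (Fin n) (Fin n) ℂ) : Prop :=
  ∀ᵐ t, t ∈ Ioo (-2 * a) (2 * a) → k t = matCLM n (H t)

theorem symmKernel_represents
    (hH : ∀ i j, IntegrableOn (fun t => H t i j) (Ioo (-2 * a) (2 * a)) volume)
    (heven : ∀ᵐ t ∂(volume.restrict (Ioo (-2 * a) (2 * a))), H (-t) = H t) :
    (symmKernel H hH).Represents a H := by
  filter_upwards [(ae_restrict_iff' measurableSet_Ioo).1 heven] with t h ht
  have ht' : -t ∈ Ioo (-2 * a) (2 * a) := ⟨by linarith [ht.2], by linarith [ht.1]⟩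
  refine congrArg (matCLM n) (Matrix.ext fun i j => ?_)
  rw [evenPart, Matrix.of_apply, indicator_of_mem ht, indicator_of_mem ht', h ht]
  ring

end MatrixOperators

namespace IntegrableKernel

section Equations

variable {n : ℕ} {a : ℝ} {k : IntegrableKernel (Fin n → ℂ)} {H : ℝ → Matrix (Fin n) (Fin n) ℂ}
  {ξ t : ℝ}

theorem Represents.ae_apply_sub_left (hkH : k.Represents a H) (ht : t ∈ Icc (-a) a) (hξ : ξ ≤ a) :
    ∀ᵐ s, s ∈ Ioc (-ξ) ξ → k (t - s) = matCLM n (H (t - s)) := by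
  filter_upwards [(quasiMeasurePreserving_sub_left volume t).ae hkH, Measure.ae_ne volume a]
    with s h hsa hs
  have hlt : s < a := lt_of_le_of_ne (hs.2.trans hξ) hsa
  exact h ⟨by linarith [ht.1], by linarith [ht.2, hs.1]⟩

theorem Represents.ae_apply_sub_right (hkH : k.Represents a H) (ht : t ∈ Icc (-a) a)
    (hξ : ξ ≤ a) : ∀ᵐ s, s ∈ Ioc (-ξ) ξ → k (s - t) = matCLM n (H (s - t)) := by
  filter_upwards [(measurePreserving_sub_right volume t).quasiMeasurePreserving.ae hkH,
    Measure.ae_ne volume a] with s h hsa hs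
  have hlt : s < a := lt_of_le_of_ne (hs.2.trans hξ) hsa
  exact h ⟨by linarith [ht.2, hs.1], by linarith [ht.1]⟩

theorem Represents.truncConv_eq_integral (hkH : k.Represents a H) (ht : t ∈ Icc (-a) a)
    (hξ : ξ ∈ Icc 0 a) (u : ℝ → Fin n → ℂ) :
    k.truncConv ξ u t = ∫ s in (-ξ)..ξ, H (t - s) *ᵥ u s := by
  rw [intervalIntegral.integral_of_le (neg_le_self hξ.1), ← integral_indicator measurableSet_Ioc]
  refine integral_congr_ae ?_
  filter_upwards [hkH.ae_apply_sub_left ht hξ.2] with s hs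
  by_cases hm : s ∈ Ioc (-ξ) ξ
  · rw [indicator_of_mem hm, indicator_of_mem hm, hs hm, matCLM_apply]
  · rw [indicator_of_notMem hm, indicator_of_notMem hm, map_zero]

theorem Represents.truncConv_apply_eq_integral (hkH : k.Represents a H) (ht : t ∈ Icc (-a) a)
    (hξ : ξ ∈ Icc 0 a) {u : ℝ → Fin n → ℂ} (hu : ContinuousOn u (Icc (-ξ) ξ)) (i : Fin n) :
    k.truncConv ξ u t i = ∫ s in (-ξ)..ξ, (H (t - s) *ᵥ u s) i := by
  obtain ⟨C, hC⟩ := exists_bddMeas_indicator_Icc hu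
  rw [hkH.truncConv_eq_integral ht hξ, intervalIntegral.integral_of_le (neg_le_self hξ.1),
    intervalIntegral.integral_of_le (neg_le_self hξ.1), eval_integral]
  refine fun i => ((integrable_apply (k := k) hC t).eval i).integrableOn.congr ?_
  refine (ae_restrict_iff' measurableSet_Ioc).2 ?_
  filter_upwards [hkH.ae_apply_sub_left ht hξ.2] with s hs hm
  rw [hs hm, matCLM_apply, indicator_of_mem (Ioc_subset_Icc_self hm)]

theorem Represents.entry_dual_truncConv (hkH : k.Represents a H) (ht : t ∈ Icc (-a) a)
    (hξ : ξ ∈ Icc 0 a) {Q : ℝ → Matrix (Fin n) (Fin n) ℂ} (hQ : ContinuousOn Q (Icc (-ξ) ξ))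
    (i j : Fin n) :
    entryCLM i j (k.dual.truncConv ξ (fun s => matCLM n (Q s)) t) =
      ∫ s in (-ξ)..ξ, (Q s * H (s - t)) i j := by
  obtain ⟨C, hC⟩ := exists_bddMeas_indicator_Icc (continuous_matCLM.comp_continuousOn hQ)
  rw [truncConv_congr (u := fun s => matCLM n (Q s)) fun s hs =>
      (indicator_of_mem (Ioc_subset_Icc_self hs) (matCLM n ∘ Q)).symm,
    truncConv, conv, ← ContinuousLinearMap.integral_comp_comm _
    (integrable_apply (k := k.dual) (hC.indicator measurableSet_Ioc) t),
    intervalIntegral.integral_of_le (neg_le_self hξ.1), ← integral_indicator measurableSet_Ioc]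
  refine integral_congr_ae ?_
  filter_upwards [hkH.ae_apply_sub_right ht hξ.2] with s hs
  by_cases hm : s ∈ Ioc (-ξ) ξ
  · rw [indicator_of_mem hm, indicator_of_mem hm, indicator_of_mem (Ioc_subset_Icc_self hm),
      dual_apply, neg_sub, hs hm, Function.comp_apply]
    refine Eq.trans ?_ (entryCLM_matCLM i j (Q s * H (s - t)))
    rw [map_mul]
    rfl
  · rw [indicator_of_notMem hm, indicator_of_notMem hm, map_zero, map_zero]

theorem Represents.isTruncatedSol_iff (hkH : k.Represents a H) (hξ : ξ ∈ Icc 0 a)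
    {Q : ℝ → Matrix (Fin n) (Fin n) ℂ} :
    IsTruncatedSol H ξ Q ↔ ContinuousOn Q (Icc (-ξ) ξ) ∧ ∀ t ∈ Icc (-ξ) ξ, ∀ j,
      (Q t).col j + k.truncConv ξ (fun s => (Q s).col j) t = Pi.single j 1 := by
  refine and_congr_right fun hQ => forall₂_congr fun t ht => ?_
  refine forall_comm.trans (forall_congr' fun j => Iff.trans (forall_congr' fun i => ?_)
    funext_iff.symm)
  rw [Pi.add_apply, hkH.truncConv_apply_eq_integral (Icc_neg_subset hξ.2 ht) hξ
    (continuousOn_col hQ j), Matrix.one_apply, Pi.single_apply]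
  rfl

theorem Represents.isTruncatedSolStar_iff (hkH : k.Represents a H) (hξ : ξ ∈ Icc 0 a)
    {Q : ℝ → Matrix (Fin n) (Fin n) ℂ} :
    IsTruncatedSolStar H ξ Q ↔ ContinuousOn Q (Icc (-ξ) ξ) ∧ ∀ t ∈ Icc (-ξ) ξ,
      matCLM n (Q t) + k.dual.truncConv ξ (fun s => matCLM n (Q s)) t = 1 := by
  refine and_congr_right fun hQ => forall₂_congr fun t ht => ?_
  rw [← (matCLM n).symm.injective.eq_iff, ← Matrix.ext_iff]
  refine forall₂_congr fun i j => ?_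
  rw [← entryCLM_apply, map_add, entryCLM_matCLM, map_one,
    hkH.entry_dual_truncConv (Icc_neg_subset hξ.2 ht) hξ hQ]

variable [ha : Fact (0 < a)]

theorem Represents.isSystemSol_iff (hkH : k.Represents a H) {f φ : ℝ → Fin n → ℂ} :
    IsSystemSol H a f φ ↔ ContinuousOn φ (Icc (-a) a) ∧
      ∀ t ∈ Icc (-a) a, φ t + k.truncConv a φ t = f t := by
  refine and_congr_right fun _ => forall₂_congr fun t ht => ?_
  rw [hkH.truncConv_eq_integral ht ⟨ha.out.le, le_rfl⟩]

theorem Represents.isTruncatedSol_add_replicateCol (hkH : k.Represents a H) (hξ : ξ ∈ Icc 0 a)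
    {Q : ℝ → Matrix (Fin n) (Fin n) ℂ} (hQ : IsTruncatedSol H ξ Q) {u : SymmC a (Fin n → ℂ)}
    (hu : u + k.op a ξ u = 0) :
    IsTruncatedSol H ξ fun t => Q t + Matrix.replicateCol (Fin n) (u.extend t) := by
  rw [hkH.isTruncatedSol_iff hξ] at hQ ⊢
  refine ⟨hQ.1.add (continuous_matrix fun i _ =>
    (continuous_apply i).comp u.continuous_extend).continuousOn, fun t ht j => ?_⟩
  obtain ⟨C, hC⟩ := exists_bddMeas_indicator_Icc (continuousOn_col hQ.1 j)
  have hut : u.extend t + k.truncConv ξ u.extend t = 0 := by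
    rw [← extend_op ξ u (Icc_neg_subset hξ.2 ht)]
    exact congrArg (fun w : SymmC a (Fin n → ℂ) => w.extend t) hu
  have hsplit : k.truncConv ξ
      (fun s => (Q s + Matrix.replicateCol (Fin n) (u.extend s)).col j) t =
      k.truncConv ξ (fun s => (Q s).col j) t + k.truncConv ξ u.extend t := by
    rw [truncConv_congr fun s hs =>
      (indicator_of_mem (Ioc_subset_Icc_self hs) fun s => (Q s).col j).symm,
      ← truncConv_add hC u.bddMeas_extend]
    refine congrFun (truncConv_congr fun s hs => ?_) t
    rw [indicator_of_mem (Ioc_subset_Icc_self hs)]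
    rfl
  rw [hsplit, ← hQ.2 t ht j]
  refine Eq.trans ?_ (add_zero _)
  rw [← hut, add_add_add_comm]
  rfl

theorem op_eq_zero_of_eqOn {u : SymmC a (Fin n → ℂ)} (hu : ∀ s ∈ Icc (-ξ) ξ, u.extend s = 0) :
    k.op a ξ u = 0 := by
  ext1 t
  rw [op_apply, truncConv_congr (v := 0) fun s hs => hu s (Ioc_subset_Icc_self hs)]
  simp [truncConv, conv]

theorem Represents.regular_of_unique (hkH : k.Represents a H)
    {q : ℝ → ℝ → Matrix (Fin n) (Fin n) ℂ}
    (hq : ∀ ξ ∈ Ioc 0 a, IsTruncatedSol H ξ (fun t => q t ξ))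
    (hq_unique : ∀ ξ ∈ Ioc 0 a, ∀ Q : ℝ → Matrix (Fin n) (Fin n) ℂ,
      IsTruncatedSol H ξ Q → EqOn Q (fun t => q t ξ) (Icc (-ξ) ξ)) : k.Regular a := by
  refine fun ξ hξ => isUnit_one_add_op fun u hu => ?_
  suffices hop : k.op a ξ u = 0 by rwa [hop, add_zero] at hu
  rcases hξ.1.eq_or_lt with rfl | h0
  · rw [op_zero, _root_.zero_apply]
  refine op_eq_zero_of_eqOn fun t ht => funext fun i => ?_
  have h := hq_unique ξ ⟨h0, hξ.2⟩ _
    (hkH.isTruncatedSol_add_replicateCol hξ (hq ξ ⟨h0, hξ.2⟩) hu) ht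
  exact congrFun (congrFun (add_eq_left.1 h) i) i

theorem Regular.eq_unitSol_of_isTruncatedSol (hk : k.Regular a) (hkH : k.Represents a H)
    (hξ : ξ ∈ Icc 0 a) {Q : ℝ → Matrix (Fin n) (Fin n) ℂ} (hQ : IsTruncatedSol H ξ Q) :
    EqOn Q (fun t => (matCLM n).symm (k.unitSol a t ξ)) (Icc (-ξ) ξ) := by
  rw [hkH.isTruncatedSol_iff hξ] at hQ
  refine fun t ht => Matrix.ext fun i j => ?_
  refine Eq.trans ?_ (matCLM_symm_apply _ i j).symm
  exact congrFun (hk.eqOn_extend_resolvent hξ (continuousOn_col hQ.1 j)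
    (g := ContinuousMap.const _ (Pi.single j 1)) (fun t ht => hQ.2 t ht j) ht) i

variable (k a) in
/-- The matrix `q*(t, ξ)` solving the transposed truncated equation. -/
def starSol (t ξ : ℝ) : Matrix (Fin n) (Fin n) ℂ := (matCLM n).symm (k.dualSol a t ξ)

theorem Regular.isTruncatedSolStar_starSol (hk : k.Regular a) (hkH : k.Represents a H)
    (hξ : ξ ∈ Icc 0 a) : IsTruncatedSolStar H ξ fun t => k.starSol a t ξ := by
  refine (hkH.isTruncatedSolStar_iff hξ).2 ⟨(continuous_matCLM_symm.comp
    (hk.continuous_dualSol continuous_id continuous_const)).continuousOn, fun t ht => ?_⟩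
  simp only [starSol, AlgEquiv.apply_symm_apply]
  exact hk.dualSol_add hξ (Icc_neg_subset hξ.2 ht)

theorem Regular.eqOn_starSol_of_isTruncatedSolStar (hk : k.Regular a) (hkH : k.Represents a H)
    (hξ : ξ ∈ Icc 0 a) {Q : ℝ → Matrix (Fin n) (Fin n) ℂ} (hQ : IsTruncatedSolStar H ξ Q) :
    EqOn Q (fun t => k.starSol a t ξ) (Icc (-ξ) ξ) := by
  rw [hkH.isTruncatedSolStar_iff hξ] at hQ
  refine fun t ht => (AlgEquiv.symm_apply_apply (matCLM n) (Q t)).symm.trans ?_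
  exact congrArg _ (hk.dual.eqOn_extend_resolvent hξ (continuous_matCLM.comp_continuousOn hQ.1)
    (g := ContinuousMap.const _ 1) hQ.2 ht)

variable {f : ℝ → Fin n → ℂ}

theorem Regular.isSystemSol_resolvent (hk : k.Regular a) (hkH : k.Represents a H)
    (hf : ContinuousOn f (Icc (-a) a)) :
    IsSystemSol H a f (k.resolvent a a (SymmC.ofContinuousOn hf)).extend :=
  hkH.isSystemSol_iff.2 ⟨(SymmC.continuous_extend _).continuousOn, fun t ht => by
    rw [hk.extend_resolvent_add ⟨ha.out.le, le_rfl⟩ _ ht, SymmC.extend_ofContinuousOn hf ht]⟩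

theorem Regular.eqOn_resolvent_of_isSystemSol (hk : k.Regular a) (hkH : k.Represents a H)
    (hf : ContinuousOn f (Icc (-a) a)) {ψ : ℝ → Fin n → ℂ} (hψ : IsSystemSol H a f ψ) :
    EqOn ψ (k.resolvent a a (SymmC.ofContinuousOn hf)).extend (Icc (-a) a) := by
  obtain ⟨hc, heq⟩ := hkH.isSystemSol_iff.1 hψ
  refine hk.eqOn_extend_resolvent ⟨ha.out.le, le_rfl⟩ hc fun t ht => ?_
  rw [heq t ht, SymmC.extend_ofContinuousOn hf ht]

end Equations

end IntegrableKernel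

namespace IntegrableKernel

section Formula

variable {n : ℕ} {a : ℝ} [ha : Fact (0 < a)] {k : IntegrableKernel (Fin n → ℂ)} {ξ t : ℝ}
  {q : ℝ → ℝ → Matrix (Fin n) (Fin n) ℂ} {f : ℝ → Fin n → ℂ}

variable (k a) in
/-- The matrices `q(t, ξ)` solve the truncated equations with right-hand side `1`. Nothing is said
about `q(0, 0)` or about the values for `|t| > ξ`. -/
def IsUnitSolMatrix (q : ℝ → ℝ → Matrix (Fin n) (Fin n) ℂ) : Prop :=
  ∀ ξ ∈ Ioc 0 a, ∀ t ∈ Icc (-ξ) ξ, q t ξ = (matCLM n).symm (k.unitSol a t ξ)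

theorem IsUnitSolMatrix.mulVec (hq : k.IsUnitSolMatrix a q) (hξ : ξ ∈ Ioc 0 a)
    (ht : t ∈ Icc (-ξ) ξ) (x : Fin n → ℂ) : q t ξ *ᵥ x = k.unitSol a t ξ x := by
  rw [hq ξ hξ t ht, matCLM_symm_mulVec]

theorem IsUnitSolMatrix.mulVec_of_mem_Ioc (hq : k.IsUnitSolMatrix a q) (hξ : ξ ∈ Ioc |t| a)
    (x : Fin n → ℂ) : q t ξ *ᵥ x = k.unitSol a t ξ x :=
  hq.mulVec ⟨(abs_nonneg t).trans_lt hξ.1, hξ.2⟩ (abs_le.1 hξ.1.le) x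

theorem truncPairing_starSol (hf : ContinuousOn f (Icc (-a) a)) (hξ : ξ ∈ Icc 0 a) :
    truncPairing (k.starSol a) f ξ = k.pairing (SymmC.ofContinuousOn hf) ξ := by
  rw [truncPairing, pairing, intervalIntegral.integral_of_le (neg_le_self hξ.1)]
  refine setIntegral_congr_fun measurableSet_Ioc fun s hs => ?_
  simp only [starSol, matCLM_symm_mulVec,
    SymmC.extend_ofContinuousOn hf (Icc_neg_subset hξ.2 (Ioc_subset_Icc_self hs))]

variable [k.IsEven]

theorem Regular.pairing_const (hk : k.Regular a) (hξ : ξ ∈ Icc 0 a) (x : Fin n → ℂ) :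
    k.pairing (ContinuousMap.const (Icc (-a) a) x) ξ =
      (2 : ℂ) • ∫ s in 0..ξ, k.unitSol a s ξ x := by
  have hint : ∀ b d, IntervalIntegrable (fun s => k.unitSol a s ξ x) volume b d := fun b d =>
    ((hk.continuous_unitSol continuous_id continuous_const).clm_apply
      continuous_const).intervalIntegrable b d
  have hneg := intervalIntegral.integral_comp_neg (a := 0) (b := ξ) fun s => k.unitSol a s ξ x
  simp only [hk.unitSol_neg hξ, neg_zero] at hneg
  rw [hk.pairing_eq hξ, ← intervalIntegral.integral_of_le (neg_le_self hξ.1)]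
  simp only [← unitSol_apply]
  rw [← intervalIntegral.integral_add_adjacent_intervals (hint (-ξ) 0) (hint 0 ξ), ← hneg,
    two_smul]

theorem Regular.kreinM_apply (hk : k.Regular a) (hq : k.IsUnitSolMatrix a q) (hξ : ξ ∈ Icc 0 a)
    (i j : Fin n) : kreinM q ξ i j =
      (1 / 2 : ℂ) * k.pairing (ContinuousMap.const (Icc (-a) a) (Pi.single j 1)) ξ i := by
  have hcont : Continuous fun s => k.unitSol a s ξ (Pi.single j 1) :=
    (hk.continuous_unitSol continuous_id continuous_const).clm_apply continuous_const
  have hentry : kreinM q ξ i j = ∫ s in 0..ξ, k.unitSol a s ξ (Pi.single j 1) i := by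
    rw [kreinM, Matrix.of_apply, intervalIntegral.integral_of_le hξ.1,
      intervalIntegral.integral_of_le hξ.1]
    refine setIntegral_congr_fun measurableSet_Ioc fun s hs => ?_
    have h0 : 0 < ξ := hs.1.trans_le hs.2
    exact (congrFun (congrFun (hq ξ ⟨h0, hξ.2⟩ s ⟨by linarith [hs.1], hs.2⟩) i) j).trans
      (matCLM_symm_apply _ i j)
  have hproj := (ContinuousLinearMap.proj (R := ℂ) (φ := fun _ : Fin n => ℂ)
    i).intervalIntegral_comp_comm (hcont.intervalIntegrable (μ := volume) 0 ξ)
  simp only [ContinuousLinearMap.proj_apply] at hproj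
  rw [hentry, hproj, hk.pairing_const hξ, Pi.smul_apply, smul_eq_mul]
  ring

theorem Regular.hasDerivWithinAt_kreinM (hk : k.Regular a) (hq : k.IsUnitSolMatrix a q)
    (hξ : ξ ∈ Icc 0 a) (i j : Fin n) :
    HasDerivWithinAt (fun η => kreinM q η i j)
      ((matCLM n).symm (k.dualSol a ξ ξ ∘L k.unitSol a ξ ξ) i j) (Icc 0 a) ξ := by
  have h := (hasDerivWithinAt_pi.1 (hk.hasDerivWithinAt_pairing
    (ContinuousMap.const (Icc (-a) a) (Pi.single j 1)) hξ) i).const_mul (1 / 2 : ℂ)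
  rw [← unitSol_apply, ← unitSol_apply, hk.unitSol_neg hξ, ← two_smul ℂ, map_smul, Pi.smul_apply,
    smul_eq_mul, ← mul_assoc, one_div, inv_mul_cancel₀ two_ne_zero, one_mul] at h
  rw [matCLM_symm_apply]
  refine h.congr (fun η hη => ?_) ?_
  · rw [hk.kreinM_apply hq hη, one_div]
  · rw [hk.kreinM_apply hq hξ, one_div]

theorem Regular.kreinM'_eq (hk : k.Regular a) (hq : k.IsUnitSolMatrix a q) (hξ : ξ ∈ Icc 0 a) :
    kreinM' a q ξ = (matCLM n).symm (k.dualSol a ξ ξ ∘L k.unitSol a ξ ξ) :=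
  Matrix.ext fun i j => (hk.hasDerivWithinAt_kreinM hq hξ i j).derivWithin
    (uniqueDiffOn_Icc ha.out ξ hξ)

theorem Regular.isUnit_unitSol (hk : k.Regular a) (hq : k.IsUnitSolMatrix a q)
    (hξ : ξ ∈ Icc 0 a) (hdet : (kreinM' a q ξ).det ≠ 0) : IsUnit (k.unitSol a ξ ξ) := by
  have hmul : (matCLM n).symm (k.dualSol a ξ ξ ∘L k.unitSol a ξ ξ) =
      (matCLM n).symm (k.dualSol a ξ ξ) * (matCLM n).symm (k.unitSol a ξ ξ) :=
    map_mul (matCLM n).symm _ _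
  rw [hk.kreinM'_eq hq hξ, hmul, Matrix.det_mul] at hdet
  have hunit := (Matrix.isUnit_iff_isUnit_det _).2 (right_ne_zero_of_mul hdet).isUnit
  simpa using! hunit.map (matCLM n)

theorem Regular.inv_kreinM'_mulVec (hk : k.Regular a) (hq : k.IsUnitSolMatrix a q)
    (hξ : ξ ∈ Icc 0 a) (hdet : (kreinM' a q ξ).det ≠ 0) (w : Fin n → ℂ) :
    (kreinM' a q ξ)⁻¹ *ᵥ k.dualSol a ξ ξ w = k.diagInv a ξ w := by
  have hw : k.dualSol a ξ ξ w = kreinM' a q ξ *ᵥ k.diagInv a ξ w := by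
    rw [hk.kreinM'_eq hq hξ, matCLM_symm_mulVec, ContinuousLinearMap.comp_apply,
      unitSol_diagInv (hk.isUnit_unitSol hq hξ hdet)]
  rw [hw, Matrix.mulVec_mulVec, Matrix.nonsing_inv_mul _ hdet.isUnit, Matrix.one_mulVec]

theorem Regular.hasDerivWithinAt_truncPairing (hk : k.Regular a)
    (hf : ContinuousOn f (Icc (-a) a)) (hξ : ξ ∈ Icc 0 a) :
    HasDerivWithinAt (truncPairing (k.starSol a) f) (k.dualSol a ξ ξ
      ((k.resolvent a ξ (SymmC.ofContinuousOn hf)).extend ξ +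
      (k.resolvent a ξ (SymmC.ofContinuousOn hf)).extend (-ξ))) (Icc 0 a) ξ :=
  (hk.hasDerivWithinAt_pairing _ hξ).congr (fun _ hη => truncPairing_starSol hf hη)
    (truncPairing_starSol hf hξ)

theorem Regular.hasStieltjesIntegral_starSol (hk : k.Regular a)
    (hf : ContinuousOn f (Icc (-a) a)) (hξ : ξ ∈ Icc 0 a) :
    HasStieltjesIntegral (fun s => k.starSol a s ξ) f (-ξ) ξ
      (k.stieltjesPairing a (SymmC.ofContinuousOn hf) ξ) := by
  refine HasRSIntegral.hasStieltjesIntegral ?_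
  simp only [starSol, AlgEquiv.apply_symm_apply]
  rcases hξ.1.eq_or_lt with rfl | h0
  · simpa only [stieltjesPairing, neg_zero, sub_self, map_zero] using HasRSIntegral.refl _ f 0
  · exact (hk.hasRSIntegral_dualSol ⟨h0, hξ.2⟩ _).congr (fun s _ => rfl) fun s hs =>
      (SymmC.extend_ofContinuousOn hf (Icc_neg_subset hξ.2 hs)).symm

theorem Regular.kreinDensity_eq (hk : k.Regular a) (hq : k.IsUnitSolMatrix a q)
    (hf : ContinuousOn f (Icc (-a) a)) (hξ : ξ ∈ Icc 0 a) (hdet : (kreinM' a q ξ).det ≠ 0) :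
    kreinDensity a q (k.starSol a) f ξ = k.density a (SymmC.ofContinuousOn hf) ξ := by
  rw [kreinDensity, (hk.hasDerivWithinAt_truncPairing hf hξ).derivWithin
    (uniqueDiffOn_Icc ha.out ξ hξ), hk.inv_kreinM'_mulVec hq hξ hdet, density]

theorem Regular.potential_integrand_eq (hk : k.Regular a) (hq : k.IsUnitSolMatrix a q)
    (hdet : ∀ ξ ∈ Icc 0 a, (kreinM' a q ξ).det ≠ 0) (g : SymmC a (Fin n → ℂ))
    (hξ : ξ ∈ Ioc |t| a) :
    q t ξ *ᵥ ((kreinM' a q ξ)⁻¹ *ᵥ k.stieltjesPairing a g ξ) =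
      k.unitSol a t ξ (k.diagInv a ξ
        ((k.resolvent a ξ g).extend ξ - (k.resolvent a ξ g).extend (-ξ))) := by
  have hξ' : ξ ∈ Icc 0 a := ⟨(abs_nonneg t).trans hξ.1.le, hξ.2⟩
  rw [hq.mulVec_of_mem_Ioc hξ, stieltjesPairing, hk.inv_kreinM'_mulVec hq hξ' (hdet ξ hξ')]

variable (hk : k.Regular a) (hq : k.IsUnitSolMatrix a q)
  (hdet : ∀ ξ ∈ Icc 0 a, (kreinM' a q ξ).det ≠ 0)

include hk hq hdet

theorem Regular.intervalIntegrable_potential (g : SymmC a (Fin n → ℂ)) (ht : t ∈ Icc (-a) a) :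
    IntervalIntegrable (fun ξ => q t ξ *ᵥ ((kreinM' a q ξ)⁻¹ *ᵥ k.stieltjesPairing a g ξ))
      volume |t| a := by
  have hcont := (hk.continuousOn_unitSol_comp_diagInv
    (fun ξ hξ => hk.isUnit_unitSol hq hξ (hdet ξ hξ)) t).clm_apply
    ((hk.continuous_sol g continuous_id continuous_id).sub
      (hk.continuous_sol g continuous_neg continuous_id)).continuousOn
  refine ((hcont.mono (Icc_subset_Icc_left (abs_nonneg t))).intervalIntegrable_of_Icc
    (abs_le.2 ht)).congr fun ξ hξ => ?_
  rw [uIoc_of_le (abs_le.2 ht)] at hξ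
  exact (hk.potential_integrand_eq hq hdet g hξ).symm

theorem Regular.kreinPotential_eq (g : SymmC a (Fin n → ℂ)) (ht : t ∈ Icc (-a) a) :
    kreinPotential a q (k.stieltjesPairing a g) t =
      ∫ s in t..a, ((k.resolvent a a g).extend s - (k.resolvent a a g).extend (-s)) := by
  rw [← hk.integral_unitSol_diagInv_sub
    (fun ξ hξ => hk.isUnit_unitSol hq hξ (hdet ξ hξ)) g ht, kreinPotential,
    intervalIntegral.integral_of_le (abs_le.2 ht), intervalIntegral.integral_of_le (abs_le.2 ht)]
  exact setIntegral_congr_fun measurableSet_Ioc fun ξ hξ =>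
    hk.potential_integrand_eq hq hdet g hξ

theorem Regular.hasDerivWithinAt_kreinPotential (g : SymmC a (Fin n → ℂ))
    (ht : t ∈ Icc (-a) a) :
    HasDerivWithinAt (kreinPotential a q (k.stieltjesPairing a g))
      (-((k.resolvent a a g).extend t - (k.resolvent a a g).extend (-t))) (Icc (-a) a) t := by
  have hcont : Continuous fun s =>
      (k.resolvent a a g).extend s - (k.resolvent a a g).extend (-s) :=
    (SymmC.continuous_extend _).sub ((SymmC.continuous_extend _).comp continuous_neg)
  have hpot : ∀ s ∈ Icc (-a) a, kreinPotential a q (k.stieltjesPairing a g) s =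
      -∫ r in a..s, ((k.resolvent a a g).extend r - (k.resolvent a a g).extend (-r)) :=
    fun s hs => by
      rw [hk.kreinPotential_eq hq hdet g hs, intervalIntegral.integral_symm]
  exact (hcont.integral_hasStrictDerivAt a t).hasDerivAt.neg.hasDerivWithinAt.congr hpot
    (hpot t ht)

theorem Regular.hasRSIntegral_kreinDensity (hf : ContinuousOn f (Icc (-a) a))
    (ht : t ∈ Icc (-a) a) :
    HasRSIntegral (fun ξ => k.unitSol a t ξ) (kreinDensity a q (k.starSol a) f) |t| a
      (k.densityIntegral a (SymmC.ofContinuousOn hf) t) :=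
  (hk.hasRSIntegral_density (fun ξ hξ => hk.isUnit_unitSol hq hξ (hdet ξ hξ)) _ ht).congr
    (fun _ _ => rfl) fun ξ hξ => by
      have hξ' : ξ ∈ Icc 0 a := ⟨(abs_nonneg t).trans hξ.1, hξ.2⟩
      exact hk.kreinDensity_eq hq hf hξ' (hdet ξ hξ')

theorem Regular.hasStieltjesIntegral_kreinDensity (hf : ContinuousOn f (Icc (-a) a))
    (ht : t ∈ Icc (-a) a) :
    HasStieltjesIntegral (fun ξ => q t ξ) (kreinDensity a q (k.starSol a) f) |t| a
      (k.densityIntegral a (SymmC.ofContinuousOn hf) t) := by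
  have hcont : ContinuousOn (kreinDensity a q (k.starSol a) f) (Icc 0 a) :=
    (hk.continuousOn_density (fun ξ hξ => hk.isUnit_unitSol hq hξ (hdet ξ hξ)) _).congr
      fun ξ hξ => hk.kreinDensity_eq hq hf hξ (hdet ξ hξ)
  -- `q t ξ` is not controlled at `ξ = |t| = 0`, a single point that the integral does not see.
  refine ((hk.hasRSIntegral_kreinDensity hq hdet hf ht).congr_Ioc
    ((hcont _ ⟨abs_nonneg t, abs_le.2 ht⟩).mono (Icc_subset_Icc_left (abs_nonneg t)))
    (fun ξ hξ => ?_) fun _ _ => rfl).hasStieltjesIntegral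
  ext1 x
  exact hq.mulVec_of_mem_Ioc hξ x

theorem Regular.densityIntegral_eq_integral_deriv (hf : ContinuousOn f (Icc (-a) a))
    (ht : t ∈ Icc (-a) a)
    (hac : AbsolutelyContinuousOnInterval (kreinDensity a q (k.starSol a) f) 0 a) :
    IntervalIntegrable (fun ξ => q t ξ *ᵥ deriv (kreinDensity a q (k.starSol a) f) ξ)
        volume |t| a ∧
      k.densityIntegral a (SymmC.ofContinuousOn hf) t =
        ∫ ξ in |t|..a, q t ξ *ᵥ deriv (kreinDensity a q (k.starSol a) f) ξ := by
  have hta : |t| ≤ a := abs_le.2 ht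
  have hsub : uIcc |t| a ⊆ uIcc 0 a := by
    rw [uIcc_of_le hta, uIcc_of_le ha.out.le]
    exact Icc_subset_Icc_left (abs_nonneg t)
  have heq : EqOn (fun ξ => k.unitSol a t ξ (deriv (kreinDensity a q (k.starSol a) f) ξ))
      (fun ξ => q t ξ *ᵥ deriv (kreinDensity a q (k.starSol a) f) ξ) (Ioc |t| a) :=
    fun ξ hξ => (hq.mulVec_of_mem_Ioc hξ _).symm
  obtain ⟨hint, hval⟩ := (hk.hasRSIntegral_kreinDensity hq hdet hf ht).eq_integral_deriv hta
    (hk.continuous_unitSol continuous_const continuous_id) (hac.mono hsub)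
  refine ⟨hint.congr (by rwa [uIoc_of_le hta]), hval.trans ?_⟩
  rw [intervalIntegral.integral_of_le hta, intervalIntegral.integral_of_le hta]
  exact setIntegral_congr_fun measurableSet_Ioc heq

theorem Regular.extend_resolvent_eq_formula (hf : ContinuousOn f (Icc (-a) a))
    (ht : t ∈ Icc (-a) a) :
    (k.resolvent a a (SymmC.ofContinuousOn hf)).extend t =
      (1 / 2 : ℂ) • (q t a *ᵥ kreinDensity a q (k.starSol a) f a)
        - (1 / 2 : ℂ) • k.densityIntegral a (SymmC.ofContinuousOn hf) t
        - (1 / 2 : ℂ) • derivWithin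
          (kreinPotential a q (k.stieltjesPairing a (SymmC.ofContinuousOn hf))) (Icc (-a) a) t := by
  have haa : a ∈ Icc 0 a := ⟨ha.out.le, le_rfl⟩
  rw [(hk.hasDerivWithinAt_kreinPotential hq hdet _ ht).derivWithin
      (uniqueDiffOn_Icc (neg_lt_self ha.out) t ht), hq.mulVec ⟨ha.out, le_rfl⟩ ht,
    hk.kreinDensity_eq hq hf haa (hdet a haa), densityIntegral]
  module

end Formula

end IntegrableKernel

end

theorem theorem4p2 (n : ℕ) (a : ℝ) (ha : 0 < a)
    (H : ℝ → Matrix (Fin n) (Fin n) ℂ)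
    (hH : ∀ i j, IntegrableOn (fun t => H t i j) (Ioo (-2 * a) (2 * a)) volume)
    (heven : ∀ᵐ t ∂(volume.restrict (Ioo (-2 * a) (2 * a))), H (-t) = H t)
    (q : ℝ → ℝ → Matrix (Fin n) (Fin n) ℂ)
    (hq : ∀ ξ ∈ Ioc 0 a, IsTruncatedSol H ξ (fun t => q t ξ))
    (hq_unique : ∀ ξ ∈ Ioc 0 a, ∀ Q : ℝ → Matrix (Fin n) (Fin n) ℂ,
      IsTruncatedSol H ξ Q → EqOn Q (fun t => q t ξ) (Icc (-ξ) ξ))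
    (hdet : ∀ ξ ∈ Icc 0 a, (kreinM' a q ξ).det ≠ 0) :
    -- `M` really is differentiable
    (∀ ξ ∈ Icc 0 a, ∀ i j,
      DifferentiableWithinAt ℝ (fun η => kreinM q η i j) (Icc 0 a) ξ) ∧
    -- the transposed equation has a unique solution `p = q*` as well
    ∃ p : ℝ → ℝ → Matrix (Fin n) (Fin n) ℂ,
      (∀ ξ ∈ Ioc 0 a, IsTruncatedSolStar H ξ (fun t => p t ξ) ∧
        ∀ Q : ℝ → Matrix (Fin n) (Fin n) ℂ,
          IsTruncatedSolStar H ξ Q → EqOn Q (fun t => p t ξ) (Icc (-ξ) ξ)) ∧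
      ∀ f : ℝ → Fin n → ℂ, ContinuousOn f (Icc (-a) a) →
        ∃ φ : ℝ → Fin n → ℂ,
          -- `φ` is the unique continuous solution
          IsSystemSol H a f φ ∧
          (∀ ψ : ℝ → Fin n → ℂ, IsSystemSol H a f ψ → EqOn ψ φ (Icc (-a) a)) ∧
          -- all derivatives and integrals in the formula exist, and the formula holds
          (∀ ξ ∈ Icc 0 a, DifferentiableWithinAt ℝ (truncPairing p f) (Icc 0 a) ξ) ∧
          ∃ S : ℝ → Fin n → ℂ,
            (∀ ξ ∈ Icc 0 a, HasStieltjesIntegral (fun s => p s ξ) f (-ξ) ξ (S ξ)) ∧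
            ∀ t ∈ Icc (-a) a,
              IntervalIntegrable (fun ξ => q t ξ *ᵥ ((kreinM' a q ξ)⁻¹ *ᵥ S ξ)) volume |t| a ∧
              DifferentiableWithinAt ℝ (kreinPotential a q S) (Icc (-a) a) t ∧
              ∃ J : Fin n → ℂ,
                HasStieltjesIntegral (fun ξ => q t ξ) (kreinDensity a q p f) |t| a J ∧
                -- the first integral is the ordinary one as soon as that makes sense
                (AbsolutelyContinuousOnInterval (kreinDensity a q p f) 0 a →
                  IntervalIntegrable
                    (fun ξ => q t ξ *ᵥ deriv (kreinDensity a q p f) ξ) volume |t| a ∧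
                  J = ∫ ξ in |t|..a, q t ξ *ᵥ deriv (kreinDensity a q p f) ξ) ∧
                φ t = (1 / 2 : ℂ) • (q t a *ᵥ kreinDensity a q p f a)
                  - (1 / 2 : ℂ) • J
                  - (1 / 2 : ℂ) • derivWithin (kreinPotential a q S) (Icc (-a) a) t := by
  have : Fact (0 < a) := ⟨ha⟩
  have hkH := symmKernel_represents hH heven
  set k := symmKernel H hH
  have hk : k.Regular a := hkH.regular_of_unique hq hq_unique
  have hqk : k.IsUnitSolMatrix a q := fun ξ hξ =>
    hk.eq_unitSol_of_isTruncatedSol hkH (Ioc_subset_Icc_self hξ) (hq ξ hξ)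
  refine ⟨fun ξ hξ i j => (hk.hasDerivWithinAt_kreinM hqk hξ i j).differentiableWithinAt,
    k.starSol a, fun ξ hξ => ⟨hk.isTruncatedSolStar_starSol hkH (Ioc_subset_Icc_self hξ),
      fun Q hQ => hk.eqOn_starSol_of_isTruncatedSolStar hkH (Ioc_subset_Icc_self hξ) hQ⟩,
    fun f hf => ⟨(k.resolvent a a (SymmC.ofContinuousOn hf)).extend,
      hk.isSystemSol_resolvent hkH hf, fun ψ hψ => hk.eqOn_resolvent_of_isSystemSol hkH hf hψ,
      fun ξ hξ => (hk.hasDerivWithinAt_truncPairing hf hξ).differentiableWithinAt,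
      k.stieltjesPairing a (SymmC.ofContinuousOn hf),
      fun ξ hξ => hk.hasStieltjesIntegral_starSol hf hξ, fun t ht => ?_⟩⟩
  exact ⟨hk.intervalIntegrable_potential hqk hdet _ ht,
    (hk.hasDerivWithinAt_kreinPotential hqk hdet _ ht).differentiableWithinAt,
    k.densityIntegral a (SymmC.ofContinuousOn hf) t,
    hk.hasStieltjesIntegral_kreinDensity hqk hdet hf ht,
    hk.densityIntegral_eq_integral_deriv hqk hdet hf ht,
    hk.extend_resolvent_eq_formula hqk hdet hf ht⟩
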